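/- Let $n,m\ge 1$, $\theta\in\mathbb R^m$, and let $A=(a_{ij})\in\mathbb R^{n\times n}$ be an irreducible, aperiodic, doubly stochastic matrix such that $A^{\tau}A$ is irreducible. On a probability space let $\phi_{k,i}$ ($\mathbb R^m$-valued) and $\varepsilon_{k,i}$ (real, square integrable), $k\ge 0$, $1\le i\le n$, be random variables; put $V_k=(\varepsilon_{k,1},\dots,\varepsilon_{k,n})^{\tau}$, $\Phi_k=\mathrm{diag}\{\phi_{k,1},\dots,\phi_{k,n}\}$, $y_{k,i}=\theta^{\tau}\phi_{k,i}+\varepsilon_{k,i}$ and $\mathcal F_k=\sigma\{\phi_{j,i},\varepsilon_{j,i}:0\le j\le k,\ 1\le i\le n\}$. The diffusion Robbins–Monro algorithm with deterministic initial values $\theta_{0,i}\in\mathbb R^m$ and $\beta\in(\frac12,1-\alpha)$ is $$\beta_{k+1,i}=\theta_{k,i}+\frac{1}{(k+1)^{\beta}}\frac{\phi_{k,i}}{1+\|\phi_{k,i}\|^2}\bigl(y_{k,i}-\theta_{k,i}^{\tau}\phi_{k,i}\bigr),\qquad \theta_{k+1,i}=\sum_{j=1}^n a_{ij}\beta_{k+1,j},$$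 and $\widetilde\Theta_k=\mathrm{col}\{\theta_{k,1}-\theta,\dots,\theta_{k,n}-\theta\}\in\mathbb R^{mn}$. Noise assumption: the vectors $V_k$, $k\ge0$, are mutually independent, and there is a constant $M>0$ such that for all $i$, almost surely, $E(\varepsilon_{k,i}\mid\Phi_j,0\le j\le k)=0$ for all $k\ge 0$ and $E(\varepsilon_{k,i}^2\mid\Phi_j,0\le j\le k)\le M$ for all $k\ge1$. Excitation assumption: for some $c>0$ and $\alpha\in[0,\frac12)$, one of the following holds. (a) Almost surely $\inf_{k\ge1}k^{\alpha}\lambda_{\min}\bigl(E\bigl[\frac1n\sum_{i=1}^n\frac{\phi_{k,i}\phi_{k,i}^{\tau}}{1+\|\phi_{k,i}\|^2}\big|\mathcal F_{k-1}\bigr]\bigr)>c$, and moreover $E(V_k\mid\Phi_j,V_l,\ 0\le j\le k,\ 0\le l\le k-1)=0$ almost surely for all $k\ge 0$; in this case put $h=1$. (b) For some integer $h\ge1$, almost surely $\inf_{k\ge1}k^{\alpha}\lambda_{\min}\bigl(E\bigl[\frac1{nh}\sum_{i=1}^n\sum_{j=k}^{k+h-1}\frac{\phi_{j,i}\phi_{j,i}^{\tau}}{1+\|\phi_{j,i}\|^2}\big|\mathcal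 F_{k-1}\bigr]\bigr)>c$, and $\{\phi_{k,i}\}$ is independent of $\{\varepsilon_{k,i}\}$. Call $s\in(0,1)$ a contraction constant of $(A,h)$ if, in every dimension $m\ge 1$, for all random symmetric $m\times m$ matrices $0\le D_{k,i}\le I_m$ ($1\le k\le h$, $1\le i\le n$) on any probability space and every sub-$\sigma$-algebra $\mathcal F$, with $\psi_h=\prod_{k=h}^{1}(A\otimes I_m)\,\mathrm{diag}\{D_{k,1},\dots,D_{k,n}\}$, almost surely $$\lambda_{\min}\bigl(E[I_{mn}-\psi_h^{\tau}\psi_h\mid\mathcal F]\bigr)\ \ge\ s\,\lambda_{\min}\Bigl(E\Bigl[\sum_{k=1}^h\sum_{i=1}^n(I_m-D_{k,i}^2)\Big|\mathcal F\Bigr]\Bigr).$$ Then: (i) $E\|\widetilde\Theta_k\|^2\to0$ and $\|\widetilde\Theta_k\|\to0$ almost surely as $k\to\infty$. (ii) $(A,h)$ has a contraction constant $s\in(0,1)$, and for every such $s$ $$\limsup_{k\to\infty}k^{\beta-\alpha}E\|\widetilde\Theta_k\|^2\le\frac{M}{sc}.$$ If, in addition, $\sup_{k\ge1}E[(V_k^{\tau}V_k)^l\mid\Phi_j,0\le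 j\le k]<\infty$ almost surely for some $l>\frac1{\beta-\alpha}$, then for every $\varepsilon\in(0,\beta-\alpha-\frac1{l+1})$, $\|\widetilde\Theta_k\|^2=o(k^{-\varepsilon})$ almost surely. -/

import Mathlib

open MeasureTheory ProbabilityTheory Filter Topology
open scoped Matrix Kronecker

universe u

namespace DiffusionRM

noncomputable section

/-! ### Matrices -/

/-- The smallest eigenvalue of a (symmetric, nonempty) real matrix. -/
def lambdaMin {ι : Type*} [Fintype ι] [DecidableEq ι] (B : Matrix ι ι ℝ) : ℝ :=
  sInf {r : ℝ | Module.End.HasEigenvalue (Matrix.toLin' B) r}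

/-- Entrywise conditional expectation of a random matrix. -/
def condExpMatrix {ι Ω : Type*} [MeasurableSpace Ω] (P : Measure Ω) (F : MeasurableSpace Ω)
    (X : Ω → Matrix ι ι ℝ) (ω : Ω) : Matrix ι ι ℝ :=
  Matrix.of fun a b => (P[fun ω' => X ω' a b | F]) ω

/-- Aperiodicity of a nonnegative square matrix: for every index `i`, the greatest common divisor
of the lengths `k ≥ 1` of closed walks at `i` (those with `(A ^ k) i i > 0`) is `1`. -/
def IsAperiodic {n : ℕ} (A : Matrix (Fin n) (Fin n) ℝ) : Prop :=
  ∀ i : Fin n, ∀ d : ℕ, (∀ k : ℕ, 1 ≤ k → 0 < (A ^ k) i i → d ∣ k) → d = 1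

/-- The network assumption: the weighted adjacency matrix is an irreducible and aperiodic doubly
stochastic matrix, and `AᵀA` is irreducible. -/
structure NetworkAssumption {n : ℕ} (A : Matrix (Fin n) (Fin n) ℝ) : Prop where
  doublyStochastic : A ∈ doublyStochastic ℝ (Fin n)
  irreducible : A.IsIrreducible
  aperiodic : IsAperiodic A
  gram_irreducible : (Aᵀ * A).IsIrreducible

/-! ### The constant `s` of the contraction inequality -/

/-- `diag{D₁, …, Dₙ}` as a matrix indexed by (node, coordinate) pairs. -/
def blockDiag {n m : ℕ} (D : Fin n → Matrix (Fin m) (Fin m) ℝ) :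
    Matrix (Fin n × Fin m) (Fin n × Fin m) ℝ :=
  Matrix.of fun p q => if p.1 = q.1 then D p.1 p.2 q.2 else 0

/-- The products `ψ₀ = I`, `ψ_{k+1} = (A ⊗ I_m) diag{D_{k,1}, …, D_{k,n}} ψ_k`. -/
def psi {n m : ℕ} (A : Matrix (Fin n) (Fin n) ℝ) (D : ℕ → Fin n → Matrix (Fin m) (Fin m) ℝ) :
    ℕ → Matrix (Fin n × Fin m) (Fin n × Fin m) ℝ
  | 0 => 1
  | k + 1 => (A ⊗ₖ (1 : Matrix (Fin m) (Fin m) ℝ)) * blockDiag (D k) * psi A D k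

/-- `s` is a contraction constant of `(A, h)`: for every dimension `m`, every probability space,
every sub-σ-algebra `F` and all random symmetric matrices `0 ≤ D_{k,i} ≤ I_m`
(`k < h`, `i` a node), almost surely
`λ_min(E[I - ψ_hᵀ ψ_h | F]) ≥ s λ_min(E[∑_{k<h} ∑_i (I_m - D_{k,i}²) | F])`. -/
def IsContractionConstant {n : ℕ} (A : Matrix (Fin n) (Fin n) ℝ) (h : ℕ) (s : ℝ) : Prop :=
  ∀ (m : ℕ) (Ω : Type u) (F : MeasurableSpace Ω) [mΩ : MeasurableSpace Ω] (P : Measure Ω)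
    [IsProbabilityMeasure P] (D : ℕ → Fin n → Ω → Matrix (Fin m) (Fin m) ℝ),
    1 ≤ m → F ≤ mΩ →
    (∀ k i a b, Measurable fun ω => D k i ω a b) →
    (∀ k i ω, (D k i ω).PosSemidef ∧ (1 - D k i ω).PosSemidef) →
    ∀ᵐ ω ∂P,
      s * lambdaMin (condExpMatrix P F
            (fun ω' => ∑ k ∈ Finset.range h, ∑ i, (1 - D k i ω' * D k i ω')) ω) ≤
        lambdaMin (condExpMatrix P F
            (fun ω' => 1 - (psi A (fun k i => D k i ω') h)ᵀ * psi A (fun k i => D k i ω') h) ω)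

/-! ### The diffusion algorithm -/

/-- The observation `y_{k,i} = θᵀ φ_{k,i} + ε_{k,i}`. -/
def observation {Ω : Type*} {n m : ℕ} (θ : EuclideanSpace ℝ (Fin m))
    (φ : ℕ → Fin n → Ω → EuclideanSpace ℝ (Fin m)) (ε : ℕ → Fin n → Ω → ℝ)
    (k : ℕ) (i : Fin n) (ω : Ω) : ℝ :=
  inner ℝ θ (φ k i ω) + ε k i ω

/-- The adapt-then-combine diffusion strategy with gains `L_{k,i}` and initial estimates `θ_{0,i}`:
`β_{k+1,j} = θ_{k,j} + L_{k,j} (y_{k,j} - θ_{k,j}ᵀ φ_{k,j})`, `θ_{k+1,i} = ∑_j a_{ij} β_{k+1,j}`. -/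
def atcEstimate {Ω : Type*} {n m : ℕ} (A : Matrix (Fin n) (Fin n) ℝ)
    (φ : ℕ → Fin n → Ω → EuclideanSpace ℝ (Fin m)) (y : ℕ → Fin n → Ω → ℝ)
    (L : ℕ → Fin n → Ω → EuclideanSpace ℝ (Fin m)) (θ₀ : Fin n → EuclideanSpace ℝ (Fin m)) :
    ℕ → Fin n → Ω → EuclideanSpace ℝ (Fin m)
  | 0, i, _ => θ₀ i
  | k + 1, i, ω => ∑ j, A i j •
      (atcEstimate A φ y L θ₀ k j ω +
        (y k j ω - inner ℝ (atcEstimate A φ y L θ₀ k j ω) (φ k j ω)) • L k j ω)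

/-- The Robbins–Monro gain `L_{k,i} = (k+1)^{-β} φ_{k,i} / (1 + ‖φ_{k,i}‖²)`. -/
def rmGain {Ω : Type*} {n m : ℕ} (β : ℝ) (φ : ℕ → Fin n → Ω → EuclideanSpace ℝ (Fin m))
    (k : ℕ) (i : Fin n) (ω : Ω) : EuclideanSpace ℝ (Fin m) :=
  (1 / ((k : ℝ) + 1) ^ β * (1 / (1 + ‖φ k i ω‖ ^ 2))) • φ k i ω

/-- The stacked estimation error `col{θ_{k,1} - θ, …, θ_{k,n} - θ} ∈ ℝ^{nm}` of the diffusion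
Robbins–Monro algorithm. -/
def stackedError {Ω : Type*} {n m : ℕ} (A : Matrix (Fin n) (Fin n) ℝ) (β : ℝ)
    (θ : EuclideanSpace ℝ (Fin m)) (θ₀ : Fin n → EuclideanSpace ℝ (Fin m))
    (φ : ℕ → Fin n → Ω → EuclideanSpace ℝ (Fin m)) (ε : ℕ → Fin n → Ω → ℝ)
    (k : ℕ) (ω : Ω) : EuclideanSpace ℝ (Fin n × Fin m) :=
  WithLp.toLp 2 fun p =>
    atcEstimate A φ (observation θ φ ε) (rmGain β φ) θ₀ k p.1 ω p.2 - θ p.2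

/-! ### σ-algebras -/

/-- `σ(φ_{j,i} : 0 ≤ j ≤ k, i a node) = σ(Φ_j : 0 ≤ j ≤ k)`. -/
abbrev regressorSigma {Ω : Type*} {n m : ℕ} (φ : ℕ → Fin n → Ω → EuclideanSpace ℝ (Fin m)) (k : ℕ) :
    MeasurableSpace Ω :=
  ⨆ (j : ℕ) (_ : j ≤ k) (i : Fin n), MeasurableSpace.comap (φ j i) inferInstance

/-- `σ(ε_{j,i} : 0 ≤ j ≤ k - 1, i a node) = σ(V_j : 0 ≤ j ≤ k - 1)`. -/
abbrev pastNoiseSigma {Ω : Type*} {n : ℕ} (ε : ℕ → Fin n → Ω → ℝ) (k : ℕ) : MeasurableSpace Ω :=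
  ⨆ (j : ℕ) (_ : j < k) (i : Fin n), MeasurableSpace.comap (ε j i) inferInstance

/-- `𝓕_{k-1} = σ(φ_{j,i}, ε_{j,i} : 0 ≤ j ≤ k - 1, i a node)`. -/
abbrev pastSigma {Ω : Type*} {n m : ℕ} (φ : ℕ → Fin n → Ω → EuclideanSpace ℝ (Fin m))
    (ε : ℕ → Fin n → Ω → ℝ) (k : ℕ) : MeasurableSpace Ω :=
  (⨆ (j : ℕ) (_ : j < k) (i : Fin n), MeasurableSpace.comap (φ j i) inferInstance) ⊔
    pastNoiseSigma ε k

/-! ### Noise and excitation assumptions -/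

/-- The noise assumption: the vectors `V_k = (ε_{k,1}, …, ε_{k,n})` are square integrable and
mutually independent, and a.s. `E(ε_{k,i} | Φ_j, j ≤ k) = 0` for all `k`, and
`E(ε_{k,i}² | Φ_j, j ≤ k) ≤ M` for all `k ≥ 1`. -/
structure NoiseAssumption {Ω : Type*} [MeasurableSpace Ω] (P : Measure Ω) {n m : ℕ}
    (φ : ℕ → Fin n → Ω → EuclideanSpace ℝ (Fin m)) (ε : ℕ → Fin n → Ω → ℝ) (M : ℝ) : Prop where
  memLp : ∀ k i, MemLp (ε k i) 2 P
  independent : iIndepFun (fun (k : ℕ) (ω : Ω) (i : Fin n) => ε k i ω) P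
  centered : ∀ k i, ∀ᵐ ω ∂P, (P[ε k i | regressorSigma φ k]) ω = 0
  variance_le : ∀ k, 1 ≤ k → ∀ i, ∀ᵐ ω ∂P,
    (P[fun ω' => ε k i ω' ^ 2 | regressorSigma φ k]) ω ≤ M

/-- `E(ε_{k,i} | Φ_j, V_l, 0 ≤ j ≤ k, 0 ≤ l ≤ k - 1) = 0` a.s. for all `k` and `i`. -/
def NoiseCenteredGivenPast {Ω : Type*} [MeasurableSpace Ω] (P : Measure Ω) {n m : ℕ}
    (φ : ℕ → Fin n → Ω → EuclideanSpace ℝ (Fin m)) (ε : ℕ → Fin n → Ω → ℝ) : Prop :=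
  ∀ k i, ∀ᵐ ω ∂P, (P[ε k i | regressorSigma φ k ⊔ pastNoiseSigma ε k]) ω = 0

/-- `φ φᵀ / (1 + ‖φ‖²)`. -/
def normalizedOuter {m : ℕ} (x : EuclideanSpace ℝ (Fin m)) : Matrix (Fin m) (Fin m) ℝ :=
  Matrix.of fun a b => x a * x b / (1 + ‖x‖ ^ 2)

/-- One-step cooperative excitation: a.s.
`inf_{k ≥ 1} k^α λ_min(E[(1/n) ∑_i φ_{k,i} φ_{k,i}ᵀ / (1 + ‖φ_{k,i}‖²) | 𝓕_{k-1}]) > c`. -/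
def OneStepExcitation {Ω : Type*} [MeasurableSpace Ω] (P : Measure Ω) {n m : ℕ}
    (φ : ℕ → Fin n → Ω → EuclideanSpace ℝ (Fin m)) (ε : ℕ → Fin n → Ω → ℝ) (c α : ℝ) : Prop :=
  ∀ᵐ ω ∂P, c < ⨅ k : {k : ℕ // 1 ≤ k}, ((k : ℕ) : ℝ) ^ α *
    lambdaMin (condExpMatrix P (pastSigma φ ε k)
      (fun ω' => (1 / (n : ℝ)) • ∑ i, normalizedOuter (φ k i ω')) ω)

/-- `λ_k(h) = λ_min(E[(1/(nh)) ∑_i ∑_{j=k}^{k+h-1} φ_{j,i} φ_{j,i}ᵀ / (1 + ‖φ_{j,i}‖²) | 𝓕_{k-1}])`.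
-/
def excitationLevel {Ω : Type*} [MeasurableSpace Ω] (P : Measure Ω) {n m : ℕ}
    (φ : ℕ → Fin n → Ω → EuclideanSpace ℝ (Fin m)) (ε : ℕ → Fin n → Ω → ℝ) (h k : ℕ) (ω : Ω) : ℝ :=
  lambdaMin (condExpMatrix P (pastSigma φ ε k)
    (fun ω' => (1 / ((n : ℝ) * (h : ℝ))) •
      ∑ i, ∑ j ∈ Finset.Ico k (k + h), normalizedOuter (φ j i ω')) ω)

/-- Excitation over windows of length `h`: a.s. `inf_{k ≥ 1} k^α λ_k(h) > c`, and the regressors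
are independent of the noises. -/
structure WindowExcitation {Ω : Type*} [MeasurableSpace Ω] (P : Measure Ω) {n m : ℕ}
    (φ : ℕ → Fin n → Ω → EuclideanSpace ℝ (Fin m)) (ε : ℕ → Fin n → Ω → ℝ)
    (c α : ℝ) (h : ℕ) : Prop where
  excitation : ∀ᵐ ω ∂P,
    c < ⨅ k : {k : ℕ // 1 ≤ k}, ((k : ℕ) : ℝ) ^ α * excitationLevel P φ ε h k ω
  independent : IndepFun (fun (ω : Ω) (p : ℕ × Fin n) => φ p.1 p.2 ω)
    (fun (ω : Ω) (p : ℕ × Fin n) => ε p.1 p.2 ω) P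

/-- Bounded conditional noise moments of order `l`:
`sup_{k ≥ 1} E[(V_kᵀ V_k)^l | Φ_j, j ≤ k] < ∞` a.s. -/
structure BoundedNoiseMoments {Ω : Type*} [MeasurableSpace Ω] (P : Measure Ω) {n m : ℕ}
    (φ : ℕ → Fin n → Ω → EuclideanSpace ℝ (Fin m)) (ε : ℕ → Fin n → Ω → ℝ) (l : ℝ) : Prop where
  integrable : ∀ k, 1 ≤ k → Integrable (fun ω => (∑ i, ε k i ω ^ 2) ^ l) P
  bounded : ∀ᵐ ω ∂P, BddAbove (Set.range fun k : {k : ℕ // 1 ≤ k} =>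
    (P[fun ω' => (∑ i, ε (k : ℕ) i ω' ^ 2) ^ l | regressorSigma φ (k : ℕ)]) ω)

end

end DiffusionRM

-- Write `x k` for the stacked error. Because the rows of `A` sum to one, it satisfies a linear
-- recursion `x (k+1) = B k x k + g k v k`, where `B k` is a block diagonal matrix between 0 and 1
-- followed by averaging, hence a pathwise contraction, and `g k` has squared norm at most
-- `(stepSize β k)^2 / 4`. The analysis is done for the abstract recursion `IsContractiveRecursion`.
--
-- Contraction constant. The energy lost over a window controls two things: how much each local
-- matrix shrinks its own block, and, through the Dirichlet form of the connected matrix `Aᵀ * A`,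
-- how far the nodes disagree. So a window that dissipates little leaves all nodes near any chosen
-- initial node, and that one block then feels all the matrices of all nodes
-- (`exists_dissipation_bound`). This is an inequality of quadratic forms, so it survives
-- conditioning, and `exists_isContractionConstant` follows.
--
-- Mean square rate. Over a window, `x (k+h)` is a transition matrix applied to `x k` plus
-- accumulated noise. The cross term has mean zero because the noise is centered given a σ-algebra
-- that already contains the regressors of the window. Excitation and the contraction constant give
-- `u(k+h) ≤ (1 - b k^(-(α+β))) u(k) + C k^(-2β)` for `u(k) = E|x k|²`, with `b = s n h c / 2` and
-- `C = h n M / 4`. Then `k^(β-α) u(k)` is eventually at most `2C/b = M/(sc)` up to any positive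
-- error (`eventually_rpow_mul_le_of_recursion`).
--
-- Almost sure statements. For `l ≥ 1` the expansion `exists_rpow_expansion_bound` of `|x + y|^(2l)`
-- turns the same contraction into a recursion for moments of order `2l`, localized on events where
-- the conditional noise moments are at most a constant. After multiplication by `k^(δl)` the
-- localized powers form a nonnegative almost supermartingale with summable perturbation and
-- expectation tending to zero, so they vanish almost surely. Plain convergence is the case `l = 1`,
-- `δ = 0`; the rate uses the given `l`.

namespace DiffusionRM

-- Smallest eigenvalue and quadratic forms.

section LambdaMin

variable {ι : Type*} [Fintype ι] [DecidableEq ι]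

theorem setOf_hasEigenvalue_eq_spectrum (B : Matrix ι ι ℝ) :
    {r : ℝ | Module.End.HasEigenvalue (Matrix.toLin' B) r} = spectrum ℝ B := by
  ext r
  rw [Set.mem_ofPred_eq, Module.End.hasEigenvalue_iff_mem_spectrum, Matrix.spectrum_toLin']

theorem lambdaMin_le_of_mem_spectrum {B : Matrix ι ι ℝ} (hB : B.IsHermitian) {r : ℝ}
    (hr : r ∈ spectrum ℝ B) : lambdaMin B ≤ r := by
  rw [lambdaMin, setOf_hasEigenvalue_eq_spectrum]
  refine csInf_le ?_ hr
  rw [hB.spectrum_real_eq_range_eigenvalues]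
  exact (Set.finite_range _).bddBelow

/-- Shifting by the smallest eigenvalue leaves a Hermitian matrix with nonnegative spectrum. -/
theorem lambdaMin_mul_le {B : Matrix ι ι ℝ} (hB : B.IsHermitian) (x : ι → ℝ) :
    lambdaMin B * (x ⬝ᵥ x) ≤ x ⬝ᵥ B *ᵥ x := by
  have hC : (B - lambdaMin B • (1 : Matrix ι ι ℝ)).IsHermitian := by
    refine hB.sub ?_
    rw [Matrix.IsHermitian, Matrix.conjTranspose_smul, Matrix.conjTranspose_one]
    simp
  have hpsd : (B - lambdaMin B • (1 : Matrix ι ι ℝ)).PosSemidef := by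
    rw [hC.posSemidef_iff_eigenvalues_nonneg]
    intro i
    have h1 := hC.eigenvalues_mem_spectrum_real i
    have h2 : hC.eigenvalues i + lambdaMin B ∈ spectrum ℝ B := by
      have := spectrum.add_mem_add_iff (r := hC.eigenvalues i) (s := lambdaMin B)
        (a := B - lambdaMin B • (1 : Matrix ι ι ℝ)) |>.2 h1
      rwa [Algebra.algebraMap_eq_smul_one, add_sub_cancel] at this
    have h3 := lambdaMin_le_of_mem_spectrum hB h2
    simpa using h3
  have := hpsd.dotProduct_mulVec_nonneg x
  simp only [star_trivial, Matrix.sub_mulVec, dotProduct_sub, Matrix.smul_mulVec,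
    Matrix.one_mulVec, dotProduct_smul, smul_eq_mul] at this
  linarith

/-- Test the form on an eigenvector. A nonempty index is needed because `sInf ∅ = 0` would otherwise
be the value. -/
theorem le_lambdaMin [Nonempty ι] {B : Matrix ι ι ℝ} (hB : B.IsHermitian) {r : ℝ}
    (h : ∀ x : ι → ℝ, r * (x ⬝ᵥ x) ≤ x ⬝ᵥ B *ᵥ x) : r ≤ lambdaMin B := by
  refine le_csInf ?_ ?_
  · rw [setOf_hasEigenvalue_eq_spectrum]
    exact ⟨_, hB.eigenvalues_mem_spectrum_real (Classical.arbitrary ι)⟩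
  · intro t ht
    obtain ⟨v, hv⟩ := Module.End.HasEigenvalue.exists_hasEigenvector ht
    have h1 : B *ᵥ v = t • v := by simpa using hv.apply_eq_smul
    have h2 := h v
    rw [h1, dotProduct_smul, smul_eq_mul] at h2
    have h3 : 0 < v ⬝ᵥ v := by
      have : v ⬝ᵥ v ≠ 0 := fun h0 => hv.2 (dotProduct_self_eq_zero.1 h0)
      have h4 : 0 ≤ v ⬝ᵥ v := by
        simpa using dotProduct_star_self_nonneg v
      exact lt_of_le_of_ne h4 (Ne.symm this)
    exact le_of_mul_le_mul_right h2 h3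

end LambdaMin

-- Inequalities for matrices between 0 and 1.

section Quadratic

variable {ι : Type*} [Fintype ι]

theorem dotProduct_self_nonneg' (x : ι → ℝ) : 0 ≤ x ⬝ᵥ x := by
  simpa using dotProduct_star_self_nonneg x

theorem add_dotProduct_self (x y : ι → ℝ) :
    (x + y) ⬝ᵥ (x + y) = x ⬝ᵥ x + 2 * (x ⬝ᵥ y) + y ⬝ᵥ y := by
  rw [add_dotProduct, dotProduct_add, dotProduct_add, dotProduct_comm y x]
  ring

theorem sub_dotProduct_self (x y : ι → ℝ) :
    (x - y) ⬝ᵥ (x - y) = x ⬝ᵥ x - 2 * (x ⬝ᵥ y) + y ⬝ᵥ y := by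
  rw [sub_dotProduct, dotProduct_sub, dotProduct_sub, dotProduct_comm y x]
  ring

theorem sub_dotProduct_self_comm (x y : ι → ℝ) :
    (x - y) ⬝ᵥ (x - y) = (y - x) ⬝ᵥ (y - x) := by
  rw [sub_dotProduct_self, sub_dotProduct_self, dotProduct_comm y x]
  ring

theorem add_dotProduct_self_le (x y : ι → ℝ) :
    (x + y) ⬝ᵥ (x + y) ≤ 2 * (x ⬝ᵥ x) + 2 * (y ⬝ᵥ y) := by
  have := dotProduct_self_nonneg' (x - y)
  rw [sub_dotProduct_self] at this
  rw [add_dotProduct_self]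
  linarith

theorem sub_dotProduct_self_le_add (x y z : ι → ℝ) :
    (x - z) ⬝ᵥ (x - z) ≤ 2 * ((x - y) ⬝ᵥ (x - y)) + 2 * ((y - z) ⬝ᵥ (y - z)) := by
  have := add_dotProduct_self_le (x - y) (y - z)
  rwa [sub_add_sub_cancel] at this

theorem dotProduct_sq_le (x y : ι → ℝ) : (x ⬝ᵥ y) ^ 2 ≤ (x ⬝ᵥ x) * (y ⬝ᵥ y) := by
  have := Finset.sum_mul_sq_le_sq_mul_sq Finset.univ x y
  simpa [dotProduct, sq] using this

theorem dotProduct_self_sum (x : ι → ℝ) : x ⬝ᵥ x = ∑ i, x i ^ 2 := by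
  simp [dotProduct, sq]

theorem dotProduct_mulVec_comm {B : Matrix ι ι ℝ} (hB : B.IsHermitian) (x y : ι → ℝ) :
    x ⬝ᵥ B *ᵥ y = y ⬝ᵥ B *ᵥ x := by
  have h : Bᵀ = B := by simpa using hB.eq
  rw [Matrix.dotProduct_mulVec, ← Matrix.mulVec_transpose, h, dotProduct_comm]

theorem mulVec_dotProduct_self (B : Matrix ι ι ℝ) (x : ι → ℝ) :
    (B *ᵥ x) ⬝ᵥ (B *ᵥ x) = x ⬝ᵥ (Bᵀ * B) *ᵥ x := by
  rw [← Matrix.mulVec_mulVec, Matrix.dotProduct_mulVec x, Matrix.vecMul_transpose]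

variable [DecidableEq ι]

/-- `D² ≤ D` for `0 ≤ D ≤ 1`. -/
theorem mulVec_dotProduct_self_le {D : Matrix ι ι ℝ} (h0 : D.PosSemidef)
    (h1 : (1 - D).PosSemidef) (x : ι → ℝ) :
    (D *ᵥ x) ⬝ᵥ (D *ᵥ x) ≤ x ⬝ᵥ D *ᵥ x := by
  -- The identity behind the bound is `D - D² = D(1 - D)D + (1 - D)D(1 - D)`.
  set y := D *ᵥ x with hy
  have e1 := h1.dotProduct_mulVec_nonneg y
  have e2 := h0.dotProduct_mulVec_nonneg (x - y)
  simp only [star_trivial, Matrix.sub_mulVec, dotProduct_sub, Matrix.one_mulVec] at e1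
  simp only [star_trivial, Matrix.mulVec_sub, dotProduct_sub, sub_dotProduct] at e2
  have e3 := dotProduct_mulVec_comm h0.1 x y
  rw [← hy] at e2 e3
  rw [e3] at e2
  linarith

theorem mulVec_dotProduct_self_le_self {D : Matrix ι ι ℝ} (h0 : D.PosSemidef)
    (h1 : (1 - D).PosSemidef) (x : ι → ℝ) :
    (D *ᵥ x) ⬝ᵥ (D *ᵥ x) ≤ x ⬝ᵥ x := by
  have e1 := h1.dotProduct_mulVec_nonneg x
  simp only [star_trivial, Matrix.sub_mulVec, dotProduct_sub, Matrix.one_mulVec] at e1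
  linarith [mulVec_dotProduct_self_le h0 h1 x]

theorem sub_mulVec_dotProduct_self_le {D : Matrix ι ι ℝ} (h0 : D.PosSemidef)
    (h1 : (1 - D).PosSemidef) (x : ι → ℝ) :
    (x - D *ᵥ x) ⬝ᵥ (x - D *ᵥ x) ≤ x ⬝ᵥ x - (D *ᵥ x) ⬝ᵥ (D *ᵥ x) := by
  rw [sub_dotProduct_self]
  linarith [mulVec_dotProduct_self_le h0 h1 x]

theorem dotProduct_one_sub_sq_mulVec {D : Matrix ι ι ℝ} (h0 : D.IsHermitian) (x : ι → ℝ) :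
    x ⬝ᵥ (1 - D * D) *ᵥ x = x ⬝ᵥ x - (D *ᵥ x) ⬝ᵥ (D *ᵥ x) := by
  have h : Dᵀ = D := by simpa using h0.eq
  rw [mulVec_dotProduct_self, h, Matrix.sub_mulVec, Matrix.one_mulVec, dotProduct_sub]

/-- `x ↦ xᵀ (1 - D²) x` is a seminorm square dominated by the norm square. -/
theorem dotProduct_one_sub_sq_mulVec_le_add {D : Matrix ι ι ℝ} (h0 : D.PosSemidef)
    (h1 : (1 - D).PosSemidef) (x y : ι → ℝ) :
    y ⬝ᵥ (1 - D * D) *ᵥ y ≤ 2 * (x ⬝ᵥ x - (D *ᵥ x) ⬝ᵥ (D *ᵥ x)) + 2 * ((y - x) ⬝ᵥ (y - x)) := by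
  rw [dotProduct_one_sub_sq_mulVec h0.1]
  -- Parallelogram law for the form `q(u) = |u|² - |Du|²`: `q(y) + q(y - 2x) = 2q(x) + 2q(y - x)`,
  -- where `q(y - 2x) ≥ 0` and `q(y - x) ≤ |y - x|²`.
  have e := mulVec_dotProduct_self_le_self h0 h1 (y - (2 : ℝ) • x)
  have e2 := dotProduct_self_nonneg' (D *ᵥ (y - x))
  simp only [Matrix.mulVec_sub, Matrix.mulVec_smul] at e e2
  simp only [sub_dotProduct, dotProduct_sub, smul_dotProduct, dotProduct_smul,
    smul_eq_mul] at e e2 ⊢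
  rw [dotProduct_comm (D *ᵥ x) (D *ᵥ y)] at e e2
  rw [dotProduct_comm x y] at e ⊢
  linarith

end Quadratic

-- Dirichlet form and Poincaré inequality of the network.

section Network

variable {n : ℕ} {A : Matrix (Fin n) (Fin n) ℝ}

/-- The dissipation of one averaging step, as a Dirichlet form of `AᵀA`. -/
theorem dotProduct_self_sub_kronecker_mulVec (hA : A ∈ doublyStochastic ℝ (Fin n)) {m : ℕ}
    (y : Fin n × Fin m → ℝ) :
    2 * (y ⬝ᵥ y - ((A ⊗ₖ (1 : Matrix (Fin m) (Fin m) ℝ)) *ᵥ y) ⬝ᵥ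
      ((A ⊗ₖ (1 : Matrix (Fin m) (Fin m) ℝ)) *ᵥ y)) =
    ∑ i, ∑ j, (Aᵀ * A) i j * ((fun a => y (i, a) - y (j, a)) ⬝ᵥ (fun a => y (i, a) - y (j, a))) := by
  obtain ⟨-, hrow, hcol⟩ := mem_doublyStochastic_iff_sum.1 hA
  have hS1 : ∀ i, ∑ j, (Aᵀ * A) i j = 1 := by
    intro i
    simp only [Matrix.mul_apply, Matrix.transpose_apply]
    rw [Finset.sum_comm]
    simp [← Finset.mul_sum, hrow, hcol]
  have hS2 : ∀ j, ∑ i, (Aᵀ * A) i j = 1 := by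
    intro j
    simp only [Matrix.mul_apply, Matrix.transpose_apply]
    rw [Finset.sum_comm]
    simp [← Finset.sum_mul, hrow, hcol]
  rw [mulVec_dotProduct_self]
  have hK : ((A ⊗ₖ (1 : Matrix (Fin m) (Fin m) ℝ))ᵀ * (A ⊗ₖ (1 : Matrix (Fin m) (Fin m) ℝ))) =
      (Aᵀ * A) ⊗ₖ (1 : Matrix (Fin m) (Fin m) ℝ) := by
    rw [← Matrix.kroneckerMap_transpose, ← Matrix.mul_kronecker_mul]
    simp
  rw [hK]
  generalize hS : Aᵀ * A = S at *
  have e1 : y ⬝ᵥ (S ⊗ₖ (1 : Matrix (Fin m) (Fin m) ℝ)) *ᵥ y =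
      ∑ i, ∑ j, S i j * ∑ a, y (i, a) * y (j, a) := by
    simp only [dotProduct, Matrix.mulVec, Fintype.sum_prod_type, Matrix.kroneckerMap_apply,
      Matrix.one_apply, mul_ite, mul_one, mul_zero, ite_mul, zero_mul, Finset.sum_ite_eq,
      Finset.mem_univ, if_true, Finset.mul_sum]
    refine Finset.sum_congr rfl fun i _ => ?_
    rw [Finset.sum_comm]
    refine Finset.sum_congr rfl fun j _ => Finset.sum_congr rfl fun a _ => ?_
    ring
  -- The row sums and the column sums of `S` are both one, so the energy can be spread over either
  -- endpoint of an edge; adding the two versions completes the squares.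
  have e2 : y ⬝ᵥ y = ∑ i, ∑ j, S i j * ∑ a, y (i, a) * y (i, a) := by
    simp only [dotProduct, Fintype.sum_prod_type, ← Finset.sum_mul, hS1, one_mul]
  have e3 : y ⬝ᵥ y = ∑ i, ∑ j, S i j * ∑ a, y (j, a) * y (j, a) := by
    rw [Finset.sum_comm]
    simp only [dotProduct, Fintype.sum_prod_type, ← Finset.sum_mul, hS2, one_mul]
  have e4 : 2 * (y ⬝ᵥ y - y ⬝ᵥ (S ⊗ₖ (1 : Matrix (Fin m) (Fin m) ℝ)) *ᵥ y) = y ⬝ᵥ y + y ⬝ᵥ y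
      - 2 * (y ⬝ᵥ (S ⊗ₖ (1 : Matrix (Fin m) (Fin m) ℝ)) *ᵥ y) := by ring
  rw [e4, e1]
  nth_rewrite 1 [e2]
  rw [e3, Finset.mul_sum, ← Finset.sum_add_distrib, ← Finset.sum_sub_distrib]
  refine Finset.sum_congr rfl fun i _ => ?_
  rw [Finset.mul_sum, ← Finset.sum_add_distrib, ← Finset.sum_sub_distrib]
  refine Finset.sum_congr rfl fun j _ => ?_
  simp only [dotProduct]
  rw [← mul_add, mul_left_comm, ← mul_sub, ← Finset.sum_add_distrib, Finset.mul_sum,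
    ← Finset.sum_sub_distrib]
  congr 1
  refine Finset.sum_congr rfl fun a _ => ?_
  ring

theorem gram_nonneg (hA : A ∈ doublyStochastic ℝ (Fin n)) (i j : Fin n) : 0 ≤ (Aᵀ * A) i j := by
  obtain ⟨h0, -, -⟩ := mem_doublyStochastic_iff_sum.1 hA
  rw [Matrix.mul_apply]
  exact Finset.sum_nonneg fun k _ => mul_nonneg (h0 _ _) (h0 _ _)

theorem kronecker_mulVec_dotProduct_self_le (hA : A ∈ doublyStochastic ℝ (Fin n)) {m : ℕ}
    (y : Fin n × Fin m → ℝ) :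
    ((A ⊗ₖ (1 : Matrix (Fin m) (Fin m) ℝ)) *ᵥ y) ⬝ᵥ
      ((A ⊗ₖ (1 : Matrix (Fin m) (Fin m) ℝ)) *ᵥ y) ≤ y ⬝ᵥ y := by
  have h := dotProduct_self_sub_kronecker_mulVec hA y
  have : 0 ≤ ∑ i, ∑ j, (Aᵀ * A) i j *
      ((fun a => y (i, a) - y (j, a)) ⬝ᵥ (fun a => y (i, a) - y (j, a))) :=
    Finset.sum_nonneg fun i _ => Finset.sum_nonneg fun j _ =>
      mul_nonneg (gram_nonneg hA i j) (dotProduct_self_nonneg' _)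
  linarith

/-- The spectral gap of `AᵀA`, in the form of a Poincaré inequality for pairs of nodes. -/
theorem exists_pair_dist_le (hA : NetworkAssumption A) :
    ∃ K : ℝ, 0 ≤ K ∧ ∀ (m : ℕ) (y : Fin n × Fin m → ℝ) (i j : Fin n),
      (fun a => y (i, a) - y (j, a)) ⬝ᵥ (fun a => y (i, a) - y (j, a)) ≤
        K * (y ⬝ᵥ y - ((A ⊗ₖ (1 : Matrix (Fin m) (Fin m) ℝ)) *ᵥ y) ⬝ᵥ
          ((A ⊗ₖ (1 : Matrix (Fin m) (Fin m) ℝ)) *ᵥ y)) := by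
  have key : ∀ i j : Fin n, ∃ K : ℝ, 0 ≤ K ∧ ∀ (m : ℕ) (y : Fin n × Fin m → ℝ),
      (fun a => y (i, a) - y (j, a)) ⬝ᵥ (fun a => y (i, a) - y (j, a)) ≤
        K * (y ⬝ᵥ y - ((A ⊗ₖ (1 : Matrix (Fin m) (Fin m) ℝ)) *ᵥ y) ⬝ᵥ
          ((A ⊗ₖ (1 : Matrix (Fin m) (Fin m) ℝ)) *ᵥ y)) := by
    intro i j
    let _ := (Aᵀ * A).toQuiver
    obtain ⟨p, -⟩ := hA.gram_irreducible.connected i j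
    -- Induction along a path of positive entries: one edge is a single term of the Dirichlet form,
    -- and the triangle inequality chains edges at the cost of a factor 2. The constant depends on
    -- the path only, hence not on `m` or `y`.
    induction p with
    | nil => exact ⟨0, le_rfl, fun m y => by simp [dotProduct]⟩
    | @cons b c p e ih =>
      obtain ⟨K, hK, h⟩ := ih
      have hpos : 0 < (Aᵀ * A) b c := e.down
      refine ⟨2 * K + 2 * (2 / (Aᵀ * A) b c), by positivity, fun m y => ?_⟩
      have h1 := h m y
      have h2 : (fun a => y (b, a) - y (c, a)) ⬝ᵥ (fun a => y (b, a) - y (c, a)) ≤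
          2 / (Aᵀ * A) b c * (y ⬝ᵥ y - ((A ⊗ₖ (1 : Matrix (Fin m) (Fin m) ℝ)) *ᵥ y) ⬝ᵥ
          ((A ⊗ₖ (1 : Matrix (Fin m) (Fin m) ℝ)) *ᵥ y)) := by
        have e1 := dotProduct_self_sub_kronecker_mulVec hA.doublyStochastic y
        have e2 : (Aᵀ * A) b c *
            ((fun a => y (b, a) - y (c, a)) ⬝ᵥ (fun a => y (b, a) - y (c, a))) ≤
            ∑ i, ∑ j, (Aᵀ * A) i j *
              ((fun a => y (i, a) - y (j, a)) ⬝ᵥ (fun a => y (i, a) - y (j, a))) := by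
          have hnn : ∀ i j, 0 ≤ (Aᵀ * A) i j *
              ((fun a => y (i, a) - y (j, a)) ⬝ᵥ (fun a => y (i, a) - y (j, a))) := fun i j =>
            mul_nonneg (gram_nonneg hA.doublyStochastic i j) (dotProduct_self_nonneg' _)
          refine le_trans ?_ (Finset.single_le_sum (fun i _ => Finset.sum_nonneg fun j _ => hnn i j)
            (Finset.mem_univ b))
          exact Finset.single_le_sum (fun j _ => hnn b j) (Finset.mem_univ c)
        rw [← e1] at e2
        rw [div_mul_eq_mul_div, le_div_iff₀ hpos]
        linarith
      have h3 := sub_dotProduct_self_le_add (fun a => y (i, a)) (fun a => y (b, a))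
        (fun a => y (c, a))
      simp only [Pi.sub_def] at h3
      linarith
  choose K hK h using key
  refine ⟨∑ i, ∑ j, K i j, Finset.sum_nonneg fun i _ => Finset.sum_nonneg fun j _ => hK i j,
    fun m y i j => (h i j m y).trans ?_⟩
  refine mul_le_mul_of_nonneg_right ?_
    (sub_nonneg.2 (kronecker_mulVec_dotProduct_self_le hA.doublyStochastic y))
  exact (Finset.single_le_sum (f := K i) (fun j _ => hK i j) (Finset.mem_univ j)).trans
    (Finset.single_le_sum (f := fun i => ∑ j, K i j)
      (fun i _ => Finset.sum_nonneg fun j _ => hK i j) (Finset.mem_univ i))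

end Network

-- Energy dissipated over a window.

section Dissipation

variable {n m : ℕ} {A : Matrix (Fin n) (Fin n) ℝ}

theorem blockDiag_mulVec_apply (D : Fin n → Matrix (Fin m) (Fin m) ℝ) (x : Fin n × Fin m → ℝ)
    (i : Fin n) (a : Fin m) : (blockDiag D *ᵥ x) (i, a) = (D i *ᵥ fun b => x (i, b)) a := by
  simp [blockDiag, Matrix.mulVec, dotProduct, Fintype.sum_prod_type, ite_mul, Finset.sum_ite_irrel]

theorem kronecker_one_mulVec_apply (A : Matrix (Fin n) (Fin n) ℝ) (x : Fin n × Fin m → ℝ)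
    (i : Fin n) (a : Fin m) :
    ((A ⊗ₖ (1 : Matrix (Fin m) (Fin m) ℝ)) *ᵥ x) (i, a) = ∑ j, A i j * x (j, a) := by
  simp [Matrix.mulVec, dotProduct, Fintype.sum_prod_type, Matrix.one_apply]

theorem dotProduct_self_prod (x : Fin n × Fin m → ℝ) :
    x ⬝ᵥ x = ∑ i, (fun a => x (i, a)) ⬝ᵥ (fun a => x (i, a)) := by
  simp [dotProduct, Fintype.sum_prod_type]

theorem psi_succ_mulVec (D : ℕ → Fin n → Matrix (Fin m) (Fin m) ℝ) (k : ℕ)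
    (x : Fin n × Fin m → ℝ) :
    psi A D (k + 1) *ᵥ x = (A ⊗ₖ (1 : Matrix (Fin m) (Fin m) ℝ)) *ᵥ
      (blockDiag (D k) *ᵥ (psi A D k *ᵥ x)) := by
  rw [psi, ← Matrix.mulVec_mulVec, ← Matrix.mulVec_mulVec]

theorem blockDiag_dissipation_apply {D : Fin n → Matrix (Fin m) (Fin m) ℝ}
    (hD : ∀ i, (D i).PosSemidef ∧ (1 - D i).PosSemidef) (x : Fin n × Fin m → ℝ) (i : Fin n) :
    (fun a => x (i, a)) ⬝ᵥ (fun a => x (i, a)) -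
      (D i *ᵥ fun a => x (i, a)) ⬝ᵥ (D i *ᵥ fun a => x (i, a)) ≤
    x ⬝ᵥ x - (blockDiag D *ᵥ x) ⬝ᵥ (blockDiag D *ᵥ x) := by
  rw [dotProduct_self_prod x, dotProduct_self_prod (blockDiag D *ᵥ x), ← Finset.sum_sub_distrib]
  simp only [blockDiag_mulVec_apply]
  exact Finset.single_le_sum (f := fun i => (fun a => x (i, a)) ⬝ᵥ (fun a => x (i, a)) -
      (D i *ᵥ fun a => x (i, a)) ⬝ᵥ (D i *ᵥ fun a => x (i, a)))
    (fun i _ => sub_nonneg.2 (mulVec_dotProduct_self_le_self (hD i).1 (hD i).2 _))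
    (Finset.mem_univ i)

theorem blockDiag_mulVec_dotProduct_self_le {D : Fin n → Matrix (Fin m) (Fin m) ℝ}
    (hD : ∀ i, (D i).PosSemidef ∧ (1 - D i).PosSemidef) (x : Fin n × Fin m → ℝ) :
    (blockDiag D *ᵥ x) ⬝ᵥ (blockDiag D *ᵥ x) ≤ x ⬝ᵥ x := by
  rw [dotProduct_self_prod x, dotProduct_self_prod (blockDiag D *ᵥ x)]
  simp only [blockDiag_mulVec_apply]
  exact Finset.sum_le_sum fun i _ => mulVec_dotProduct_self_le_self (hD i).1 (hD i).2 _

theorem psi_mulVec_antitone (hA : A ∈ doublyStochastic ℝ (Fin n))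
    {D : ℕ → Fin n → Matrix (Fin m) (Fin m) ℝ}
    (hD : ∀ k i, (D k i).PosSemidef ∧ (1 - D k i).PosSemidef) (x : Fin n × Fin m → ℝ) :
    Antitone fun k => (psi A D k *ᵥ x) ⬝ᵥ (psi A D k *ᵥ x) := by
  refine antitone_nat_of_succ_le fun k => ?_
  rw [psi_succ_mulVec]
  exact (kronecker_mulVec_dotProduct_self_le hA _).trans
    (blockDiag_mulVec_dotProduct_self_le (hD k) _)

theorem psi_mulVec_dotProduct_self_le (hA : A ∈ doublyStochastic ℝ (Fin n))
    {D : ℕ → Fin n → Matrix (Fin m) (Fin m) ℝ}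
    (hD : ∀ k i, (D k i).PosSemidef ∧ (1 - D k i).PosSemidef) (k : ℕ) (x : Fin n × Fin m → ℝ) :
    (psi A D k *ᵥ x) ⬝ᵥ (psi A D k *ᵥ x) ≤ x ⬝ᵥ x := by
  have := psi_mulVec_antitone hA hD x (Nat.zero_le k)
  simpa [psi] using this

/-- Jensen's inequality for the square: a row of `A` gives the weights of a convex combination. -/
theorem average_sub_dotProduct_self_le (hA : A ∈ doublyStochastic ℝ (Fin n))
    (y : Fin n × Fin m → ℝ) (i : Fin n) (z : Fin m → ℝ) {c : ℝ}
    (h : ∀ j, ((fun a => y (j, a)) - z) ⬝ᵥ ((fun a => y (j, a)) - z) ≤ c) :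
    ((fun a => ((A ⊗ₖ (1 : Matrix (Fin m) (Fin m) ℝ)) *ᵥ y) (i, a)) - z) ⬝ᵥ
      ((fun a => ((A ⊗ₖ (1 : Matrix (Fin m) (Fin m) ℝ)) *ᵥ y) (i, a)) - z) ≤ c := by
  obtain ⟨h0, hrow, -⟩ := mem_doublyStochastic_iff_sum.1 hA
  have e : ∀ a, (∑ j, A i j * y (j, a) - z a) ^ 2 ≤ ∑ j, A i j * (y (j, a) - z a) ^ 2 := by
    intro a
    have h1 : ∑ j, A i j * y (j, a) - z a = ∑ j, A i j * (y (j, a) - z a) := by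
      simp only [mul_sub, Finset.sum_sub_distrib, ← Finset.sum_mul, hrow, one_mul]
    rw [h1]
    have := (Even.convexOn_pow (𝕜 := ℝ) even_two).map_sum_le (t := Finset.univ) (w := A i)
      (p := fun j => y (j, a) - z a) (fun j _ => h0 i j) (hrow i) (fun j _ => Set.mem_univ _)
    simpa [smul_eq_mul] using this
  simp only [dotProduct_self_sum, Pi.sub_apply, kronecker_one_mulVec_apply] at h ⊢
  calc ∑ a, (∑ j, A i j * y (j, a) - z a) ^ 2
      ≤ ∑ a, ∑ j, A i j * (y (j, a) - z a) ^ 2 := Finset.sum_le_sum fun a _ => e a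
    _ = ∑ j, A i j * ∑ a, (y (j, a) - z a) ^ 2 := by
        rw [Finset.sum_comm]; simp only [Finset.mul_sum]
    _ ≤ ∑ j, A i j * c := Finset.sum_le_sum fun j _ => mul_le_mul_of_nonneg_left (h j) (h0 i j)
    _ = c := by rw [← Finset.sum_mul, hrow, one_mul]

/-- Along a window, all nodes stay close to any initial node, up to the dissipated energy. -/
theorem exists_drift_bound (hA : NetworkAssumption A) (k : ℕ) :
    ∃ C : ℝ, 0 ≤ C ∧ ∀ (h m : ℕ) (D : ℕ → Fin n → Matrix (Fin m) (Fin m) ℝ), k < h →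
      (∀ k i, (D k i).PosSemidef ∧ (1 - D k i).PosSemidef) →
      ∀ (x : Fin n × Fin m → ℝ) (i j : Fin n),
        ((fun a => (psi A D k *ᵥ x) (i, a)) - fun a => x (j, a)) ⬝ᵥ
          ((fun a => (psi A D k *ᵥ x) (i, a)) - fun a => x (j, a)) ≤
        C * (x ⬝ᵥ x - (psi A D h *ᵥ x) ⬝ᵥ (psi A D h *ᵥ x)) := by
  obtain ⟨K, hK, hgap⟩ := exists_pair_dist_le hA
  -- one-step estimates
  have step : ∀ (h k m : ℕ) (D : ℕ → Fin n → Matrix (Fin m) (Fin m) ℝ), k < h →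
      (∀ k i, (D k i).PosSemidef ∧ (1 - D k i).PosSemidef) →
      ∀ (x : Fin n × Fin m → ℝ),
      (∀ i, ((fun a => (psi A D k *ᵥ x) (i, a)) -
            fun a => (blockDiag (D k) *ᵥ (psi A D k *ᵥ x)) (i, a)) ⬝ᵥ
          ((fun a => (psi A D k *ᵥ x) (i, a)) -
            fun a => (blockDiag (D k) *ᵥ (psi A D k *ᵥ x)) (i, a)) ≤
          x ⬝ᵥ x - (psi A D h *ᵥ x) ⬝ᵥ (psi A D h *ᵥ x)) ∧
      (∀ i j, ((fun a => (blockDiag (D k) *ᵥ (psi A D k *ᵥ x)) (i, a)) -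
            fun a => (blockDiag (D k) *ᵥ (psi A D k *ᵥ x)) (j, a)) ⬝ᵥ
          ((fun a => (blockDiag (D k) *ᵥ (psi A D k *ᵥ x)) (i, a)) -
            fun a => (blockDiag (D k) *ᵥ (psi A D k *ᵥ x)) (j, a)) ≤
          K * (x ⬝ᵥ x - (psi A D h *ᵥ x) ⬝ᵥ (psi A D h *ᵥ x))) := by
    intro h k m D hk hD x
    -- Energy never increases along the window, so the loss in any single adaptation or averaging
    -- substep is at most the total loss.
    have h1 := psi_mulVec_antitone hA.doublyStochastic hD x (Nat.zero_le k)
    have h2 := psi_mulVec_antitone hA.doublyStochastic hD x (Nat.succ_le_of_lt hk)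
    simp only [psi, Matrix.one_mulVec] at h1
    simp only [psi_succ_mulVec, Nat.succ_eq_add_one] at h2
    have h3 := kronecker_mulVec_dotProduct_self_le hA.doublyStochastic
      (blockDiag (D k) *ᵥ (psi A D k *ᵥ x))
    have h4 := blockDiag_mulVec_dotProduct_self_le (hD k) (psi A D k *ᵥ x)
    constructor
    · intro i
      have h5 := blockDiag_dissipation_apply (hD k) (psi A D k *ᵥ x) i
      have h6 := sub_mulVec_dotProduct_self_le (hD k i).1 (hD k i).2
        (fun a => (psi A D k *ᵥ x) (i, a))
      simp only [blockDiag_mulVec_apply]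
      linarith
    · intro i j
      refine (hgap m _ i j).trans (mul_le_mul_of_nonneg_left ?_ hK)
      linarith
  induction k with
  | zero =>
    -- The route is `x_i → (Dx)_i → (Dx)_j → x_j`, with squared lengths at most 1, `K` and 1 times
    -- the total loss: `2 + 2(2K + 2)`.
    refine ⟨6 + 4 * K, by positivity, fun h m D hh hD x i j => ?_⟩
    obtain ⟨h1, h2⟩ := step h 0 m D hh hD x
    simp only [psi, Matrix.one_mulVec] at h1 h2 ⊢
    have e1 := h1 i
    have e2 := h2 i j
    have e3 := h1 j
    have t1 := sub_dotProduct_self_le_add (fun a => x (i, a))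
      (fun a => (blockDiag (D 0) *ᵥ x) (i, a)) (fun a => x (j, a))
    have t2 := sub_dotProduct_self_le_add (fun a => (blockDiag (D 0) *ᵥ x) (i, a))
      (fun a => (blockDiag (D 0) *ᵥ x) (j, a)) (fun a => x (j, a))
    have t3 : ((fun a => (blockDiag (D 0) *ᵥ x) (j, a)) - fun a => x (j, a)) ⬝ᵥ
        ((fun a => (blockDiag (D 0) *ᵥ x) (j, a)) - fun a => x (j, a)) =
        ((fun a => x (j, a)) - fun a => (blockDiag (D 0) *ᵥ x) (j, a)) ⬝ᵥ
        ((fun a => x (j, a)) - fun a => (blockDiag (D 0) *ᵥ x) (j, a)) :=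
      sub_dotProduct_self_comm _ _
    linarith
  | succ k ih =>
    obtain ⟨C, hC, ih⟩ := ih
    -- From the averaged block to the adapted block of node `i` costs `K`, back to the block before
    -- adaptation costs 1, and on to `x_j` costs `C` by induction.
    refine ⟨2 * K + 2 * (2 + 2 * C), by positivity, fun h m D hh hD x i j => ?_⟩
    obtain ⟨h1, h2⟩ := step h k m D (by omega) hD x
    have e0 := ih h m D (by omega) hD x i j
    have e1 := h1 i
    rw [psi_succ_mulVec]
    have e2 := average_sub_dotProduct_self_le hA.doublyStochastic
      (blockDiag (D k) *ᵥ (psi A D k *ᵥ x)) i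
      (fun a => (blockDiag (D k) *ᵥ (psi A D k *ᵥ x)) (i, a)) (fun j => h2 j i)
    have t1 := sub_dotProduct_self_le_add
      (fun a => ((A ⊗ₖ (1 : Matrix (Fin m) (Fin m) ℝ)) *ᵥ
        (blockDiag (D k) *ᵥ (psi A D k *ᵥ x))) (i, a))
      (fun a => (blockDiag (D k) *ᵥ (psi A D k *ᵥ x)) (i, a)) (fun a => x (j, a))
    have t2 := sub_dotProduct_self_le_add (fun a => (blockDiag (D k) *ᵥ (psi A D k *ᵥ x)) (i, a))
      (fun a => (psi A D k *ᵥ x) (i, a)) (fun a => x (j, a))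
    have t3 : ((fun a => (blockDiag (D k) *ᵥ (psi A D k *ᵥ x)) (i, a)) -
          fun a => (psi A D k *ᵥ x) (i, a)) ⬝ᵥ
        ((fun a => (blockDiag (D k) *ᵥ (psi A D k *ᵥ x)) (i, a)) -
          fun a => (psi A D k *ᵥ x) (i, a)) =
        ((fun a => (psi A D k *ᵥ x) (i, a)) -
          fun a => (blockDiag (D k) *ᵥ (psi A D k *ᵥ x)) (i, a)) ⬝ᵥ
        ((fun a => (psi A D k *ᵥ x) (i, a)) -
          fun a => (blockDiag (D k) *ᵥ (psi A D k *ᵥ x)) (i, a)) :=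
      sub_dotProduct_self_comm _ _
    linarith

/-- The deterministic core of the contraction inequality. -/
theorem exists_dissipation_bound (hA : NetworkAssumption A) (h : ℕ) :
    ∃ C : ℝ, 0 ≤ C ∧ ∀ (m : ℕ) (D : ℕ → Fin n → Matrix (Fin m) (Fin m) ℝ),
      (∀ k i, (D k i).PosSemidef ∧ (1 - D k i).PosSemidef) →
      ∀ (x : Fin n × Fin m → ℝ) (j : Fin n),
        ∑ k ∈ Finset.range h, ∑ i, (fun a => x (j, a)) ⬝ᵥ (1 - D k i * D k i) *ᵥ
          (fun a => x (j, a)) ≤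
        C * (x ⬝ᵥ x - (psi A D h *ᵥ x) ⬝ᵥ (psi A D h *ᵥ x)) := by
  choose C hC hdrift using fun k => exists_drift_bound hA k
  -- Each matrix is evaluated at the current block of its node, where the form is at most the total
  -- loss, and moved to `x_j` at the price of the drift: `2 + 2C`.
  refine ⟨∑ k ∈ Finset.range h, ∑ i : Fin n, (2 + 2 * C k),
    Finset.sum_nonneg fun k _ => Finset.sum_nonneg fun i _ => by have := hC k; positivity,
    fun m D hD x j => ?_⟩
  simp only [Finset.sum_mul]
  refine Finset.sum_le_sum fun k hk => Finset.sum_le_sum fun i _ => ?_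
  have hk' := Finset.mem_range.1 hk
  have e1 := dotProduct_one_sub_sq_mulVec_le_add (hD k i).1 (hD k i).2
    (fun a => (psi A D k *ᵥ x) (i, a)) (fun a => x (j, a))
  have e2 := hdrift k h m D hk' hD x i j
  have e3 := blockDiag_dissipation_apply (hD k) (psi A D k *ᵥ x) i
  have h1 := psi_mulVec_antitone hA.doublyStochastic hD x (Nat.zero_le k)
  have h2 := psi_mulVec_antitone hA.doublyStochastic hD x (Nat.succ_le_of_lt hk')
  simp only [psi, Matrix.one_mulVec] at h1
  simp only [psi_succ_mulVec, Nat.succ_eq_add_one] at h2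
  have h3 := kronecker_mulVec_dotProduct_self_le hA.doublyStochastic
      (blockDiag (D k) *ᵥ (psi A D k *ᵥ x))
  have t3 : ((fun a => x (j, a)) - fun a => (psi A D k *ᵥ x) (i, a)) ⬝ᵥ
      ((fun a => x (j, a)) - fun a => (psi A D k *ᵥ x) (i, a)) =
      ((fun a => (psi A D k *ᵥ x) (i, a)) - fun a => x (j, a)) ⬝ᵥ
      ((fun a => (psi A D k *ᵥ x) (i, a)) - fun a => x (j, a)) :=
      sub_dotProduct_self_comm _ _
  linarith

end Dissipation

-- Bounded measurable random matrices.

section BoundedMeasurable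

variable {ι κ τ Ω : Type*}

/-- A random matrix with measurable, uniformly bounded entries. -/
structure IsBddMeasurable (F : MeasurableSpace Ω) (X : Ω → Matrix ι κ ℝ) : Prop where
  measurable : ∀ a b, Measurable[F] fun ω => X ω a b
  bounded : ∀ a b, ∃ C : ℝ, ∀ ω, |X ω a b| ≤ C

namespace IsBddMeasurable

variable {F : MeasurableSpace Ω} {X Y : Ω → Matrix ι κ ℝ}

theorem mono {F' : MeasurableSpace Ω} (hX : IsBddMeasurable F X) (h : F ≤ F') :
    IsBddMeasurable F' X :=
  ⟨fun a b => (hX.measurable a b).mono h le_rfl, hX.bounded⟩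

theorem const (B : Matrix ι κ ℝ) : IsBddMeasurable F fun _ : Ω => B :=
  ⟨fun _ _ => measurable_const, fun a b => ⟨|B a b|, fun _ => le_rfl⟩⟩

theorem add (hX : IsBddMeasurable F X) (hY : IsBddMeasurable F Y) :
    IsBddMeasurable F fun ω => X ω + Y ω := by
  refine ⟨fun a b => (hX.measurable a b).add (hY.measurable a b), fun a b => ?_⟩
  obtain ⟨C, hC⟩ := hX.bounded a b
  obtain ⟨C', hC'⟩ := hY.bounded a b
  exact ⟨C + C', fun ω => (abs_add_le _ _).trans (add_le_add (hC ω) (hC' ω))⟩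

theorem smul (hX : IsBddMeasurable F X) (r : ℝ) : IsBddMeasurable F fun ω => r • X ω := by
  refine ⟨fun a b => (hX.measurable a b).const_mul r, fun a b => ?_⟩
  obtain ⟨C, hC⟩ := hX.bounded a b
  refine ⟨|r| * C, fun ω => ?_⟩
  rw [Matrix.smul_apply, smul_eq_mul, abs_mul]
  exact mul_le_mul_of_nonneg_left (hC ω) (abs_nonneg r)

theorem sub (hX : IsBddMeasurable F X) (hY : IsBddMeasurable F Y) :
    IsBddMeasurable F fun ω => X ω - Y ω := by
  simpa [sub_eq_add_neg] using hX.add (hY.smul (-1))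

theorem transpose (hX : IsBddMeasurable F X) : IsBddMeasurable F fun ω => (X ω)ᵀ :=
  ⟨fun a b => hX.measurable b a, fun a b => hX.bounded b a⟩

theorem sum {σ : Type*} {s : Finset σ} {X : σ → Ω → Matrix ι κ ℝ}
    (hX : ∀ i ∈ s, IsBddMeasurable F (X i)) : IsBddMeasurable F fun ω => ∑ i ∈ s, X i ω := by
  classical
  induction s using Finset.induction_on with
  | empty => simpa using const 0
  | insert i s hi ih =>
    simp only [Finset.sum_insert hi]
    exact (hX i (Finset.mem_insert_self i s)).add
      (ih fun j hj => hX j (Finset.mem_insert_of_mem hj))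

theorem mul [Fintype κ] {Z : Ω → Matrix κ τ ℝ} (hX : IsBddMeasurable F X)
    (hZ : IsBddMeasurable F Z) : IsBddMeasurable F fun ω => X ω * Z ω := by
  refine ⟨fun a b => ?_, fun a b => ?_⟩
  · simp only [Matrix.mul_apply]
    exact Finset.measurable_sum _ fun c _ => (hX.measurable a c).mul (hZ.measurable c b)
  · choose C hC using hX.bounded a
    choose C' hC' using fun c => hZ.bounded c b
    refine ⟨∑ c, C c * C' c, fun ω => ?_⟩
    rw [Matrix.mul_apply]
    refine (Finset.abs_sum_le_sum_abs _ _).trans (Finset.sum_le_sum fun c _ => ?_)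
    rw [abs_mul]
    exact mul_le_mul (hC c ω) (hC' c ω) (abs_nonneg _) ((abs_nonneg _).trans (hC c ω))

theorem blockDiag {n m : ℕ} {D : Fin n → Ω → Matrix (Fin m) (Fin m) ℝ}
    (hD : ∀ i, IsBddMeasurable F (D i)) :
    IsBddMeasurable F fun ω => DiffusionRM.blockDiag fun i => D i ω := by
  refine ⟨fun p q => ?_, fun p q => ?_⟩
  · by_cases h : p.1 = q.1
    · simpa [DiffusionRM.blockDiag, h] using (hD q.1).measurable p.2 q.2
    · simp [DiffusionRM.blockDiag, h]
  · by_cases h : p.1 = q.1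
    · simpa [DiffusionRM.blockDiag, h] using (hD q.1).bounded p.2 q.2
    · exact ⟨0, by simp [DiffusionRM.blockDiag, h]⟩

theorem psi {n m : ℕ} (A : Matrix (Fin n) (Fin n) ℝ) {D : ℕ → Fin n → Ω → Matrix (Fin m) (Fin m) ℝ}
    (h : ℕ) (hD : ∀ k < h, ∀ i, IsBddMeasurable F (D k i)) :
    IsBddMeasurable F fun ω => DiffusionRM.psi A (fun k i => D k i ω) h := by
  induction h with
  | zero => exact const 1
  | succ h ih =>
    exact ((const _).mul (blockDiag (hD h (Nat.lt_succ_self h)))).mul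
      (ih fun k hk => hD k (hk.trans (Nat.lt_succ_self h)))

theorem integrable {mΩ : MeasurableSpace Ω} {P : Measure Ω} [IsFiniteMeasure P]
    (hX : IsBddMeasurable mΩ X) (a : ι) (b : κ) : Integrable (fun ω => X ω a b) P := by
  obtain ⟨C, hC⟩ := hX.bounded a b
  exact Integrable.of_bound (hX.measurable a b).aestronglyMeasurable C
    (Eventually.of_forall fun ω => hC ω)

/-- Columns are images of unit vectors, so every entry is at most 1 in absolute value. -/
theorem of_contraction [Fintype ι] [Fintype κ] [DecidableEq κ]
    (hX : ∀ a b, Measurable[F] fun ω => X ω a b)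
    (h : ∀ ω x, (X ω *ᵥ x) ⬝ᵥ (X ω *ᵥ x) ≤ x ⬝ᵥ x) : IsBddMeasurable F X := by
  refine ⟨hX, fun a b => ⟨1, fun ω => ?_⟩⟩
  have h1 := h ω (Pi.single b 1)
  rw [dotProduct_self_sum, dotProduct_self_sum] at h1
  have h2 : ∑ i, (Pi.single b (1 : ℝ) : κ → ℝ) i ^ 2 = 1 := by
    rw [Finset.sum_eq_single b] <;> simp +contextual
  rw [h2] at h1
  have h3 := (Finset.single_le_sum (f := fun i => (X ω *ᵥ Pi.single b (1 : ℝ)) i ^ 2)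
    (fun i _ => sq_nonneg _) (Finset.mem_univ a)).trans h1
  simp only [Matrix.mulVec_single_one] at h3
  exact (sq_le_one_iff_abs_le_one _).1 h3

end IsBddMeasurable

theorem eventuallyEq_finsetSum {σ : Type*} {l : Filter Ω} {s : Finset σ} {f g : σ → Ω → ℝ}
    (h : ∀ i ∈ s, f i =ᶠ[l] g i) : ∑ i ∈ s, f i =ᶠ[l] ∑ i ∈ s, g i := by
  filter_upwards [(eventually_all_finset s).2 h] with ω hω
  simpa using Finset.sum_congr rfl hω

end BoundedMeasurable

-- Conditional expectations of quadratic forms.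

section CondExpMatrix

variable {ι Ω : Type*} {F : MeasurableSpace Ω} [mΩ : MeasurableSpace Ω] {P : Measure Ω}

theorem condExpMatrix_isHermitian {X : Ω → Matrix ι ι ℝ} (hX : ∀ ω, (X ω).IsHermitian) (ω : Ω) :
    (condExpMatrix P F X ω).IsHermitian := by
  ext a b
  have : (fun ω' => X ω' b a) = fun ω' => X ω' a b := by
    funext ω'
    simpa using (hX ω').apply a b
  simp [condExpMatrix, this]

theorem condExpMatrix_sub {X Y : Ω → Matrix ι ι ℝ} [Finite ι]
    (hX : ∀ a b, Integrable (fun ω => X ω a b) P) (hY : ∀ a b, Integrable (fun ω => Y ω a b) P) :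
    ∀ᵐ ω ∂P, condExpMatrix P F (fun ω' => X ω' - Y ω') ω =
      condExpMatrix P F X ω - condExpMatrix P F Y ω := by
  have : ∀ a b, ∀ᵐ ω ∂P, (P[fun ω' => X ω' a b - Y ω' a b | F]) ω =
      (P[fun ω' => X ω' a b | F]) ω - (P[fun ω' => Y ω' a b | F]) ω :=
    fun a b => condExp_sub (hX a b) (hY a b) F
  have h2 : ∀ᵐ ω ∂P, ∀ a b, (P[fun ω' => X ω' a b - Y ω' a b | F]) ω =
      (P[fun ω' => X ω' a b | F]) ω - (P[fun ω' => Y ω' a b | F]) ω := by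
    rw [ae_all_iff]; intro a; rw [ae_all_iff]; exact this a
  filter_upwards [h2] with ω hω
  ext a b
  simpa [condExpMatrix] using hω a b

theorem condExpMatrix_smul {X : Ω → Matrix ι ι ℝ} [Finite ι] (r : ℝ) :
    ∀ᵐ ω ∂P, condExpMatrix P F (fun ω' => r • X ω') ω = r • condExpMatrix P F X ω := by
  have : ∀ a b, ∀ᵐ ω ∂P, (P[fun ω' => r * X ω' a b | F]) ω = r * (P[fun ω' => X ω' a b | F]) ω :=
    fun a b => condExp_smul r (fun ω' => X ω' a b) F
  have h2 : ∀ᵐ ω ∂P, ∀ a b, (P[fun ω' => r * X ω' a b | F]) ω =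
      r * (P[fun ω' => X ω' a b | F]) ω := by
    rw [ae_all_iff]; intro a; rw [ae_all_iff]; exact this a
  filter_upwards [h2] with ω hω
  ext a b
  simpa [condExpMatrix] using hω a b

theorem dotProduct_mulVec_eq_sum [Fintype ι] (B : Matrix ι ι ℝ) (x : ι → ℝ) :
    x ⬝ᵥ B *ᵥ x = ∑ a, ∑ b, x a * x b * B a b := by
  simp only [dotProduct, Matrix.mulVec, Finset.mul_sum]
  exact Finset.sum_congr rfl fun a _ => Finset.sum_congr rfl fun b _ => by ring

/-- For fixed `x` this is positivity of conditional expectation, but the null set depends on `x`. A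
countable dense family of vectors and continuity of the form give one null set for all `x`. -/
theorem condExpMatrix_dotProduct_mulVec_nonneg [Fintype ι] {X : Ω → Matrix ι ι ℝ}
    (hX : ∀ a b, Integrable (fun ω => X ω a b) P) (h0 : ∀ ω x, 0 ≤ x ⬝ᵥ X ω *ᵥ x) :
    ∀ᵐ ω ∂P, ∀ x, 0 ≤ x ⬝ᵥ condExpMatrix P F X ω *ᵥ x := by
  have h1 : ∀ x : ι → ℝ, ∀ᵐ ω ∂P, 0 ≤ x ⬝ᵥ condExpMatrix P F X ω *ᵥ x := by
    intro x
    have e1 : P[∑ a, ∑ b, (x a * x b) • fun ω' => X ω' a b | F] =ᵐ[P]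
        ∑ a, ∑ b, (x a * x b) • P[fun ω' => X ω' a b | F] := by
      refine (condExp_finsetSum (fun a _ => integrable_finsetSum' _ fun b _ =>
        (hX a b).smul (x a * x b)) F).trans ?_
      refine eventuallyEq_finsetSum fun a _ => ?_
      refine (condExp_finsetSum (fun b _ => (hX a b).smul (x a * x b)) F).trans ?_
      exact eventuallyEq_finsetSum fun b _ => condExp_smul _ _ _
    have e2 : 0 ≤ᵐ[P] P[∑ a, ∑ b, (x a * x b) • fun ω' => X ω' a b | F] := by
      refine condExp_nonneg (Eventually.of_forall fun ω => ?_)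
      have := h0 ω x
      rw [dotProduct_mulVec_eq_sum] at this
      simpa using this
    filter_upwards [e1, e2] with ω h1 h2
    rw [h1] at h2
    rw [dotProduct_mulVec_eq_sum]
    simpa [condExpMatrix] using h2
  have h2 : ∀ᵐ ω ∂P, ∀ i, 0 ≤ TopologicalSpace.denseSeq (ι → ℝ) i ⬝ᵥ
      condExpMatrix P F X ω *ᵥ TopologicalSpace.denseSeq (ι → ℝ) i := by
    rw [ae_all_iff]; exact fun i => h1 _
  filter_upwards [h2] with ω hω x
  have hcl : IsClosed {x : ι → ℝ | 0 ≤ x ⬝ᵥ condExpMatrix P F X ω *ᵥ x} := by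
    refine isClosed_le continuous_const ?_
    simp only [dotProduct_mulVec_eq_sum]
    fun_prop
  have := hcl.closure_subset_iff.2 (Set.range_subset_iff.2 hω)
  rw [(TopologicalSpace.denseRange_denseSeq (ι → ℝ)).closure_range] at this
  exact this (Set.mem_univ x)

/-- Comparison of quadratic forms passes to conditional expectations. -/
theorem condExpMatrix_dotProduct_mulVec_mono [Fintype ι] {X Y : Ω → Matrix ι ι ℝ}
    (hX : ∀ a b, Integrable (fun ω => X ω a b) P) (hY : ∀ a b, Integrable (fun ω => Y ω a b) P)
    (h : ∀ ω x, x ⬝ᵥ X ω *ᵥ x ≤ x ⬝ᵥ Y ω *ᵥ x) :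
    ∀ᵐ ω ∂P, ∀ x, x ⬝ᵥ condExpMatrix P F X ω *ᵥ x ≤ x ⬝ᵥ condExpMatrix P F Y ω *ᵥ x := by
  have h1 := condExpMatrix_dotProduct_mulVec_nonneg (F := F) (X := fun ω => Y ω - X ω)
    (fun a b => (hY a b).sub (hX a b)) (fun ω x => by
      rw [Matrix.sub_mulVec, dotProduct_sub]
      exact sub_nonneg.2 (h ω x))
  filter_upwards [h1, condExpMatrix_sub (F := F) hY hX] with ω h2 h3 x
  have h4 := h2 x
  rw [h3, Matrix.sub_mulVec, dotProduct_sub] at h4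
  exact sub_nonneg.1 h4

/-- Pull-out and tower property, entry by entry. This is how an almost sure eigenvalue bound on a
conditional expectation becomes a bound on second moments of vectors known at `F`. -/
theorem integral_dotProduct_condExpMatrix_mulVec [Fintype ι] (hF : F ≤ mΩ) [IsFiniteMeasure P]
    {X : Ω → Matrix ι ι ℝ} (hX : IsBddMeasurable mΩ X) {z : Ω → ι → ℝ}
    (hz : ∀ a, Measurable[F] fun ω => z ω a) (hz2 : ∀ a, MemLp (fun ω => z ω a) 2 P) :
    Integrable (fun ω => z ω ⬝ᵥ condExpMatrix P F X ω *ᵥ z ω) P ∧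
    ∫ ω, z ω ⬝ᵥ condExpMatrix P F X ω *ᵥ z ω ∂P = ∫ ω, z ω ⬝ᵥ X ω *ᵥ z ω ∂P := by
  have hzz : ∀ a b, Integrable (fun ω => z ω a * z ω b) P := fun a b =>
    (hz2 a).integrable_mul (hz2 b)
  have hzX : ∀ a b, Integrable ((fun ω => z ω a * z ω b) * fun ω => X ω a b) P := by
    intro a b
    obtain ⟨C, hC⟩ := hX.bounded a b
    exact (hzz a b) |>.mul_bdd (c := C) (hX.measurable a b).aestronglyMeasurable
      (Eventually.of_forall fun ω => hC ω)
  have hpull : ∀ a b, P[(fun ω => z ω a * z ω b) * fun ω => X ω a b | F] =ᵐ[P]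
      (fun ω => z ω a * z ω b) * P[fun ω => X ω a b | F] := fun a b =>
    condExp_mul_of_stronglyMeasurable_left
      ((hz a).mul (hz b)).stronglyMeasurable (hzX a b) (hX.integrable a b)
  have hint : ∀ a b, Integrable (fun ω => z ω a * z ω b * condExpMatrix P F X ω a b) P :=
    fun a b => integrable_condExp.congr (hpull a b)
  have heq : ∀ a b, ∫ ω, z ω a * z ω b * condExpMatrix P F X ω a b ∂P =
      ∫ ω, z ω a * z ω b * X ω a b ∂P := fun a b =>
    (integral_congr_ae (hpull a b)).symm.trans (integral_condExp hF)
  have hzX' : ∀ a b, Integrable (fun ω => z ω a * z ω b * X ω a b) P := hzX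
  simp only [dotProduct_mulVec_eq_sum]
  refine ⟨integrable_finsetSum _ fun a _ => integrable_finsetSum _ fun b _ => hint a b, ?_⟩
  rw [integral_finsetSum _ fun a _ => integrable_finsetSum _ fun b _ => hint a b,
    integral_finsetSum _ fun a _ => integrable_finsetSum _ fun b _ => hzX' a b]
  refine Finset.sum_congr rfl fun a _ => ?_
  rw [integral_finsetSum _ fun b _ => hint a b, integral_finsetSum _ fun b _ => hzX' a b]
  exact Finset.sum_congr rfl fun b _ => heq a b

end CondExpMatrix

-- Existence of a contraction constant.

section Existence

theorem isHermitian_one_sub_sq {ι : Type*} [Fintype ι] [DecidableEq ι] {D : Matrix ι ι ℝ}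
    (hD : D.IsHermitian) : (1 - D * D).IsHermitian := by
  refine Matrix.isHermitian_one.sub ?_
  have := Matrix.isHermitian_conjTranspose_mul_self D
  rwa [hD.eq] at this

theorem isHermitian_sum {ι σ : Type*} {s : Finset σ} {X : σ → Matrix ι ι ℝ}
    (hX : ∀ i ∈ s, (X i).IsHermitian) : (∑ i ∈ s, X i).IsHermitian := by
  rw [Matrix.IsHermitian, Matrix.conjTranspose_sum]
  exact Finset.sum_congr rfl fun i hi => (hX i hi).eq

theorem isHermitian_one_sub_gram {ι : Type*} [Fintype ι] [DecidableEq ι] (B : Matrix ι ι ℝ) :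
    (1 - Bᵀ * B).IsHermitian :=
  Matrix.isHermitian_one.sub (by simpa using Matrix.isHermitian_conjTranspose_mul_self B)

theorem dotProduct_one_sub_gram_mulVec {ι : Type*} [Fintype ι] [DecidableEq ι] (B : Matrix ι ι ℝ)
    (x : ι → ℝ) : x ⬝ᵥ (1 - Bᵀ * B) *ᵥ x = x ⬝ᵥ x - (B *ᵥ x) ⬝ᵥ (B *ᵥ x) := by
  rw [mulVec_dotProduct_self, Matrix.sub_mulVec, Matrix.one_mulVec, dotProduct_sub]

theorem dotProduct_blockDiag_mulVec {n m : ℕ} (D : Fin n → Matrix (Fin m) (Fin m) ℝ)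
    (x : Fin n × Fin m → ℝ) :
    x ⬝ᵥ blockDiag D *ᵥ x = ∑ j, (fun a => x (j, a)) ⬝ᵥ D j *ᵥ (fun a => x (j, a)) := by
  simp only [dotProduct, Fintype.sum_prod_type, blockDiag_mulVec_apply]

theorem condExpMatrix_blockDiag {n m : ℕ} {Ω : Type*} (F : MeasurableSpace Ω)
    [MeasurableSpace Ω] (P : Measure Ω) (X : Fin n → Ω → Matrix (Fin m) (Fin m) ℝ) (ω : Ω) :
    condExpMatrix P F (fun ω' => blockDiag fun j => X j ω') ω =
      blockDiag fun j => condExpMatrix P F (X j) ω := by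
  ext p q
  by_cases h : p.1 = q.1
  · simp [condExpMatrix, blockDiag, h]
  · have : (P[fun _ : Ω => (0 : ℝ) | F]) = 0 := condExp_zero
    simp [condExpMatrix, blockDiag, h, this]

theorem dotProduct_sum_mulVec {ι σ : Type*} [Fintype ι] (s : Finset σ) (X : σ → Matrix ι ι ℝ)
    (x : ι → ℝ) : x ⬝ᵥ (∑ i ∈ s, X i) *ᵥ x = ∑ i ∈ s, x ⬝ᵥ X i *ᵥ x := by
  rw [Matrix.sum_mulVec, dotProduct_sum]

theorem isBddMeasurable_of_posSemidef {ι Ω : Type*} [Fintype ι] [DecidableEq ι]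
    {F : MeasurableSpace Ω} {D : Ω → Matrix ι ι ℝ} (hD : ∀ a b, Measurable[F] fun ω => D ω a b)
    (h : ∀ ω, (D ω).PosSemidef ∧ (1 - D ω).PosSemidef) : IsBddMeasurable F D :=
  .of_contraction hD fun ω x => mulVec_dotProduct_self_le_self (h ω).1 (h ω).2 x

/-- Summing the dissipation bound over the `n` choices of the initial node compares `n` diagonal
copies of the information matrix with `n * C` times the dissipation matrix, pathwise as forms.
Conditioning preserves this order. -/
theorem exists_isContractionConstant {n : ℕ} (hn : 1 ≤ n) {A : Matrix (Fin n) (Fin n) ℝ}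
    (hA : NetworkAssumption A) (h : ℕ) :
    ∃ s : ℝ, 0 < s ∧ s < 1 ∧ IsContractionConstant.{u} A h s := by
  obtain ⟨C, hC, hbound⟩ := exists_dissipation_bound hA h
  have hpos : 0 < n * C + 2 := by positivity
  -- The summand 2 keeps the constant strictly below 1 even when `C = 0`.
  refine ⟨1 / (n * C + 2), by positivity, ?_, ?_⟩
  · rw [div_lt_one hpos]; nlinarith [mul_nonneg (Nat.cast_nonneg (α := ℝ) n) hC]
  intro m Ω F mΩ P _ D hm hF hDm hD
  have : Nonempty (Fin n × Fin m) := ⟨(⟨0, hn⟩, ⟨0, hm⟩)⟩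
  set Q : Ω → Matrix (Fin m) (Fin m) ℝ :=
    fun ω' => ∑ k ∈ Finset.range h, ∑ i, (1 - D k i ω' * D k i ω') with hQ
  set X : Ω → Matrix (Fin n × Fin m) (Fin n × Fin m) ℝ := fun ω' =>
    1 - (psi A (fun k i => D k i ω') h)ᵀ * psi A (fun k i => D k i ω') h with hX
  have hDb : ∀ k i, IsBddMeasurable mΩ (D k i) := fun k i =>
    isBddMeasurable_of_posSemidef (hDm k i) (hD k i)
  have hQb : IsBddMeasurable mΩ Q := .sum fun k _ => .sum fun i _ =>
    (IsBddMeasurable.const 1).sub ((hDb k i).mul (hDb k i))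
  have hψ : IsBddMeasurable mΩ fun ω => psi A (fun k i => D k i ω) h :=
    .psi A h fun k _ i => hDb k i
  have hXb : IsBddMeasurable mΩ X := (IsBddMeasurable.const 1).sub (hψ.transpose.mul hψ)
  have hQh : ∀ ω, (Q ω).IsHermitian := fun ω =>
    isHermitian_sum fun k _ => isHermitian_sum fun i _ => isHermitian_one_sub_sq (hD k i ω).1.1
  have hXh : ∀ ω, (X ω).IsHermitian := fun ω => isHermitian_one_sub_gram _
  have hXnn : ∀ ω x, 0 ≤ x ⬝ᵥ X ω *ᵥ x := fun ω x => by
    rw [hX, dotProduct_one_sub_gram_mulVec]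
    exact sub_nonneg.2
      (psi_mulVec_dotProduct_self_le hA.doublyStochastic (fun k i => hD k i ω) h x)
  have key := condExpMatrix_dotProduct_mulVec_mono (P := P) (F := F)
    (X := fun ω => blockDiag fun _ : Fin n => Q ω) (Y := fun ω => (n * C) • X ω)
    (IsBddMeasurable.blockDiag fun _ => hQb).integrable (hXb.smul _).integrable (fun ω x => by
      rw [dotProduct_blockDiag_mulVec, Matrix.smul_mulVec, dotProduct_smul, smul_eq_mul, hX,
        dotProduct_one_sub_gram_mulVec]
      calc _ ≤ ∑ j : Fin n, C * (x ⬝ᵥ x - (psi A (fun k i => D k i ω) h *ᵥ x) ⬝ᵥ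
            (psi A (fun k i => D k i ω) h *ᵥ x)) := Finset.sum_le_sum fun j _ => by
            rw [hQ]
            simp only [dotProduct_sum_mulVec]
            exact hbound m (fun k i => D k i ω) (fun k i => hD k i ω) x j
        _ = _ := by simp [mul_assoc])
  have hnn := condExpMatrix_dotProduct_mulVec_nonneg (P := P) (F := F) hXb.integrable hXnn
  filter_upwards [key, hnn, condExpMatrix_smul (P := P) (F := F) (X := X) (n * C)]
    with ω h1 h2 h3
  refine le_lambdaMin (condExpMatrix_isHermitian hXh ω) fun x => ?_
  have h4 := h1 x
  rw [h3, condExpMatrix_blockDiag, dotProduct_blockDiag_mulVec, Matrix.smul_mulVec,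
    dotProduct_smul, smul_eq_mul] at h4
  have h5 : lambdaMin (condExpMatrix P F Q ω) * (x ⬝ᵥ x) ≤
      ∑ j, (fun a => x (j, a)) ⬝ᵥ condExpMatrix P F Q ω *ᵥ (fun a => x (j, a)) := by
    rw [dotProduct_self_prod, Finset.mul_sum]
    exact Finset.sum_le_sum fun j _ => lambdaMin_mul_le (condExpMatrix_isHermitian hQh ω) _
  have h6 := h2 x
  rw [one_div, mul_assoc, inv_mul_le_iff₀ hpos]
  linarith

end Existence

-- Expansion of real powers of a squared norm.

section PowerInequality

/-- The graph of `t ↦ t^l` lies above its tangent at `1 + v`, compared at `t = 1`. It is obtained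
from Bernoulli's inequality at the base `1/(1 + v)`. -/
theorem rpow_one_add_le_one_add_mul {l v : ℝ} (hl : 1 ≤ l) (hv : -1 < v) :
    (1 + v) ^ l ≤ 1 + l * v * (1 + v) ^ (l - 1) := by
  have h0 : 0 < 1 + v := by linarith
  have h1 : 1 + l * (-v / (1 + v)) ≤ (1 + -v / (1 + v)) ^ l := by
    refine one_add_mul_self_le_rpow_one_add ?_ hl
    rw [le_div_iff₀ h0]; linarith
  have h2 : 1 + -v / (1 + v) = (1 + v)⁻¹ := by field_simp; ring
  rw [h2, Real.inv_rpow h0.le] at h1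
  have h3 : 0 < (1 + v) ^ l := Real.rpow_pos_of_pos h0 l
  have h4 := mul_le_mul_of_nonneg_left h1 h3.le
  rw [mul_inv_cancel₀ h3.ne'] at h4
  rw [Real.rpow_sub_one h0.ne']
  have h5 : (1 + v) ^ l * (1 + l * (-v / (1 + v))) =
      (1 + v) ^ l - l * v * ((1 + v) ^ l / (1 + v)) := by field_simp; ring
  linarith

/-- The convexity bound is applied at the exponent `s + 1`, since `s` itself may be less than 1. -/
theorem rpow_one_add_le_of_nonneg {s v : ℝ} (hs : 0 ≤ s) (hv0 : 0 ≤ v) (hv1 : v ≤ 1) :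
    (1 + v) ^ s ≤ 1 + (s + 1) * 2 ^ s * v := by
  have h1 : (1 + v) ^ s ≤ (1 + v) ^ (s + 1) :=
    Real.rpow_le_rpow_of_exponent_le (by linarith) (by linarith)
  have h2 := rpow_one_add_le_one_add_mul (l := s + 1) (v := v) (by linarith) (by linarith)
  rw [add_sub_cancel_right] at h2
  have h3 : (1 + v) ^ s ≤ 2 ^ s := Real.rpow_le_rpow (by linarith) (by linarith) hs
  have h4 : (s + 1) * v * (1 + v) ^ s ≤ (s + 1) * v * 2 ^ s :=
    mul_le_mul_of_nonneg_left h3 (by positivity)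
  linarith

theorem mul_rpow_one_add_le {s v : ℝ} (hs : 0 ≤ s) (hv0 : -1 / 2 ≤ v) (hv1 : v ≤ 1) :
    v * (1 + v) ^ s ≤ v + (s + 1) * 2 ^ s * v ^ 2 := by
  rcases le_total 0 v with h | h
  · have := mul_le_mul_of_nonneg_left (rpow_one_add_le_of_nonneg hs h hv1) h
    linarith
  · have h1 : (1 + v) ^ (s + 1) ≤ (1 + v) ^ s :=
      Real.rpow_le_rpow_of_exponent_ge (by linarith) (by linarith) (by linarith)
    have h2 : 1 + (s + 1) * v ≤ (1 + v) ^ (s + 1) :=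
      one_add_mul_self_le_rpow_one_add (by linarith) (by linarith)
    have h3 : (1 : ℝ) ≤ 2 ^ s := Real.one_le_rpow (by norm_num) hs
    have h4 : v * (1 + v) ^ s ≤ v * (1 + (s + 1) * v) :=
      mul_le_mul_of_nonpos_left (h2.trans h1) h
    have h5 : (s + 1) * 1 * v ^ 2 ≤ (s + 1) * 2 ^ s * v ^ 2 := by gcongr
    linarith

/-- If `q` is bounded below, every term is dominated by a multiple of `q^l`. If `q` is small, a
second-order expansion at 1 leaves a remainder of order `q`, which Young's inequality splits into
`η` and a multiple of `η^(1-l) q^l`. The linear term in `b` must stay exact, because it is the one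
that later integrates to zero. -/
theorem exists_rpow_expansion_bound_one {l : ℝ} (hl : 1 ≤ l) :
    ∃ C : ℝ, 0 ≤ C ∧ ∀ b q η : ℝ, 0 ≤ q → b ^ 2 ≤ q → 0 < η → η ≤ 1 →
      (1 + 2 * b + q) ^ l ≤ 1 + η + 2 * l * b + C * η ^ (1 - l) * q ^ l := by
  set K : ℝ := (l - 1 + 1) * 2 ^ (l - 1) with hK
  have hK0 : 0 ≤ K := by have : 0 ≤ l - 1 := by linarith
                         positivity
  set C₂ : ℝ := l + 9 * l * K with hC₂
  have hC₂0 : 0 ≤ C₂ := by positivity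
  refine ⟨34 ^ l + 2 * l * 16 ^ l + C₂ ^ l, by positivity, fun b q η hq hb hη hη1 => ?_⟩
  have hη' : 1 ≤ η ^ (1 - l) := Real.one_le_rpow_of_pos_of_le_one_of_nonpos hη hη1 (by linarith)
  have hql : 0 ≤ q ^ l := Real.rpow_nonneg hq l
  have hsq : 0 ≤ 1 + 2 * b + q := by nlinarith [sq_nonneg (1 + b)]
  have hηl : 0 ≤ η ^ (1 - l) := by linarith
  rw [add_mul, add_mul, add_mul, add_mul]
  rcases le_or_gt (1 / 16) q with h | h
  · have h1 : 1 + 2 * b + q ≤ 34 * q := by nlinarith [sq_nonneg (b - 1)]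
    have h2 : (1 + 2 * b + q) ^ l ≤ 34 ^ l * q ^ l := by
      rw [← Real.mul_rpow (by norm_num) hq]
      exact Real.rpow_le_rpow hsq h1 (by linarith)
    have h3 : -b ≤ 16 * q := by nlinarith
    have h4 : 16 * q ≤ 16 ^ l * q ^ l := by
      rw [← Real.mul_rpow (by norm_num) hq]
      exact Real.self_le_rpow_of_one_le (by linarith) hl
    have h5 : -(2 * l * b) ≤ 2 * l * 16 ^ l * q ^ l := by
      have := mul_le_mul_of_nonneg_left (h3.trans h4) (by linarith : 0 ≤ 2 * l)
      linarith
    have h6 : 34 ^ l * q ^ l ≤ 34 ^ l * η ^ (1 - l) * q ^ l := by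
      rw [mul_right_comm]; exact le_mul_of_one_le_right (by positivity) hη'
    have h7 : 2 * l * 16 ^ l * q ^ l ≤ 2 * l * 16 ^ l * η ^ (1 - l) * q ^ l := by
      rw [mul_right_comm _ (η ^ (1 - l))]; exact le_mul_of_one_le_right (by positivity) hη'
    have h8 : 0 ≤ C₂ ^ l * η ^ (1 - l) * q ^ l := by positivity
    linarith
  · have hb1 : -(1 / 4) ≤ b := by nlinarith
    have hb2 : b ≤ 1 / 4 := by nlinarith
    set v := 2 * b + q with hv
    have e0 : 1 + 2 * b + q = 1 + v := by rw [hv]; ring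
    rw [e0]
    have e1 := rpow_one_add_le_one_add_mul (v := v) hl (by linarith)
    have e2 := mul_rpow_one_add_le (s := l - 1) (v := v) (by linarith) (by linarith) (by linarith)
    rw [← hK] at e2
    have e3 : v ^ 2 ≤ 9 * q := by
      have : v ^ 2 ≤ 2 * (4 * b ^ 2) + 2 * q ^ 2 := by nlinarith [sq_nonneg (2 * b - q)]
      nlinarith
    have e4 : K * v ^ 2 ≤ K * (9 * q) := mul_le_mul_of_nonneg_left e3 hK0
    have e5 : l * (v * (1 + v) ^ (l - 1)) ≤ l * (v + K * (9 * q)) :=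
      mul_le_mul_of_nonneg_left (by linarith) (by linarith)
    -- Young's inequality by cases: above the level `η`, a number `w` equals `w^l * w^(1-l)`, and
    -- `w^(1-l) ≤ η^(1-l)`.
    have e6 : C₂ * q ≤ η + C₂ ^ l * η ^ (1 - l) * q ^ l := by
      rcases le_or_gt (C₂ * q) η with h1 | h1
      · have : 0 ≤ C₂ ^ l * η ^ (1 - l) * q ^ l := by positivity
        linarith
      · have hw : 0 < C₂ * q := hη.trans h1
        have h2 : C₂ * q = (C₂ * q) ^ l * (C₂ * q) ^ (1 - l) := by
          rw [← Real.rpow_add hw]; simp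
        have h3 : (C₂ * q) ^ (1 - l) ≤ η ^ (1 - l) :=
          Real.rpow_le_rpow_of_nonpos hη h1.le (by linarith)
        have h4 : C₂ * q ≤ (C₂ * q) ^ l * η ^ (1 - l) := by
          conv_lhs => rw [h2]
          exact mul_le_mul_of_nonneg_left h3 (by positivity)
        rw [Real.mul_rpow hC₂0 hq] at h4
        linarith [mul_right_comm (C₂ ^ l) (q ^ l) (η ^ (1 - l))]
    have e7 : 0 ≤ 34 ^ l * η ^ (1 - l) * q ^ l := by positivity
    have e8 : 0 ≤ 2 * l * 16 ^ l * η ^ (1 - l) * q ^ l := by positivity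
    have e9 : l * (v + K * (9 * q)) = 2 * l * b + C₂ * q := by rw [hC₂, hv]; ring
    linarith

/-- Second-order expansion of `|x + y|^{2l}`, with `a = |x|²`, `b = ⟨x, y⟩`, `q = |y|²`. -/
theorem exists_rpow_expansion_bound {l : ℝ} (hl : 1 ≤ l) :
    ∃ C : ℝ, 0 ≤ C ∧ ∀ a b q η : ℝ, 0 ≤ a → 0 ≤ q → b ^ 2 ≤ a * q → 0 < η → η ≤ 1 →
      (a + 2 * b + q) ^ l ≤
        (1 + η) * a ^ l + 2 * l * (a ^ (l - 1) * b) + C * η ^ (1 - l) * q ^ l := by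
  obtain ⟨C, hC, h⟩ := exists_rpow_expansion_bound_one hl
  refine ⟨C + 1, by positivity, fun a b q η ha hq hb hη hη1 => ?_⟩
  have hη' : 1 ≤ η ^ (1 - l) := Real.one_le_rpow_of_pos_of_le_one_of_nonpos hη hη1 (by linarith)
  have hql : 0 ≤ q ^ l := Real.rpow_nonneg hq l
  -- For `a > 0` the claim is homogeneous and reduces to `a = 1`. The case `a = 0` forces `b = 0`
  -- and is the reason for `C + 1`.
  rcases ha.eq_or_lt with rfl | ha
  · have hb0 : b = 0 := by
      rw [zero_mul] at hb
      exact pow_eq_zero_iff two_ne_zero |>.1 (le_antisymm hb (sq_nonneg b))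
    rw [hb0, Real.zero_rpow (by linarith)]
    simp only [mul_zero, zero_add]
    have : 1 ≤ (C + 1) * η ^ (1 - l) := by nlinarith
    exact le_mul_of_one_le_left hql this
  · have h1 := h (b / a) (q / a) η (by positivity) (by
      rw [div_pow, div_le_div_iff₀ (by positivity) ha]; nlinarith) hη hη1
    have h2 : a + 2 * b + q = a * (1 + 2 * (b / a) + q / a) := by field_simp
    have h3 : 0 ≤ 1 + 2 * (b / a) + q / a := by
      have : 0 ≤ a + 2 * b + q := by nlinarith [sq_nonneg (a + b)]
      rw [h2] at this
      exact nonneg_of_mul_nonneg_right this ha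
    rw [h2, Real.mul_rpow ha.le h3]
    have hal : 0 < a ^ l := Real.rpow_pos_of_pos ha l
    refine (mul_le_mul_of_nonneg_left h1 hal.le).trans ?_
    rw [Real.div_rpow hq ha.le, Real.rpow_sub_one ha.ne']
    have e : a ^ l * (1 + η + 2 * l * (b / a) + C * η ^ (1 - l) * (q ^ l / a ^ l)) =
        (1 + η) * a ^ l + 2 * l * (a ^ l / a * b) + C * η ^ (1 - l) * q ^ l := by
      field_simp
    rw [e]
    have : 0 ≤ η ^ (1 - l) * q ^ l := by positivity
    linarith [add_mul C 1 (η ^ (1 - l)), add_mul (C * η ^ (1 - l)) (1 * η ^ (1 - l)) (q ^ l)]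

end PowerInequality

-- Deterministic recursions with polynomially small contraction.

section Deterministic

theorem tendsto_zero_of_le_one_sub_mul {w e : ℕ → ℝ} (hw : ∀ t, 0 ≤ w t)
    (he0 : ∀ t, 0 ≤ e t) (he : ¬ Summable e)
    (h : ∀ t, w (t + 1) ≤ (1 - e t) * w t) : Tendsto w atTop (𝓝 0) := by
  have h1 : ∀ t, w t ≤ w 0 * Real.exp (-∑ j ∈ Finset.range t, e j) := by
    intro t
    induction t with
    | zero => simp
    | succ t ih =>
      calc w (t + 1) ≤ (1 - e t) * w t := h t
        _ ≤ Real.exp (-e t) * (w 0 * Real.exp (-∑ j ∈ Finset.range t, e j)) := by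
            refine mul_le_mul ?_ ih (hw t) (Real.exp_pos _).le
            linarith [Real.add_one_le_exp (-e t)]
        _ = w 0 * Real.exp (-∑ j ∈ Finset.range (t + 1), e j) := by
            rw [Finset.sum_range_succ, neg_add, Real.exp_add]; ring
  have h2 := (not_summable_iff_tendsto_nat_atTop_of_nonneg he0).1 he
  have h3 : Tendsto (fun t => w 0 * Real.exp (-∑ j ∈ Finset.range t, e j)) atTop (𝓝 0) := by
    have := (Real.tendsto_exp_neg_atTop_nhds_zero.comp h2).const_mul (w 0)
    simpa using this
  exact squeeze_zero hw h1 h3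

theorem not_summable_rpow_neg_arithmetic {κ : ℝ} (hκ1 : κ ≤ 1) {r h : ℕ}
    (hr : 1 ≤ r) : ¬ Summable fun t : ℕ => ((r + h * t : ℕ) : ℝ) ^ (-κ) := by
  intro hs
  have h1 : Summable fun t : ℕ => ((r + h : ℕ) : ℝ)⁻¹ * (1 / ((t : ℝ) + 1)) := by
    refine Summable.of_nonneg_of_le (fun t => by positivity) (fun t => ?_) hs
    have hK : (1 : ℝ) ≤ ((r + h * t : ℕ) : ℝ) := by
      exact_mod_cast hr.trans (Nat.le_add_right _ _)
    have h2 : ((r + h * t : ℕ) : ℝ) ≤ ((r + h : ℕ) : ℝ) * ((t : ℝ) + 1) := by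
      have : r + h * t ≤ (r + h) * (t + 1) := by nlinarith
      exact_mod_cast this
    calc ((r + h : ℕ) : ℝ)⁻¹ * (1 / ((t : ℝ) + 1)) = (((r + h : ℕ) : ℝ) * ((t : ℝ) + 1))⁻¹ := by
          rw [mul_inv, one_div]
      _ ≤ (((r + h * t : ℕ) : ℝ))⁻¹ := inv_anti₀ (by linarith) h2
      _ = ((r + h * t : ℕ) : ℝ) ^ (-1 : ℝ) := (Real.rpow_neg_one _).symm
      _ ≤ _ := Real.rpow_le_rpow_of_exponent_le hK (by linarith)
  have hrh : ((r + h : ℕ) : ℝ)⁻¹ ≠ 0 := by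
    have : 0 < r + h := by omega
    positivity
  rw [summable_mul_left_iff hrh] at h1
  have h3 : Summable fun t : ℕ => 1 / (t : ℝ) := by
    rw [← summable_nat_add_iff 1]
    simpa using h1
  exact Real.not_summable_one_div_natCast h3

/-- Polynomial growth of the weights is absorbed by the contraction. -/
theorem eventually_ratio_rpow_mul_le {κ g b : ℝ} (hκ0 : 0 < κ) (hκ1 : κ < 1) (hg : 0 ≤ g)
    (hb : 0 < b) (h : ℕ) :
    ∀ᶠ k : ℕ in atTop, 0 ≤ 1 - b * (k : ℝ) ^ (-κ) ∧
      ((k + h : ℕ) : ℝ) ^ g * (1 - b * (k : ℝ) ^ (-κ)) ≤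
        (k : ℝ) ^ g * (1 - 3 / 4 * b * (k : ℝ) ^ (-κ)) ∧
      ((k + h : ℕ) : ℝ) ^ g ≤ 3 / 2 * (k : ℝ) ^ g := by
  -- The weight ratio is at most `1 + c/k`. As `κ < 1`, the excess `c/k` is eventually below a
  -- quarter of `b k^(-κ)`, which is where the factor 3/4 comes from.
  set c : ℝ := (g + 1) * 2 ^ g * h with hc
  have hc0 : 0 ≤ c := by positivity
  have t1 : Tendsto (fun k : ℕ => b * (k : ℝ) ^ (-κ)) atTop (𝓝 (b * 0)) :=
    ((tendsto_rpow_neg_atTop hκ0).comp tendsto_natCast_atTop_atTop).const_mul b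
  have t2 : Tendsto (fun k : ℕ => (k : ℝ) ^ (1 - κ)) atTop atTop :=
    (tendsto_rpow_atTop (by linarith)).comp tendsto_natCast_atTop_atTop
  rw [mul_zero] at t1
  filter_upwards [t1.eventually (eventually_le_nhds (show (0 : ℝ) < 1 by norm_num)),
    t2.eventually_ge_atTop (4 * c / b), eventually_ge_atTop (max 1 h),
    tendsto_natCast_atTop_atTop.eventually_ge_atTop (2 * c)] with k h1 h2 h3 h4
  have hk1 : 1 ≤ k := (le_max_left _ _).trans h3
  have hkh : (h : ℝ) ≤ k := by exact_mod_cast (le_max_right _ _).trans h3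
  have hk : (0 : ℝ) < k := by exact_mod_cast hk1
  have hkg : 0 < (k : ℝ) ^ g := Real.rpow_pos_of_pos hk g
  have e1 : ((k + h : ℕ) : ℝ) ^ g = (k : ℝ) ^ g * (1 + h / k) ^ g := by
    rw [← Real.mul_rpow hk.le (by positivity)]
    congr 1; push_cast; field_simp
  have e2 : (1 + (h : ℝ) / k) ^ g ≤ 1 + c / k := by
    have := rpow_one_add_le_of_nonneg hg (by positivity : (0 : ℝ) ≤ h / k)
      ((div_le_one hk).2 hkh)
    rw [hc]
    convert this using 2
    ring
  have h1' : 0 ≤ 1 - b * (k : ℝ) ^ (-κ) := by linarith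
  refine ⟨h1', ?_, ?_⟩
  · rw [e1, mul_assoc]
    refine mul_le_mul_of_nonneg_left ?_ hkg.le
    refine (mul_le_mul_of_nonneg_right e2 h1').trans ?_
    have e3 : c / k ≤ 1 / 4 * b * (k : ℝ) ^ (-κ) := by
      have : (k : ℝ) ^ (1 - κ) = k * (k : ℝ) ^ (-κ) := by
        rw [sub_eq_add_neg, Real.rpow_add hk, Real.rpow_one]
      rw [this, div_le_iff₀ hb] at h2
      rw [div_le_iff₀ hk]
      linarith
    have e4 : 0 ≤ c / k := by positivity
    have e5 : 0 ≤ b * (k : ℝ) ^ (-κ) := by positivity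
    nlinarith
  · rw [e1, mul_comm]
    refine mul_le_mul_of_nonneg_right (e2.trans ?_) hkg.le
    have : c / k ≤ 1 / 2 := by rw [div_le_iff₀ hk]; linarith
    linarith

theorem eventually_rpow_mul_le_of_recursion {κ g b C : ℝ} (hκ0 : 0 < κ) (hκ1 : κ < 1) (hg : 0 ≤ g)
    (hb : 0 < b) (hC : 0 ≤ C) {r h : ℕ} (hr : 1 ≤ r) (hh : 1 ≤ h) {u : ℕ → ℝ}
    (hu : ∀ᶠ t in atTop, u (t + 1) ≤ (1 - b * ((r + h * t : ℕ) : ℝ) ^ (-κ)) * u t +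
      C * ((r + h * t : ℕ) : ℝ) ^ (-κ - g)) {η : ℝ} (hη : 0 < η) :
    ∀ᶠ t in atTop, ((r + h * t : ℕ) : ℝ) ^ g * u t ≤ 2 * C / b + η := by
  have hKt : Tendsto (fun t : ℕ => r + h * t) atTop atTop :=
    tendsto_atTop_mono (fun t => by
      have := Nat.le_mul_of_pos_left t hh
      simp only [id]; omega) tendsto_id
  -- `L` balances the losses: the weighted forcing is at most `(3/2) C k^(-κ)` and the contraction
  -- is `(3/4) b k^(-κ)`. Since `(3/2) C = (3/4) b L`, the positive excess over `L` obeys a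
  -- homogeneous recursion whose rates have divergent sum.
  set L := 2 * C / b with hL
  have hstep : ∀ᶠ t in atTop, (3 / 4 * b * ((r + h * t : ℕ) : ℝ) ^ (-κ) ≤ 1) ∧
      max (((r + h * (t + 1) : ℕ) : ℝ) ^ g * u (t + 1) - L) 0 ≤
      (1 - 3 / 4 * b * ((r + h * t : ℕ) : ℝ) ^ (-κ)) *
        max (((r + h * t : ℕ) : ℝ) ^ g * u t - L) 0 := by
    filter_upwards [hu, hKt.eventually (eventually_ratio_rpow_mul_le hκ0 hκ1 hg hb h)]
      with t h1 h2
    obtain ⟨h2, h3, h4⟩ := h2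
    have hKs : r + h * (t + 1) = r + h * t + h := by ring
    rw [hKs]
    set k := r + h * t with hk
    have hk0 : (0 : ℝ) < k := by exact_mod_cast (by omega : 0 < k)
    have hx : 0 ≤ (k : ℝ) ^ (-κ) := by positivity
    have h5 : 3 / 4 * b * (k : ℝ) ^ (-κ) ≤ 1 := by nlinarith [mul_nonneg hb.le hx]
    refine ⟨h5, ?_⟩
    have hm0 : 0 ≤ max ((k : ℝ) ^ g * u t - L) 0 := le_max_right _ _
    refine max_le ?_ (mul_nonneg (by linarith) hm0)
    have hkh : 0 ≤ ((k + h : ℕ) : ℝ) ^ g := by positivity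
    have hkg : 0 < (k : ℝ) ^ g := by positivity
    -- replace `u t` by its positive excess over `L k^{-g}`
    set v := max (u t - L * (k : ℝ) ^ (-g)) 0 with hv
    have e1 : u t ≤ v + L * (k : ℝ) ^ (-g) := by
      have := le_max_left (u t - L * (k : ℝ) ^ (-g)) 0
      linarith
    have e0 : (k : ℝ) ^ g * (k : ℝ) ^ (-g) = 1 := by
      rw [← Real.rpow_add hk0]; simp
    have e2 : (k : ℝ) ^ g * v = max ((k : ℝ) ^ g * u t - L) 0 := by
      rw [hv, mul_max_of_nonneg _ _ hkg.le, mul_zero, mul_sub, mul_left_comm, e0, mul_one]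
    have e3 : u (t + 1) ≤ (1 - b * (k : ℝ) ^ (-κ)) * (v + L * (k : ℝ) ^ (-g)) +
        C * (k : ℝ) ^ (-κ - g) := h1.trans (by gcongr)
    have e4 : (k : ℝ) ^ (-κ - g) = (k : ℝ) ^ (-κ) * (k : ℝ) ^ (-g) := by
      rw [← Real.rpow_add hk0]; ring_nf
    have hv0 : 0 ≤ v + L * (k : ℝ) ^ (-g) := by
      have : 0 ≤ L := by positivity
      have : 0 ≤ v := le_max_right _ _
      positivity
    have e5 : ((k + h : ℕ) : ℝ) ^ g * u (t + 1) ≤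
        (k : ℝ) ^ g * (1 - 3 / 4 * b * (k : ℝ) ^ (-κ)) * (v + L * (k : ℝ) ^ (-g)) +
        3 / 2 * (k : ℝ) ^ g * (C * ((k : ℝ) ^ (-κ) * (k : ℝ) ^ (-g))) := by
      rw [e4] at e3
      calc _ ≤ ((k + h : ℕ) : ℝ) ^ g * ((1 - b * (k : ℝ) ^ (-κ)) * (v + L * (k : ℝ) ^ (-g)) +
            C * ((k : ℝ) ^ (-κ) * (k : ℝ) ^ (-g))) := mul_le_mul_of_nonneg_left e3 hkh
        _ = (((k + h : ℕ) : ℝ) ^ g * (1 - b * (k : ℝ) ^ (-κ))) * (v + L * (k : ℝ) ^ (-g)) +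
            ((k + h : ℕ) : ℝ) ^ g * (C * ((k : ℝ) ^ (-κ) * (k : ℝ) ^ (-g))) := by ring
        _ ≤ _ := add_le_add (mul_le_mul_of_nonneg_right h3 hv0)
            (mul_le_mul_of_nonneg_right h4 (by positivity))
    have e6 : (k : ℝ) ^ g * (1 - 3 / 4 * b * (k : ℝ) ^ (-κ)) * (v + L * (k : ℝ) ^ (-g)) +
        3 / 2 * (k : ℝ) ^ g * (C * ((k : ℝ) ^ (-κ) * (k : ℝ) ^ (-g))) =
        (1 - 3 / 4 * b * (k : ℝ) ^ (-κ)) * ((k : ℝ) ^ g * v) +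
        ((k : ℝ) ^ g * (k : ℝ) ^ (-g)) * ((1 - 3 / 4 * b * (k : ℝ) ^ (-κ)) * L +
          3 / 2 * C * (k : ℝ) ^ (-κ)) := by ring
    have e7 : 3 / 2 * C = 3 / 4 * b * L := by rw [hL]; field_simp; ring
    rw [e6, e0, e2, e7] at e5
    linarith
  obtain ⟨T, hT⟩ := eventually_atTop.1 hstep
  have hns : ¬ Summable fun t => 3 / 4 * b * ((r + h * (t + T) : ℕ) : ℝ) ^ (-κ) := by
    rw [summable_mul_left_iff (by positivity),
      summable_nat_add_iff (f := fun t => ((r + h * t : ℕ) : ℝ) ^ (-κ)) T]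
    exact not_summable_rpow_neg_arithmetic hκ1.le hr
  have hlim := tendsto_zero_of_le_one_sub_mul
    (w := fun t => max (((r + h * (t + T) : ℕ) : ℝ) ^ g * u (t + T) - L) 0)
    (fun t => le_max_right _ _) (fun t => by positivity) hns (fun t => by
      have := (hT (t + T) (by omega)).2
      rwa [show t + T + 1 = t + 1 + T by ring] at this)
  obtain ⟨T', hT'⟩ := eventually_atTop.1 (hlim.eventually (eventually_le_nhds hη))
  refine eventually_atTop.2 ⟨T' + T, fun t ht => ?_⟩
  have h9 := (le_max_left _ _).trans (hT' (t - T) (by omega))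
  rw [Nat.sub_add_cancel (by omega)] at h9
  linarith

end Deterministic

-- Convergence of almost supermartingales.

section AlmostSupermartingale

variable {Ω : Type*} [mΩ : MeasurableSpace Ω] {P : Measure Ω}

theorem eLpNorm_one_le_of_integral_abs_le {f : Ω → ℝ} (hf : Integrable f P) {B : ℝ}
    (h : ∫ ω, |f ω| ∂P ≤ B) : eLpNorm f 1 P ≤ (B.toNNReal : ENNReal) := by
  rw [eLpNorm_one_eq_lintegral_enorm, ← ofReal_integral_norm_eq_lintegral_enorm hf]
  exact ENNReal.ofReal_le_ofReal h

/-- Convergence to zero in `L¹` gives an almost surely vanishing subsequence, which identifies the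
limit. -/
theorem ae_eq_zero_of_tendsto_integral {Y : ℕ → Ω → ℝ} {Z : Ω → ℝ} (hY0 : ∀ t ω, 0 ≤ Y t ω)
    (hY : ∀ t, Integrable (Y t) P) (hlim : Tendsto (fun t => ∫ ω, Y t ω ∂P) atTop (𝓝 0))
    (hZ : ∀ᵐ ω ∂P, Tendsto (fun t => Y t ω) atTop (𝓝 (Z ω))) : ∀ᵐ ω ∂P, Z ω = 0 := by
  have h1 : Tendsto (fun t => eLpNorm (Y t - 0) 1 P) atTop (𝓝 0) := by
    have e : ∀ t, eLpNorm (Y t - 0) 1 P = ENNReal.ofReal (∫ ω, Y t ω ∂P) := by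
      intro t
      rw [sub_zero, eLpNorm_one_eq_lintegral_enorm,
        ← ofReal_integral_norm_eq_lintegral_enorm (hY t)]
      simp only [Real.norm_eq_abs, abs_of_nonneg (hY0 t _)]
    simp only [e]
    simpa using ENNReal.tendsto_ofReal hlim
  have h2 := tendstoInMeasure_of_tendsto_eLpNorm one_ne_zero
    (fun t => (hY t).aestronglyMeasurable) aestronglyMeasurable_zero h1
  obtain ⟨ns, hns, h3⟩ := h2.exists_seq_tendsto_ae
  filter_upwards [hZ, h3] with ω h4 h5
  exact tendsto_nhds_unique (h4.comp hns.tendsto_atTop) h5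

/-- A nonnegative almost supermartingale whose expectation tends to zero converges to zero almost
surely. -/
theorem ae_tendsto_zero_of_almostSupermartingale [IsFiniteMeasure P] (ℱ : Filtration ℕ mΩ) {Y R : ℕ → Ω → ℝ}
    (hY0 : ∀ t ω, 0 ≤ Y t ω) (hR0 : ∀ t ω, 0 ≤ R t ω)
    (hYm : ∀ t, Measurable[ℱ t] (Y t)) (hRm : ∀ t, Measurable[ℱ (t + 1)] (R t))
    (hY : ∀ t, Integrable (Y t) P) (hR : ∀ t, Integrable (R t) P)
    (hstep : ∀ t s, MeasurableSet[ℱ t] s →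
      ∫ ω in s, Y (t + 1) ω ∂P ≤ ∫ ω in s, Y t ω ∂P + ∫ ω in s, R t ω ∂P)
    (hsum : Summable fun t => ∫ ω, R t ω ∂P)
    (hlim : Tendsto (fun t => ∫ ω, Y t ω ∂P) atTop (𝓝 0)) :
    ∀ᵐ ω ∂P, Tendsto (fun t => Y t ω) atTop (𝓝 0) := by
  set S : ℕ → Ω → ℝ := fun t ω => ∑ j ∈ Finset.range t, R j ω with hS
  have hSi : ∀ t, Integrable (S t) P := fun t => integrable_finsetSum _ fun j _ => hR j
  have hS0 : ∀ t ω, 0 ≤ S t ω := fun t ω => Finset.sum_nonneg fun j _ => hR0 j ω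
  have hSm : ∀ t, Measurable[ℱ t] (S t) := fun t => by
    refine Finset.measurable_sum _ fun j hj => ?_
    exact (hRm j).mono (ℱ.mono (Finset.mem_range.1 hj)) le_rfl
  have hSint : ∀ t, ∫ ω, S t ω ∂P ≤ ∑' j, ∫ ω, R j ω ∂P := fun t => by
    rw [integral_finsetSum _ fun j _ => hR j]
    exact hsum.sum_le_tsum _ fun j _ => integral_nonneg (hR0 j)
  have hSs : ∀ t ω, S (t + 1) ω = S t ω + R t ω := fun t ω => Finset.sum_range_succ _ _
  obtain ⟨B, hB⟩ := hlim.bddAbove_range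
  have hSsub : Submartingale S ℱ P := by
    refine submartingale_of_setIntegral_le_succ (fun t => (hSm t).stronglyMeasurable) hSi
      fun t s _ => ?_
    refine setIntegral_mono (hSi t).integrableOn (hSi (t + 1)).integrableOn fun ω => ?_
    rw [hSs]
    linarith [hR0 t ω]
  -- The accumulated perturbation and its difference with `Y` are both submartingales bounded in
  -- `L¹`, so `Y` converges almost surely as a difference of convergent sequences.
  have hW : Submartingale (fun t ω => S t ω - Y t ω) ℱ P := by
    refine submartingale_of_setIntegral_le_succ
      (fun t => ((hSm t).sub (hYm t)).stronglyMeasurable) (fun t => (hSi t).sub (hY t))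
      fun t s hs => ?_
    rw [integral_sub (hSi t).integrableOn (hY t).integrableOn,
      integral_sub (hSi (t + 1)).integrableOn (hY (t + 1)).integrableOn]
    simp only [hSs]
    rw [integral_add (hSi t).integrableOn (hR t).integrableOn]
    linarith [hstep t s hs]
  have c1 := hSsub.ae_tendsto_limitProcess (R := (∑' j, ∫ ω, R j ω ∂P).toNNReal) fun t => by
    refine eLpNorm_one_le_of_integral_abs_le (hSi t) ?_
    simp only [abs_of_nonneg (hS0 t _)]
    exact hSint t
  have c2 := hW.ae_tendsto_limitProcess (R := (∑' j, ∫ ω, R j ω ∂P + B).toNNReal) fun t => by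
    refine eLpNorm_one_le_of_integral_abs_le ((hSi t).sub (hY t)) ?_
    calc ∫ ω, |S t ω - Y t ω| ∂P ≤ ∫ ω, (S t ω + Y t ω) ∂P := by
          refine integral_mono ((hSi t).sub (hY t)).abs ((hSi t).add (hY t)) fun ω => ?_
          refine abs_le.2 ⟨?_, ?_⟩ <;> linarith [hS0 t ω, hY0 t ω]
      _ = ∫ ω, S t ω ∂P + ∫ ω, Y t ω ∂P := integral_add (hSi t) (hY t)
      _ ≤ _ := add_le_add (hSint t) (hB ⟨t, rfl⟩)
  have c3 : ∀ᵐ ω ∂P, Tendsto (fun t => Y t ω) atTop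
      (𝓝 (Filtration.limitProcess S ℱ P ω -
        Filtration.limitProcess (fun t ω => S t ω - Y t ω) ℱ P ω)) := by
    filter_upwards [c1, c2] with ω h1 h2
    simpa using h1.sub h2
  filter_upwards [c3, ae_eq_zero_of_tendsto_integral hY0 hY hlim c3] with ω h1 h2
  rwa [h2] at h1

end AlmostSupermartingale

-- Second moments of contractive recursions.

section Recursion

/-- The transition matrices `B_{k+i-1} ⋯ B_k`. -/
def transition {ι Ω : Type*} [Fintype ι] [DecidableEq ι] (B : ℕ → Ω → Matrix ι ι ℝ) (k : ℕ) :
    ℕ → Ω → Matrix ι ι ℝ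
  | 0, _ => 1
  | i + 1, ω => B (k + i) ω * transition B k i ω

/-- The noise accumulated by the recursion between the times `k` and `k + i`. -/
def accumulatedNoise {ι κ Ω : Type*} [Fintype ι] [Fintype κ] (B : ℕ → Ω → Matrix ι ι ℝ)
    (g : ℕ → Ω → Matrix ι κ ℝ) (v : ℕ → Ω → κ → ℝ) (k : ℕ) : ℕ → Ω → ι → ℝ
  | 0, _ => 0
  | i + 1, ω => B (k + i) ω *ᵥ accumulatedNoise B g v k i ω + g (k + i) ω *ᵥ v (k + i) ω

/-- A linear recursion `x_{k+1} = B_k x_k + g_k v_k` with contractive random matrices `B_k` and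
centered noises `v_k`. The state `x_k` is known at `F k`; the larger σ-algebra `H k` also contains
the coefficients over the next `h` steps, and the noise `v_k` is centered given `H k`. -/
structure IsContractiveRecursion {ι κ Ω : Type*} [Fintype ι] [Fintype κ] [mΩ : MeasurableSpace Ω]
    (P : Measure Ω) (h : ℕ) (F H : ℕ → MeasurableSpace Ω) (a : ℕ → ℝ)
    (B : ℕ → Ω → Matrix ι ι ℝ) (g : ℕ → Ω → Matrix ι κ ℝ) (v : ℕ → Ω → κ → ℝ)
    (x : ℕ → Ω → ι → ℝ) : Prop where
  one_le : 1 ≤ h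
  past_le : ∀ k, F k ≤ H k
  past_mono : Monotone F
  mono : Monotone H
  le : ∀ k, H k ≤ mΩ
  succ_eq : ∀ k ω, x (k + 1) ω = B k ω *ᵥ x k ω + g k ω *ᵥ v k ω
  contraction : ∀ k ω z, (B k ω *ᵥ z) ⬝ᵥ (B k ω *ᵥ z) ≤ z ⬝ᵥ z
  gain_le : ∀ k ω u, (g k ω *ᵥ u) ⬝ᵥ (g k ω *ᵥ u) ≤ a k ^ 2 / 4 * (u ⬝ᵥ u)
  measurable_B : ∀ k j, j < k + h → ∀ p q, Measurable[H k] fun ω => B j ω p q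
  measurable_g : ∀ k j, j < k + h → ∀ p q, Measurable[H k] fun ω => g j ω p q
  measurable_B_past : ∀ k p q, Measurable[F (k + 1)] fun ω => B k ω p q
  measurable_x : ∀ k p, Measurable[F k] fun ω => x k ω p
  measurable_v : ∀ k q, Measurable[H (k + 1)] fun ω => v k ω q
  memLp_zero : ∀ p, MemLp (fun ω => x 0 ω p) 2 P
  memLp_v : ∀ k q, MemLp (fun ω => v k ω q) 2 P
  centered : ∀ k q, P[fun ω => v k ω q | H k] =ᵐ[P] 0

variable {ι κ Ω : Type*} [Fintype ι] [Fintype κ] {mΩ : MeasurableSpace Ω}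
  {P : Measure Ω} {h : ℕ} {F H : ℕ → MeasurableSpace Ω} {a : ℕ → ℝ}
  {B : ℕ → Ω → Matrix ι ι ℝ} {g : ℕ → Ω → Matrix ι κ ℝ} {v : ℕ → Ω → κ → ℝ} {x : ℕ → Ω → ι → ℝ}

theorem measurable_mulVec_apply {τ : Type*} {σ : MeasurableSpace Ω} {X : Ω → Matrix τ κ ℝ}
    {z : Ω → κ → ℝ} (hX : ∀ p q, Measurable[σ] fun ω => X ω p q)
    (hz : ∀ q, Measurable[σ] fun ω => z ω q) (p : τ) :
    Measurable[σ] fun ω => (X ω *ᵥ z ω) p := by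
  simp only [Matrix.mulVec, dotProduct]
  exact Finset.measurable_sum _ fun q _ => (hX p q).mul (hz q)

theorem measurable_dotProduct {σ : MeasurableSpace Ω} {y z : Ω → ι → ℝ}
    (hy : ∀ q, Measurable[σ] fun ω => y ω q) (hz : ∀ q, Measurable[σ] fun ω => z ω q) :
    Measurable[σ] fun ω => y ω ⬝ᵥ z ω := by
  simp only [dotProduct]
  exact Finset.measurable_sum _ fun q _ => (hy q).mul (hz q)

theorem memLp_mulVec_apply {τ : Type*} {X : Ω → Matrix τ κ ℝ} {z : Ω → κ → ℝ}
    (hX : IsBddMeasurable mΩ X) (hz : ∀ q, MemLp (fun ω => z ω q) 2 P) (p : τ) :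
    MemLp (fun ω => (X ω *ᵥ z ω) p) 2 P := by
  simp only [Matrix.mulVec, dotProduct]
  refine memLp_finsetSum _ fun q _ => ?_
  obtain ⟨C, hC⟩ := hX.bounded p q
  exact (hz q).of_le_mul (c := C)
    ((hX.measurable p q).aestronglyMeasurable.mul (hz q).aestronglyMeasurable)
    (Eventually.of_forall fun ω => by
      rw [norm_mul]; exact mul_le_mul_of_nonneg_right (hC ω) (norm_nonneg _))

theorem integrable_dotProduct {y z : Ω → ι → ℝ} (hy : ∀ q, MemLp (fun ω => y ω q) 2 P)
    (hz : ∀ q, MemLp (fun ω => z ω q) 2 P) : Integrable (fun ω => y ω ⬝ᵥ z ω) P := by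
  simp only [dotProduct]
  exact integrable_finsetSum _ fun q _ => (hy q).integrable_mul (hz q)

theorem memLp_of_integrable_dotProduct_self {z : Ω → ι → ℝ} (hz : ∀ q, Measurable fun ω => z ω q)
    (h : Integrable (fun ω => z ω ⬝ᵥ z ω) P) (q : ι) : MemLp (fun ω => z ω q) 2 P := by
  rw [memLp_two_iff_integrable_sq (hz q).aestronglyMeasurable]
  refine h.mono' ((hz q).pow_const 2).aestronglyMeasurable (Eventually.of_forall fun ω => ?_)
  rw [Real.norm_eq_abs, abs_of_nonneg (sq_nonneg _), dotProduct_self_sum]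
  exact Finset.single_le_sum (f := fun i => z ω i ^ 2) (fun i _ => sq_nonneg _) (Finset.mem_univ q)

theorem isBddMeasurable_of_mulVec_le {σ : MeasurableSpace Ω} {X : Ω → Matrix ι κ ℝ} {C : ℝ}
    (hX : ∀ p q, Measurable[σ] fun ω => X ω p q)
    (h : ∀ ω u, (X ω *ᵥ u) ⬝ᵥ (X ω *ᵥ u) ≤ C ^ 2 * (u ⬝ᵥ u)) : IsBddMeasurable σ X := by
  classical
  refine ⟨hX, fun p q => ⟨|C|, fun ω => ?_⟩⟩
  have h1 := h ω (Pi.single q 1)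
  rw [dotProduct_self_sum, dotProduct_self_sum] at h1
  have h2 : ∑ i, (Pi.single q (1 : ℝ) : κ → ℝ) i ^ 2 = 1 := by
    rw [Finset.sum_eq_single q] <;> simp +contextual
  rw [h2] at h1
  have h3 := (Finset.single_le_sum (f := fun i => (X ω *ᵥ Pi.single q (1 : ℝ)) i ^ 2)
    (fun i _ => sq_nonneg _) (Finset.mem_univ p)).trans h1
  simp only [Matrix.mulVec_single_one, mul_one] at h3
  exact sq_le_sq.1 h3

namespace IsContractiveRecursion

theorem isBddMeasurable_B (hx : IsContractiveRecursion P h F H a B g v x) {k j : ℕ}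
    (hj : j < k + h) : IsBddMeasurable (H k) (B j) := by
  refine isBddMeasurable_of_mulVec_le (C := 1) (hx.measurable_B k j hj) fun ω u => ?_
  simpa using hx.contraction j ω u

theorem isBddMeasurable_g (hx : IsContractiveRecursion P h F H a B g v x) {k j : ℕ}
    (hj : j < k + h) : IsBddMeasurable (H k) (g j) := by
  refine isBddMeasurable_of_mulVec_le (C := a j / 2) (hx.measurable_g k j hj) fun ω u => ?_
  refine (hx.gain_le j ω u).trans_eq ?_
  ring

theorem measurable_x_top (hx : IsContractiveRecursion P h F H a B g v x) (k : ℕ) (p : ι) :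
    Measurable fun ω => x k ω p :=
  (hx.measurable_x k p).mono ((hx.past_le k).trans (hx.le k)) le_rfl

theorem memLp_x (hx : IsContractiveRecursion P h F H a B g v x) (k : ℕ) (p : ι) :
    MemLp (fun ω => x k ω p) 2 P := by
  induction k generalizing p with
  | zero => exact hx.memLp_zero p
  | succ k ih =>
    have := hx.one_le
    simp only [hx.succ_eq, Pi.add_apply]
    exact (memLp_mulVec_apply ((hx.isBddMeasurable_B (k := k) (by omega)).mono (hx.le k)) ih p).add
      (memLp_mulVec_apply ((hx.isBddMeasurable_g (k := k) (by omega)).mono (hx.le k))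
        (hx.memLp_v k) p)

theorem measurable_accumulatedNoise (hx : IsContractiveRecursion P h F H a B g v x) (k i : ℕ)
    (p : ι) : Measurable[H (k + i)] fun ω => accumulatedNoise B g v k i ω p := by
  induction i generalizing p with
  | zero => exact measurable_const
  | succ i ih =>
    have h1 := hx.one_le
    have h2 : H (k + i) ≤ H (k + (i + 1)) := hx.mono (by omega)
    refine Measurable.add (measurable_mulVec_apply (hx.measurable_B _ _ (by omega))
      (fun q => (ih q).mono h2 le_rfl) p) ?_
    exact measurable_mulVec_apply (hx.measurable_g _ _ (by omega)) (hx.measurable_v _) p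

theorem measurable_accumulatedNoise_top (hx : IsContractiveRecursion P h F H a B g v x) (k i : ℕ)
    (p : ι) : Measurable fun ω => accumulatedNoise B g v k i ω p :=
  (hx.measurable_accumulatedNoise k i p).mono (hx.le _) le_rfl

theorem memLp_accumulatedNoise (hx : IsContractiveRecursion P h F H a B g v x) (k i : ℕ) (p : ι) :
    MemLp (fun ω => accumulatedNoise B g v k i ω p) 2 P := by
  induction i generalizing p with
  | zero => exact MemLp.zero
  | succ i ih =>
    have := hx.one_le
    exact (memLp_mulVec_apply
      ((hx.isBddMeasurable_B (k := k + i) (by omega)).mono (hx.le _)) ih p).add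
      (memLp_mulVec_apply ((hx.isBddMeasurable_g (k := k + i) (by omega)).mono (hx.le _))
        (hx.memLp_v _) p)

theorem integral_mul_v_eq_zero [IsFiniteMeasure P] (hx : IsContractiveRecursion P h F H a B g v x)
    (k : ℕ) (q : κ) {Z : Ω → ℝ} (hZ : Measurable[H k] Z)
    (hi : Integrable (fun ω => Z ω * v k ω q) P) : ∫ ω, Z ω * v k ω q ∂P = 0 := by
  have h1 := condExp_mul_of_stronglyMeasurable_left (μ := P) (m := H k) hZ.stronglyMeasurable
    (g := fun ω => v k ω q) hi ((hx.memLp_v k q).integrable one_le_two)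
  have h2 : P[Z * (fun ω => v k ω q) | H k] =ᵐ[P] 0 := by
    filter_upwards [h1, hx.centered k q] with ω e1 e2
    rw [e1, Pi.mul_apply, e2]
    simp
  have h3 := integral_condExp (μ := P) (hx.le k) (f := Z * (fun ω => v k ω q))
  rw [integral_congr_ae h2] at h3
  simpa using h3.symm

/-- The accumulated noise is uncorrelated with everything known at its start. -/
theorem integral_dotProduct_accumulatedNoise [IsFiniteMeasure P]
    (hx : IsContractiveRecursion P h F H a B g v x) (k i : ℕ) (hi : i ≤ h) {Z : Ω → ι → ℝ}
    (hZ : ∀ p, Measurable[H k] fun ω => Z ω p)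
    (hint : ∀ p, ∀ j < i, ∀ q, Integrable (fun ω => Z ω p * v (k + j) ω q) P) :
    Integrable (fun ω => Z ω ⬝ᵥ accumulatedNoise B g v k i ω) P ∧
      ∫ ω, Z ω ⬝ᵥ accumulatedNoise B g v k i ω ∂P = 0 := by
  induction i generalizing Z with
  | zero => simp [accumulatedNoise]
  | succ i ih =>
    have hB := hx.isBddMeasurable_B (k := k) (j := k + i) (by omega)
    have hg := hx.isBddMeasurable_g (k := k) (j := k + i) (by omega)
    -- The last matrix is transposed onto `Z`. The new vector is still known at `H k`, because `H k`
    -- contains the coefficients of `h` steps ahead; this is where `i ≤ h` enters.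
    have e : ∀ ω, Z ω ⬝ᵥ accumulatedNoise B g v k (i + 1) ω =
        ((B (k + i) ω)ᵀ *ᵥ Z ω) ⬝ᵥ accumulatedNoise B g v k i ω +
          ∑ q, ∑ p, g (k + i) ω p q * (Z ω p * v (k + i) ω q) := by
      intro ω
      rw [accumulatedNoise, dotProduct_add, Matrix.dotProduct_mulVec, Matrix.mulVec_transpose]
      congr 1
      simp only [dotProduct, Matrix.mulVec, Finset.mul_sum]
      rw [Finset.sum_comm]
      exact Finset.sum_congr rfl fun q _ => Finset.sum_congr rfl fun p _ => by ring
    have h1 : ∀ p, ∀ j < i, ∀ q,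
        Integrable (fun ω => ((B (k + i) ω)ᵀ *ᵥ Z ω) p * v (k + j) ω q) P := by
      intro p j hj q
      simp only [Matrix.mulVec, dotProduct, Finset.sum_mul, mul_assoc]
      refine integrable_finsetSum _ fun p' _ => ?_
      obtain ⟨C, hC⟩ := hB.bounded p' p
      exact (hint p' j (by omega) q).bdd_mul (c := C)
        ((hB.measurable p' p).mono (hx.le k) le_rfl).aestronglyMeasurable
        (Eventually.of_forall fun ω => hC ω)
    obtain ⟨i1, i2⟩ := ih (by omega) (fun p => measurable_mulVec_apply
      (X := fun ω => (B (k + i) ω)ᵀ) (fun p q => hB.measurable q p) hZ p) h1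
    have h2 : ∀ q p, Integrable (fun ω => g (k + i) ω p q * (Z ω p * v (k + i) ω q)) P := by
      intro q p
      obtain ⟨C, hC⟩ := hg.bounded p q
      exact (hint p i (by omega) q).bdd_mul (c := C)
        ((hg.measurable p q).mono (hx.le k) le_rfl).aestronglyMeasurable
        (Eventually.of_forall fun ω => hC ω)
    have h3 : ∀ q p, ∫ ω, g (k + i) ω p q * (Z ω p * v (k + i) ω q) ∂P = 0 := by
      intro q p
      have hm : H k ≤ H (k + i) := hx.mono (by omega)
      have := hx.integral_mul_v_eq_zero (k + i) q (Z := fun ω => g (k + i) ω p q * Z ω p)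
        (((hg.measurable p q).mul (hZ p)).mono hm le_rfl) (by simpa only [mul_assoc] using h2 q p)
      simpa only [mul_assoc] using this
    have h4 : Integrable (fun ω => ∑ q, ∑ p, g (k + i) ω p q * (Z ω p * v (k + i) ω q)) P :=
      integrable_finsetSum _ fun q _ => integrable_finsetSum _ fun p _ => h2 q p
    simp only [e]
    refine ⟨i1.add h4, ?_⟩
    rw [integral_add i1 h4, i2, integral_finsetSum _ fun q _ =>
      integrable_finsetSum _ fun p _ => h2 q p, zero_add]
    refine Finset.sum_eq_zero fun q _ => ?_
    rw [integral_finsetSum _ fun p _ => h2 q p]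
    exact Finset.sum_eq_zero fun p _ => h3 q p

/-- Orthogonality of each new noise to the past makes the variances add with no combinatorial
factor, as the explicit constant of the mean square rate requires. -/
theorem integral_accumulatedNoise_le [IsFiniteMeasure P]
    (hx : IsContractiveRecursion P h F H a B g v x) (k i : ℕ) :
    ∫ ω, accumulatedNoise B g v k i ω ⬝ᵥ accumulatedNoise B g v k i ω ∂P ≤
      ∑ j ∈ Finset.range i, a (k + j) ^ 2 / 4 * ∫ ω, v (k + j) ω ⬝ᵥ v (k + j) ω ∂P := by
  induction i with
  | zero => simp [accumulatedNoise]
  | succ i ih =>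
    have h1 := hx.one_le
    rw [Finset.sum_range_succ]
    have hB := hx.isBddMeasurable_B (k := k + i) (j := k + i) (by omega)
    have hg := hx.isBddMeasurable_g (k := k + i) (j := k + i) (by omega)
    have mξ := hx.memLp_accumulatedNoise k i
    have mBξ := fun p => memLp_mulVec_apply (hB.mono (hx.le _)) mξ p
    have mgv := fun p => memLp_mulVec_apply (hg.mono (hx.le _)) (hx.memLp_v (k + i)) p
    -- one step of noise started at time `k + i`
    have hcross := hx.integral_dotProduct_accumulatedNoise (k + i) 1 hx.one_le
      (Z := fun ω => B (k + i) ω *ᵥ accumulatedNoise B g v k i ω)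
      (fun p => measurable_mulVec_apply hB.measurable (hx.measurable_accumulatedNoise k i) p)
      (fun p j hj q => by
        obtain rfl : j = 0 := by omega
        exact (mBξ p).integrable_mul (hx.memLp_v (k + i) q))
    simp only [accumulatedNoise, add_zero, Matrix.mulVec_zero, zero_add] at hcross
    obtain ⟨i1, i2⟩ := hcross
    have e : ∀ ω, accumulatedNoise B g v k (i + 1) ω ⬝ᵥ accumulatedNoise B g v k (i + 1) ω ≤
        accumulatedNoise B g v k i ω ⬝ᵥ accumulatedNoise B g v k i ω +
        2 * ((B (k + i) ω *ᵥ accumulatedNoise B g v k i ω) ⬝ᵥ (g (k + i) ω *ᵥ v (k + i) ω)) +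
        a (k + i) ^ 2 / 4 * (v (k + i) ω ⬝ᵥ v (k + i) ω) := by
      intro ω
      rw [accumulatedNoise, add_dotProduct_self]
      have := hx.contraction (k + i) ω (accumulatedNoise B g v k i ω)
      have := hx.gain_le (k + i) ω (v (k + i) ω)
      linarith
    have j1 := integrable_dotProduct (hx.memLp_accumulatedNoise k (i + 1))
      (hx.memLp_accumulatedNoise k (i + 1))
    have j2 := integrable_dotProduct mξ mξ
    have j3 := (integrable_dotProduct (hx.memLp_v (k + i)) (hx.memLp_v (k + i))).const_mul
      (a (k + i) ^ 2 / 4)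
    refine (integral_mono j1 ((j2.add (i1.const_mul 2)).add j3) e).trans ?_
    rw [integral_add' (j2.add (i1.const_mul 2)) j3, integral_add' j2 (i1.const_mul 2),
      integral_const_mul, integral_const_mul, i2]
    linarith

variable [DecidableEq ι]

theorem eq_transition_add (hx : IsContractiveRecursion P h F H a B g v x) (k i : ℕ) (ω : Ω) :
    x (k + i) ω = transition B k i ω *ᵥ x k ω + accumulatedNoise B g v k i ω := by
  induction i with
  | zero => simp [transition, accumulatedNoise]
  | succ i ih =>
    rw [← add_assoc, hx.succ_eq, ih, transition, accumulatedNoise, Matrix.mulVec_add,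
      Matrix.mulVec_mulVec, add_assoc]

theorem transition_contraction (hx : IsContractiveRecursion P h F H a B g v x) (k i : ℕ) (ω : Ω)
    (z : ι → ℝ) : (transition B k i ω *ᵥ z) ⬝ᵥ (transition B k i ω *ᵥ z) ≤ z ⬝ᵥ z := by
  induction i with
  | zero => simp [transition]
  | succ i ih =>
    rw [transition, ← Matrix.mulVec_mulVec]
    exact (hx.contraction _ _ _).trans ih

theorem isBddMeasurable_transition (hx : IsContractiveRecursion P h F H a B g v x) (k i : ℕ)
    (hi : i ≤ h) : IsBddMeasurable (H k) (transition B k i) := by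
  induction i with
  | zero => exact .const 1
  | succ i ih => exact (hx.isBddMeasurable_B (by omega)).mul (ih (by omega))

/-- Needed to recover the accumulated noise from the states, and so to see it as known in the
smaller filtration `F`. -/
theorem measurable_transition_past (hx : IsContractiveRecursion P h F H a B g v x) (k i : ℕ)
    (p q : ι) : Measurable[F (k + i)] fun ω => transition B k i ω p q := by
  induction i generalizing p q with
  | zero => exact measurable_const
  | succ i ih =>
    simp only [transition, Matrix.mul_apply]
    have hm : F (k + i) ≤ F (k + (i + 1)) := hx.past_mono (by omega)
    exact Finset.measurable_sum _ fun r _ =>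
      (hx.measurable_B_past (k + i) p r).mul ((ih r q).mono hm le_rfl)

/-- Mean-square contraction over a window. -/
def IsContractingAt (P : Measure Ω) (h : ℕ) (F : ℕ → MeasurableSpace Ω)
    (B : ℕ → Ω → Matrix ι ι ℝ) (k : ℕ) (p : ℝ) : Prop :=
  ∀ z : Ω → ι → ℝ, (∀ q, Measurable[F k] fun ω => z ω q) → (∀ q, MemLp (fun ω => z ω q) 2 P) →
    ∫ ω, (transition B k h ω *ᵥ z ω) ⬝ᵥ (transition B k h ω *ᵥ z ω) ∂P ≤
      (1 - p) * ∫ ω, z ω ⬝ᵥ z ω ∂P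

/-- Pythagoras: the transported state is known at `H k`, hence uncorrelated with the noise of the
window. -/
theorem integral_sq_le [IsFiniteMeasure P] (hx : IsContractiveRecursion P h F H a B g v x) (k : ℕ)
    {p : ℝ} (hp : IsContractingAt P h F B k p) :
    ∫ ω, x (k + h) ω ⬝ᵥ x (k + h) ω ∂P ≤ (1 - p) * ∫ ω, x k ω ⬝ᵥ x k ω ∂P +
      ∑ j ∈ Finset.range h, a (k + j) ^ 2 / 4 * ∫ ω, v (k + j) ω ⬝ᵥ v (k + j) ω ∂P := by
  have hψ := hx.isBddMeasurable_transition k h le_rfl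
  have mT := fun q => memLp_mulVec_apply (hψ.mono (hx.le k)) (hx.memLp_x k) q
  have mξ := hx.memLp_accumulatedNoise k h
  obtain ⟨i1, i2⟩ := hx.integral_dotProduct_accumulatedNoise k h le_rfl
    (Z := fun ω => transition B k h ω *ᵥ x k ω)
    (fun p => measurable_mulVec_apply hψ.measurable
      (fun q => (hx.measurable_x k q).mono (hx.past_le k) le_rfl) p)
    (fun p j _ q => (mT p).integrable_mul (hx.memLp_v (k + j) q))
  have e : ∀ ω, x (k + h) ω ⬝ᵥ x (k + h) ω =
      (transition B k h ω *ᵥ x k ω) ⬝ᵥ (transition B k h ω *ᵥ x k ω) +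
      2 * ((transition B k h ω *ᵥ x k ω) ⬝ᵥ accumulatedNoise B g v k h ω) +
      accumulatedNoise B g v k h ω ⬝ᵥ accumulatedNoise B g v k h ω := fun ω => by
    rw [hx.eq_transition_add, add_dotProduct_self]
  simp only [e]
  have j1 := integrable_dotProduct mT mT
  have j2 : Integrable (fun ω =>
      (transition B k h ω *ᵥ x k ω) ⬝ᵥ (transition B k h ω *ᵥ x k ω) +
      2 * ((transition B k h ω *ᵥ x k ω) ⬝ᵥ accumulatedNoise B g v k h ω)) P :=
    j1.add (i1.const_mul 2)
  rw [integral_add j2 (integrable_dotProduct mξ mξ), integral_add j1 (i1.const_mul 2), integral_const_mul, i2]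
  have := hp (x k) (hx.measurable_x k) (hx.memLp_x k)
  have := hx.integral_accumulatedNoise_le k h
  linarith

end IsContractiveRecursion

end Recursion

-- Localized higher moments of contractive recursions.

section RecursionPower

variable {ι κ Ω : Type*} [Fintype ι] [Fintype κ] {mΩ : MeasurableSpace Ω}
  {P : Measure Ω} {h : ℕ} {F H : ℕ → MeasurableSpace Ω} {a : ℕ → ℝ}
  {B : ℕ → Ω → Matrix ι ι ℝ} {g : ℕ → Ω → Matrix ι κ ℝ} {v : ℕ → Ω → κ → ℝ} {x : ℕ → Ω → ι → ℝ}

theorem rpow_sub_one_mul_self {a l : ℝ} (ha : 0 ≤ a) (hl : 1 ≤ l) : a ^ (l - 1) * a = a ^ l := by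
  rcases ha.eq_or_lt with rfl | ha
  · rw [mul_zero, Real.zero_rpow (by linarith)]
  · rw [Real.rpow_sub_one ha.ne']; field_simp

theorem abs_apply_le_sqrt_dotProduct_self (z : ι → ℝ) (q : ι) : |z q| ≤ √(z ⬝ᵥ z) := by
  rw [dotProduct_self_sum]
  refine Real.abs_le_sqrt ?_
  exact Finset.single_le_sum (f := fun i => z i ^ 2) (fun i _ => sq_nonneg _) (Finset.mem_univ q)

/-- A Young-type domination, used to see that the cross terms of the expansion are integrable. -/
theorem rpow_sub_one_mul_sqrt_mul_sqrt_le {a c l : ℝ} (ha : 0 ≤ a) (hc : 0 ≤ c) (hl : 1 ≤ l) :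
    a ^ (l - 1) * (√a * √c) ≤ a ^ l + c ^ l := by
  have hl1 : 0 ≤ l - 1 := by linarith
  have hl0 : 0 ≤ l := by linarith
  have key : ∀ d, a ≤ d → c ≤ d → 0 ≤ d → a ^ (l - 1) * (√a * √c) ≤ d ^ l := by
    intro d h1 h2 hd
    calc a ^ (l - 1) * (√a * √c) ≤ d ^ (l - 1) * (√d * √d) :=
          mul_le_mul (Real.rpow_le_rpow ha h1 hl1)
            (mul_le_mul (Real.sqrt_le_sqrt h1) (Real.sqrt_le_sqrt h2) (Real.sqrt_nonneg _)
              (Real.sqrt_nonneg _)) (by positivity) (by positivity)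
      _ = d ^ l := by rw [Real.mul_self_sqrt hd, rpow_sub_one_mul_self hd hl]
  have h3 : 0 ≤ a ^ l := Real.rpow_nonneg ha l
  have h4 : 0 ≤ c ^ l := Real.rpow_nonneg hc l
  rcases le_total a c with h | h
  · linarith [key c h le_rfl hc]
  · linarith [key a le_rfl h ha]

namespace IsContractiveRecursion

/-- A crude pathwise bound: for higher moments only orders of magnitude matter, so the factor `2 ^
i` is harmless. -/
theorem accumulatedNoise_dotProduct_self_le (hx : IsContractiveRecursion P h F H a B g v x)
    (k i : ℕ) (ω : Ω) : accumulatedNoise B g v k i ω ⬝ᵥ accumulatedNoise B g v k i ω ≤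
      2 ^ i * ∑ j ∈ Finset.range i, a (k + j) ^ 2 / 4 * (v (k + j) ω ⬝ᵥ v (k + j) ω) := by
  induction i with
  | zero => simp [accumulatedNoise]
  | succ i ih =>
    rw [accumulatedNoise, Finset.sum_range_succ]
    refine (add_dotProduct_self_le _ _).trans ?_
    have h1 := hx.contraction (k + i) ω (accumulatedNoise B g v k i ω)
    have h2 := hx.gain_le (k + i) ω (v (k + i) ω)
    have h3 : 0 ≤ a (k + i) ^ 2 / 4 * (v (k + i) ω ⬝ᵥ v (k + i) ω) :=
      mul_nonneg (by positivity) (dotProduct_self_nonneg' _)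
    have h4 : a (k + i) ^ 2 / 4 * (v (k + i) ω ⬝ᵥ v (k + i) ω) ≤
        2 ^ i * (a (k + i) ^ 2 / 4 * (v (k + i) ω ⬝ᵥ v (k + i) ω)) :=
      le_mul_of_one_le_left h3 (one_le_pow₀ (by norm_num))
    rw [pow_succ']
    linarith

theorem accumulatedNoise_rpow_le (hx : IsContractiveRecursion P h F H a B g v x)
    (k i : ℕ) (ω : Ω) {l : ℝ} (hl : 1 ≤ l) :
    (accumulatedNoise B g v k i ω ⬝ᵥ accumulatedNoise B g v k i ω) ^ l ≤
      (2 ^ i) ^ l * (i : ℝ) ^ (l - 1) * ∑ j ∈ Finset.range i,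
        (a (k + j) ^ 2 / 4) ^ l * (v (k + j) ω ⬝ᵥ v (k + j) ω) ^ l := by
  have h0 : ∀ j, 0 ≤ a (k + j) ^ 2 / 4 * (v (k + j) ω ⬝ᵥ v (k + j) ω) := fun j =>
    mul_nonneg (by positivity) (dotProduct_self_nonneg' _)
  have h1 := Real.rpow_sum_le_const_mul_sum_rpow_of_nonneg (s := Finset.range i)
    (f := fun j => a (k + j) ^ 2 / 4 * (v (k + j) ω ⬝ᵥ v (k + j) ω)) hl fun j _ => h0 j
  rw [Finset.card_range] at h1
  refine (Real.rpow_le_rpow (dotProduct_self_nonneg' _)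
    (hx.accumulatedNoise_dotProduct_self_le k i ω) (by linarith)).trans ?_
  rw [Real.mul_rpow (by positivity) (Finset.sum_nonneg fun j _ => h0 j), mul_assoc]
  refine mul_le_mul_of_nonneg_left (h1.trans_eq ?_) (by positivity)
  congr 1
  refine Finset.sum_congr rfl fun j _ => ?_
  rw [Real.mul_rpow (by positivity) (dotProduct_self_nonneg' _)]

theorem integrableOn_accumulatedNoise_rpow (hx : IsContractiveRecursion P h F H a B g v x)
    (k i : ℕ) {l : ℝ} (hl : 1 ≤ l) {S : Set Ω}
    (hv : ∀ j < i, IntegrableOn (fun ω => (v (k + j) ω ⬝ᵥ v (k + j) ω) ^ l) S P) :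
    IntegrableOn
      (fun ω => (accumulatedNoise B g v k i ω ⬝ᵥ accumulatedNoise B g v k i ω) ^ l) S P := by
  have hm := fun p => hx.measurable_accumulatedNoise_top k i p
  have h1 : IntegrableOn (fun ω => (2 ^ i) ^ l * (i : ℝ) ^ (l - 1) * ∑ j ∈ Finset.range i,
      (a (k + j) ^ 2 / 4) ^ l * (v (k + j) ω ⬝ᵥ v (k + j) ω) ^ l) S P :=
    (integrable_finsetSum _ fun j hj => (hv j (Finset.mem_range.1 hj)).const_mul _).const_mul _
  refine h1.mono' ((measurable_dotProduct hm hm).pow_const l).aestronglyMeasurable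
    (Eventually.of_forall fun ω => ?_)
  rw [Real.norm_eq_abs, abs_of_nonneg (Real.rpow_nonneg (dotProduct_self_nonneg' _) _)]
  exact hx.accumulatedNoise_rpow_le k i ω hl

theorem setIntegral_accumulatedNoise_rpow_le (hx : IsContractiveRecursion P h F H a B g v x)
    (k i : ℕ) {l : ℝ} (hl : 1 ≤ l) {S : Set Ω}
    (hv : ∀ j < i, IntegrableOn (fun ω => (v (k + j) ω ⬝ᵥ v (k + j) ω) ^ l) S P) :
    ∫ ω in S, (accumulatedNoise B g v k i ω ⬝ᵥ accumulatedNoise B g v k i ω) ^ l ∂P ≤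
      (2 ^ i) ^ l * (i : ℝ) ^ (l - 1) * ∑ j ∈ Finset.range i,
        (a (k + j) ^ 2 / 4) ^ l * ∫ ω in S, (v (k + j) ω ⬝ᵥ v (k + j) ω) ^ l ∂P := by
  have h1 : ∀ j ∈ Finset.range i, IntegrableOn (fun ω => (a (k + j) ^ 2 / 4) ^ l *
      (v (k + j) ω ⬝ᵥ v (k + j) ω) ^ l) S P :=
    fun j hj => (hv j (Finset.mem_range.1 hj)).const_mul _
  refine (integral_mono (hx.integrableOn_accumulatedNoise_rpow k i hl hv)
    ((integrable_finsetSum _ h1).const_mul _)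
    (fun ω => hx.accumulatedNoise_rpow_le k i ω hl)).trans_eq ?_
  rw [integral_const_mul, integral_finsetSum _ h1]
  congr 1
  exact Finset.sum_congr rfl fun j _ => integral_const_mul _ _

variable [DecidableEq ι]

/-- The contraction in mean square controls higher moments, because it also holds pathwise in the
weak sense. -/
theorem setIntegral_transition_rpow_le (hx : IsContractiveRecursion P h F H a B g v x) (k : ℕ)
    {l : ℝ} (hl : 1 ≤ l) {p : ℝ} (hp : IsContractingAt P h F B k p) {S S' : Set Ω}
    (hSS : S' ⊆ S) (hS : MeasurableSet[F k] S) (hS' : MeasurableSet S')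
    (hxi : IntegrableOn (fun ω => (x k ω ⬝ᵥ x k ω) ^ l) S P) :
    IntegrableOn (fun ω => ((transition B k h ω *ᵥ x k ω) ⬝ᵥ
      (transition B k h ω *ᵥ x k ω)) ^ l) S' P ∧
    ∫ ω in S', ((transition B k h ω *ᵥ x k ω) ⬝ᵥ (transition B k h ω *ᵥ x k ω)) ^ l ∂P ≤
      (1 - p) * ∫ ω in S, (x k ω ⬝ᵥ x k ω) ^ l ∂P := by
  have hl0 : 0 ≤ l := by linarith
  have hl1 : 0 ≤ l - 1 := by linarith
  have hFle : F k ≤ mΩ := (hx.past_le k).trans (hx.le k)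
  have hST := hFle _ hS
  -- The mean square contraction is tested on `1_S |x|^(l-1) x`, whose squared norm is `1_S
  -- |x|^(2l)`. With `T` the transition matrix, its image has squared norm `1_S |x|^(2l-2) |Tx|²`,
  -- which is at least `1_S |Tx|^(2l)` because `|Tx| ≤ |x|` pathwise.
  set z : Ω → ι → ℝ := S.indicator fun ω => √((x k ω ⬝ᵥ x k ω) ^ (l - 1)) • x k ω with hz
  have hzm : ∀ q, Measurable[F k] fun ω => z ω q := by
    intro q
    have e : (fun ω => z ω q) =
        S.indicator fun ω => √((x k ω ⬝ᵥ x k ω) ^ (l - 1)) * x k ω q := by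
      funext ω
      by_cases hω : ω ∈ S <;> simp [hz, hω]
    rw [e]
    refine Measurable.indicator (Measurable.mul ?_ (hx.measurable_x k q)) hS
    exact ((measurable_dotProduct (hx.measurable_x k) (hx.measurable_x k)).pow_const _).sqrt
  have hψ := (hx.isBddMeasurable_transition k h le_rfl).mono (hx.le k)
  have hTm := fun p => measurable_mulVec_apply hψ.measurable (hx.measurable_x_top k) p
  have hzz : ∀ ω, z ω ⬝ᵥ z ω = S.indicator (fun ω => (x k ω ⬝ᵥ x k ω) ^ l) ω := by
    intro ω
    by_cases hω : ω ∈ S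
    · have h0 := dotProduct_self_nonneg' (x k ω)
      simp only [hz, Set.indicator_of_mem hω, smul_dotProduct, dotProduct_smul, smul_eq_mul]
      rw [← mul_assoc, Real.mul_self_sqrt (Real.rpow_nonneg h0 _), rpow_sub_one_mul_self h0 hl]
    · simp [hz, hω]
  have hTz : ∀ ω, (transition B k h ω *ᵥ z ω) ⬝ᵥ (transition B k h ω *ᵥ z ω) =
      S.indicator (fun ω => (x k ω ⬝ᵥ x k ω) ^ (l - 1) *
        ((transition B k h ω *ᵥ x k ω) ⬝ᵥ (transition B k h ω *ᵥ x k ω))) ω := by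
    intro ω
    by_cases hω : ω ∈ S
    · have h0 := dotProduct_self_nonneg' (x k ω)
      simp only [hz, Set.indicator_of_mem hω, Matrix.mulVec_smul, smul_dotProduct,
        dotProduct_smul, smul_eq_mul]
      rw [← mul_assoc, Real.mul_self_sqrt (Real.rpow_nonneg h0 _)]
    · simp [hz, hω]
  have hzi : Integrable (fun ω => z ω ⬝ᵥ z ω) P := by
    simp only [hzz]
    exact (integrable_indicator_iff hST).2 hxi
  have hz2 := memLp_of_integrable_dotProduct_self (fun q => (hzm q).mono hFle le_rfl) hzi
  have hcon := hp z hzm hz2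
  have hle : ∀ ω, S'.indicator (fun ω => ((transition B k h ω *ᵥ x k ω) ⬝ᵥ
      (transition B k h ω *ᵥ x k ω)) ^ l) ω ≤
      (transition B k h ω *ᵥ z ω) ⬝ᵥ (transition B k h ω *ᵥ z ω) := by
    intro ω
    by_cases hω : ω ∈ S'
    · rw [hTz, Set.indicator_of_mem hω, Set.indicator_of_mem (hSS hω)]
      have h0 := dotProduct_self_nonneg' (transition B k h ω *ᵥ x k ω)
      rw [← rpow_sub_one_mul_self h0 hl]
      exact mul_le_mul_of_nonneg_right (Real.rpow_le_rpow h0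
        (hx.transition_contraction k h ω _) hl1) h0
    · rw [Set.indicator_of_notMem hω]
      exact dotProduct_self_nonneg' _
  have hTzi : Integrable (fun ω => (transition B k h ω *ᵥ z ω) ⬝ᵥ (transition B k h ω *ᵥ z ω)) P :=
    integrable_dotProduct (memLp_mulVec_apply hψ hz2) (memLp_mulVec_apply hψ hz2)
  have hTi : Integrable (S'.indicator (fun ω => ((transition B k h ω *ᵥ x k ω) ⬝ᵥ
      (transition B k h ω *ᵥ x k ω)) ^ l)) P := by
    refine hTzi.mono' (((measurable_dotProduct hTm hTm).pow_const l).indicator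
      hS').aestronglyMeasurable (Eventually.of_forall fun ω => ?_)
    rw [Real.norm_eq_abs, abs_of_nonneg]
    · exact hle ω
    · exact Set.indicator_nonneg (fun ω _ => Real.rpow_nonneg (dotProduct_self_nonneg' _) _) ω
  refine ⟨(integrable_indicator_iff hS').1 hTi, ?_⟩
  rw [← integral_indicator hS', ← integral_indicator hST]
  refine (integral_mono hTi hTzi hle).trans (hcon.trans_eq ?_)
  simp only [hzz]

/-- One window of the localized moment recursion. -/
theorem setIntegral_rpow_le [IsFiniteMeasure P] (hx : IsContractiveRecursion P h F H a B g v x)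
    (k : ℕ) {l : ℝ} (hl : 1 ≤ l) {C : ℝ}
    (hexp : ∀ a b q η : ℝ, 0 ≤ a → 0 ≤ q → b ^ 2 ≤ a * q → 0 < η → η ≤ 1 →
      (a + 2 * b + q) ^ l ≤
        (1 + η) * a ^ l + 2 * l * (a ^ (l - 1) * b) + C * η ^ (1 - l) * q ^ l)
    {p η : ℝ} (hp : IsContractingAt P h F B k p) (hη : 0 < η) (hη1 : η ≤ 1) {S S' : Set Ω}
    (hSS : S' ⊆ S) (hS : MeasurableSet[F k] S) (hS' : MeasurableSet[H k] S')
    (hxi : IntegrableOn (fun ω => (x k ω ⬝ᵥ x k ω) ^ l) S P)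
    (hv : ∀ j < h, IntegrableOn (fun ω => (v (k + j) ω ⬝ᵥ v (k + j) ω) ^ l) S' P) :
    IntegrableOn (fun ω => (x (k + h) ω ⬝ᵥ x (k + h) ω) ^ l) S' P ∧
    ∫ ω in S', (x (k + h) ω ⬝ᵥ x (k + h) ω) ^ l ∂P ≤
      (1 + η) * ((1 - p) * ∫ ω in S, (x k ω ⬝ᵥ x k ω) ^ l ∂P) + C * η ^ (1 - l) *
        ∫ ω in S', (accumulatedNoise B g v k h ω ⬝ᵥ accumulatedNoise B g v k h ω) ^ l ∂P := by
  have hST' := hx.le k _ hS'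
  obtain ⟨t1, t2⟩ := hx.setIntegral_transition_rpow_le k hl hp hSS hS hST' hxi
  have n1 := hx.integrableOn_accumulatedNoise_rpow k h hl hv
  have hψ := hx.isBddMeasurable_transition k h le_rfl
  have hTm := fun p => measurable_mulVec_apply hψ.measurable
    (fun q => (hx.measurable_x k q).mono (hx.past_le k) le_rfl) p
  have hTTm := measurable_dotProduct hTm hTm
  set T : Ω → ι → ℝ := fun ω => transition B k h ω *ᵥ x k ω with hT
  set ξ : Ω → ι → ℝ := fun ω => accumulatedNoise B g v k h ω with hξ
  -- The linear term of the expansion is `⟨Z, ξ⟩`. Since `S'` is in `H k`, so is `Z`, and the term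
  -- has integral zero.
  set Z : Ω → ι → ℝ := S'.indicator fun ω => ((T ω ⬝ᵥ T ω) ^ (l - 1)) • T ω with hZ
  have hZq : ∀ q, (fun ω => Z ω q) = S'.indicator fun ω => (T ω ⬝ᵥ T ω) ^ (l - 1) * T ω q := by
    intro q
    funext ω
    by_cases hω : ω ∈ S' <;> simp [hZ, hω]
  have hZm : ∀ q, Measurable[H k] fun ω => Z ω q := by
    intro q
    rw [hZq]
    exact Measurable.indicator ((hTTm.pow_const _).mul (hTm q)) hS'
  have hZi : ∀ q, ∀ j < h, ∀ r, Integrable (fun ω => Z ω q * v (k + j) ω r) P := by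
    intro q j hj r
    have hb : Integrable (S'.indicator fun ω => (T ω ⬝ᵥ T ω) ^ l +
        (v (k + j) ω ⬝ᵥ v (k + j) ω) ^ l) P :=
      (integrable_indicator_iff hST').2 (t1.add (hv j hj))
    refine hb.mono' (((hZm q).mono (hx.le k) le_rfl).mul
      ((hx.measurable_v (k + j) r).mono (hx.le _) le_rfl)).aestronglyMeasurable
      (Eventually.of_forall fun ω => ?_)
    rw [congr_fun (hZq q) ω]
    by_cases hω : ω ∈ S'
    · rw [Set.indicator_of_mem hω, Set.indicator_of_mem hω, Real.norm_eq_abs, mul_assoc, abs_mul,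
        abs_of_nonneg (Real.rpow_nonneg (dotProduct_self_nonneg' _) _), abs_mul]
      refine le_trans ?_ (rpow_sub_one_mul_sqrt_mul_sqrt_le (dotProduct_self_nonneg' (T ω))
        (dotProduct_self_nonneg' (v (k + j) ω)) hl)
      refine mul_le_mul_of_nonneg_left ?_ (Real.rpow_nonneg (dotProduct_self_nonneg' _) _)
      exact mul_le_mul (abs_apply_le_sqrt_dotProduct_self _ _)
        (abs_apply_le_sqrt_dotProduct_self _ _) (abs_nonneg _) (Real.sqrt_nonneg _)
    · simp [hω]
  obtain ⟨c1, c2⟩ := hx.integral_dotProduct_accumulatedNoise k h le_rfl hZm hZi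
  have hZξ : (fun ω => Z ω ⬝ᵥ ξ ω) =
      S'.indicator fun ω => (T ω ⬝ᵥ T ω) ^ (l - 1) * (T ω ⬝ᵥ ξ ω) := by
    funext ω
    by_cases hω : ω ∈ S' <;> simp [hZ, hω, smul_dotProduct]
  change Integrable (fun ω => Z ω ⬝ᵥ ξ ω) P at c1
  change ∫ ω, (fun ω => Z ω ⬝ᵥ ξ ω) ω ∂P = 0 at c2
  rw [hZξ] at c1 c2
  rw [integrable_indicator_iff hST'] at c1
  rw [integral_indicator hST'] at c2
  have hpt : ∀ ω, (x (k + h) ω ⬝ᵥ x (k + h) ω) ^ l ≤ (1 + η) * (T ω ⬝ᵥ T ω) ^ l +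
      2 * l * ((T ω ⬝ᵥ T ω) ^ (l - 1) * (T ω ⬝ᵥ ξ ω)) + C * η ^ (1 - l) * (ξ ω ⬝ᵥ ξ ω) ^ l := by
    intro ω
    rw [hx.eq_transition_add, add_dotProduct_self]
    exact hexp _ _ _ η (dotProduct_self_nonneg' _) (dotProduct_self_nonneg' _)
      (dotProduct_sq_le _ _) hη hη1
  have d1 : IntegrableOn (fun ω => (1 + η) * (T ω ⬝ᵥ T ω) ^ l) S' P := t1.const_mul _
  have d2 : IntegrableOn (fun ω => 2 * l * ((T ω ⬝ᵥ T ω) ^ (l - 1) * (T ω ⬝ᵥ ξ ω))) S' P :=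
    c1.const_mul _
  have d3 : IntegrableOn (fun ω => C * η ^ (1 - l) * (ξ ω ⬝ᵥ ξ ω) ^ l) S' P := n1.const_mul _
  have d12 : IntegrableOn (fun ω => (1 + η) * (T ω ⬝ᵥ T ω) ^ l +
      2 * l * ((T ω ⬝ᵥ T ω) ^ (l - 1) * (T ω ⬝ᵥ ξ ω))) S' P := d1.add d2
  have d : IntegrableOn (fun ω => (1 + η) * (T ω ⬝ᵥ T ω) ^ l +
      2 * l * ((T ω ⬝ᵥ T ω) ^ (l - 1) * (T ω ⬝ᵥ ξ ω)) +
      C * η ^ (1 - l) * (ξ ω ⬝ᵥ ξ ω) ^ l) S' P := d12.add d3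
  have hxk := hx.measurable_x_top (k + h)
  have hint : IntegrableOn (fun ω => (x (k + h) ω ⬝ᵥ x (k + h) ω) ^ l) S' P := by
    refine d.mono' ((measurable_dotProduct hxk hxk).pow_const l).aestronglyMeasurable
      (Eventually.of_forall fun ω => ?_)
    rw [Real.norm_eq_abs, abs_of_nonneg (Real.rpow_nonneg (dotProduct_self_nonneg' _) _)]
    exact hpt ω
  refine ⟨hint, (integral_mono hint d hpt).trans ?_⟩
  rw [integral_add d12 d3, integral_add d1 d2, integral_const_mul, integral_const_mul,
    integral_const_mul, c2, mul_zero, add_zero]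
  have := mul_le_mul_of_nonneg_left t2 (by linarith : 0 ≤ 1 + η)
  linarith

end IsContractiveRecursion

end RecursionPower

-- Convergence rates of contractive recursions.

section Rates

/-- The estimates advance by whole windows, so they are proved along each residue class modulo `h`
and then reassembled. -/
theorem eventually_of_residues {h r₀ : ℕ} (hh : 1 ≤ h) {p : ℕ → Prop}
    (hp : ∀ r, r₀ ≤ r → r < r₀ + h → ∀ᶠ t in atTop, p (r + h * t)) : ∀ᶠ k in atTop, p k := by
  have h1 : ∀ i : Fin h, ∃ T, ∀ t, T ≤ t → p (r₀ + i + h * t) := fun i =>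
    eventually_atTop.1 (hp (r₀ + i) (by omega) (by have := i.2; omega))
  choose T hT using h1
  refine eventually_atTop.2 ⟨r₀ + h * (∑ i, T i + 1), fun k hk => ?_⟩
  have hlt : (k - r₀) % h < h := Nat.mod_lt _ hh
  have hle : T ⟨(k - r₀) % h, hlt⟩ ≤ (k - r₀) / h := by
    have e1 : T ⟨(k - r₀) % h, hlt⟩ ≤ ∑ i, T i :=
      Finset.single_le_sum (f := T) (fun i _ => Nat.zero_le _) (Finset.mem_univ _)
    refine e1.trans ((Nat.le_div_iff_mul_le hh).2 ?_)
    have : h * (∑ i, T i + 1) = (∑ i, T i) * h + h := by ring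
    omega
  have := hT ⟨(k - r₀) % h, hlt⟩ _ hle
  have e2 := Nat.mod_add_div (k - r₀) h
  have e3 : r₀ ≤ k := le_trans (Nat.le_add_right _ _) hk
  have e4 : r₀ + (k - r₀) % h + h * ((k - r₀) / h) = k := by omega
  simpa only [e4] using this

theorem summable_rpow_neg_arithmetic {e : ℝ} (he : 1 < e) {r h : ℕ} (hr : 1 ≤ r) (hh : 1 ≤ h) :
    Summable fun t : ℕ => ((r + h * t : ℕ) : ℝ) ^ (-e) := by
  have h1 : Summable fun t : ℕ => ((t + 1 : ℕ) : ℝ) ^ (-e) :=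
    (summable_nat_add_iff 1).2 (Real.summable_nat_rpow.2 (by linarith))
  refine Summable.of_nonneg_of_le (fun t => by positivity) (fun t => ?_) h1
  refine Real.rpow_le_rpow_of_nonpos (by positivity) ?_ (by linarith)
  have : t ≤ h * t := Nat.le_mul_of_pos_left t hh
  exact_mod_cast (by omega : t + 1 ≤ r + h * t)

variable {ι κ Ω : Type*} [Fintype ι] [Fintype κ] [DecidableEq ι] {mΩ : MeasurableSpace Ω}
  {P : Measure Ω} {h : ℕ} {F H : ℕ → MeasurableSpace Ω} {a : ℕ → ℝ}
  {B : ℕ → Ω → Matrix ι ι ℝ} {g : ℕ → Ω → Matrix ι κ ℝ} {v : ℕ → Ω → κ → ℝ} {x : ℕ → Ω → ι → ℝ}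

namespace IsContractiveRecursion

theorem sq_gain_le {β : ℝ} (hβ : 0 ≤ β) (ha0 : ∀ k, 0 ≤ a k)
    (ha : ∀ k, 1 ≤ k → a k ≤ (k : ℝ) ^ (-β)) {k : ℕ} (hk : 1 ≤ k) (j : ℕ) :
    a (k + j) ^ 2 / 4 ≤ (k : ℝ) ^ (-(2 * β)) / 4 := by
  have hk0 : (0 : ℝ) < k := by exact_mod_cast hk
  have h1 : a (k + j) ≤ (k : ℝ) ^ (-β) := (ha _ (by omega)).trans
    (Real.rpow_le_rpow_of_nonpos hk0 (by push_cast; linarith [Nat.cast_nonneg (α := ℝ) j])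
      (by linarith))
  have h2 : (k : ℝ) ^ (-(2 * β)) = ((k : ℝ) ^ (-β)) ^ 2 := by
    rw [← Real.rpow_natCast, ← Real.rpow_mul hk0.le]
    congr 1; push_cast; ring
  rw [h2]
  have := pow_le_pow_left₀ (ha0 (k + j)) h1 2
  linarith

/-- Mean-square convergence rate of a contractive recursion. -/
theorem eventually_rpow_mul_integral_le [IsFiniteMeasure P]
    (hx : IsContractiveRecursion P h F H a B g v x) {β c b M : ℝ} (hβ : 0 ≤ β) (hc0 : 0 < c)
    (hc1 : c < 1) (hg : c ≤ 2 * β) (hb : 0 < b) (hM : 0 ≤ M) (ha0 : ∀ k, 0 ≤ a k)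
    (ha : ∀ k, 1 ≤ k → a k ≤ (k : ℝ) ^ (-β))
    (hp : ∀ᶠ k : ℕ in atTop, IsContractingAt P h F B k (b * (k : ℝ) ^ (-c)))
    (hv : ∀ k, 1 ≤ k → ∫ ω, v k ω ⬝ᵥ v k ω ∂P ≤ M) {η : ℝ} (hη : 0 < η) :
    ∀ᶠ k : ℕ in atTop, (k : ℝ) ^ (2 * β - c) * ∫ ω, x k ω ⬝ᵥ x k ω ∂P ≤
      2 * (h * (M / 4)) / b + η := by
  refine eventually_of_residues (r₀ := 1) hx.one_le fun r hr _ => ?_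
  have hKt : Tendsto (fun t : ℕ => r + h * t) atTop atTop :=
    tendsto_atTop_mono (fun t => by
      have := Nat.le_mul_of_pos_left t hx.one_le
      simp only [id]; omega) tendsto_id
  refine eventually_rpow_mul_le_of_recursion hc0 hc1 (by linarith) hb (by positivity) hr
    hx.one_le (u := fun t => ∫ ω, x (r + h * t) ω ⬝ᵥ x (r + h * t) ω ∂P) ?_ hη
  filter_upwards [hKt.eventually hp] with t ht
  have h1 := hx.integral_sq_le _ ht
  rw [show r + h * (t + 1) = r + h * t + h by ring]
  refine h1.trans (add_le_add le_rfl ?_)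
  have hk : 1 ≤ r + h * t := by omega
  have hk0 : (0 : ℝ) ≤ ((r + h * t : ℕ) : ℝ) := Nat.cast_nonneg _
  calc _ ≤ ∑ j ∈ Finset.range h, ((r + h * t : ℕ) : ℝ) ^ (-(2 * β)) / 4 * M := by
        refine Finset.sum_le_sum fun j _ => ?_
        refine mul_le_mul (sq_gain_le hβ ha0 ha hk j) (hv _ (by omega))
          (integral_nonneg fun ω => dotProduct_self_nonneg' _) (by positivity)
    _ = h * (M / 4) * ((r + h * t : ℕ) : ℝ) ^ (-c - (2 * β - c)) := by
        rw [Finset.sum_const, Finset.card_range, nsmul_eq_mul,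
          show -c - (2 * β - c) = -(2 * β) by ring]
        ring

/-- Localized moment recursion along an arithmetic progression of times. -/
theorem exists_localized_recursion [IsFiniteMeasure P]
    (hx : IsContractiveRecursion P h F H a B g v x) {β c b M l : ℝ} (hβ : 0 ≤ β)
    (hc0 : 0 < c) (hb : 0 < b) (hM : 0 ≤ M) (hl : 1 ≤ l)
    (ha0 : ∀ k, 0 ≤ a k) (ha : ∀ k, 1 ≤ k → a k ≤ (k : ℝ) ^ (-β))
    (hp : ∀ᶠ k : ℕ in atTop, IsContractingAt P h F B k (b * (k : ℝ) ^ (-c)))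
    {E : ℕ → Set Ω}
    (hv1 : ∀ k, 1 ≤ k → IntegrableOn (fun ω => (v k ω ⬝ᵥ v k ω) ^ l) (E k) P)
    (hv2 : ∀ k, 1 ≤ k → ∫ ω in E k, (v k ω ⬝ᵥ v k ω) ^ l ∂P ≤ M) :
    ∃ C : ℝ, 0 ≤ C ∧ ∀ᶠ k : ℕ in atTop, ∃ D : ℝ, 0 ≤ D ∧ ∀ S S' : Set Ω, S' ⊆ S →
      MeasurableSet[F k] S → MeasurableSet[H k] S' → (∀ j < h, S' ⊆ E (k + j)) →
      IntegrableOn (fun ω => (x k ω ⬝ᵥ x k ω) ^ l) S P →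
      IntegrableOn (fun ω => (x (k + h) ω ⬝ᵥ x (k + h) ω) ^ l) S' P ∧
      IntegrableOn (fun ω => (accumulatedNoise B g v k h ω ⬝ᵥ accumulatedNoise B g v k h ω) ^ l)
        S' P ∧
      (∫ ω in S', (x (k + h) ω ⬝ᵥ x (k + h) ω) ^ l ∂P ≤
        (1 - b / 2 * (k : ℝ) ^ (-c)) * ∫ ω in S, (x k ω ⬝ᵥ x k ω) ^ l ∂P + D *
          ∫ ω in S', (accumulatedNoise B g v k h ω ⬝ᵥ accumulatedNoise B g v k h ω) ^ l ∂P) ∧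
      D * ∫ ω in S', (accumulatedNoise B g v k h ω ⬝ᵥ accumulatedNoise B g v k h ω) ^ l ∂P ≤
        C * (k : ℝ) ^ (-c - (2 * β - c) * l) := by
  obtain ⟨C₁, hC₁, hexp⟩ := exists_rpow_expansion_bound hl
  set C₂ : ℝ := (2 ^ h) ^ l * (h : ℝ) ^ (l - 1) * (h * ((1 / 4) ^ l * M)) with hC₂
  have hC₂0 : 0 ≤ C₂ := by positivity
  refine ⟨C₁ * (b / 2) ^ (1 - l) * C₂, by positivity, ?_⟩
  have t1 : Tendsto (fun k : ℕ => b / 2 * (k : ℝ) ^ (-c)) atTop (𝓝 (b / 2 * 0)) :=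
    ((tendsto_rpow_neg_atTop hc0).comp tendsto_natCast_atTop_atTop).const_mul _
  rw [mul_zero] at t1
  filter_upwards [hp, t1.eventually (eventually_le_nhds (show (0 : ℝ) < 1 by norm_num)),
    eventually_ge_atTop 1] with k hpk hη1 hk
  have hk0 : (0 : ℝ) < k := by exact_mod_cast hk
  have hkc : 0 < (k : ℝ) ^ (-c) := Real.rpow_pos_of_pos hk0 _
  have hη : 0 < b / 2 * (k : ℝ) ^ (-c) := by positivity
  -- The expansion is used with `η` equal to half of the contraction rate `p`, since `(1 + p/2)(1 -
  -- p) ≤ 1 - p/2`. The coefficient `D` is chosen before the sets, so the inequality can be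
  -- intersected with arbitrary past events.
  refine ⟨C₁ * (b / 2 * (k : ℝ) ^ (-c)) ^ (1 - l), by positivity,
    fun S S' hSS hS hS' hSE hxi => ?_⟩
  have hvi : ∀ j < h, IntegrableOn (fun ω => (v (k + j) ω ⬝ᵥ v (k + j) ω) ^ l) S' P :=
    fun j hj => (hv1 (k + j) (by omega)).mono_set (hSE j hj)
  have hvj : ∀ j < h, ∫ ω in S', (v (k + j) ω ⬝ᵥ v (k + j) ω) ^ l ∂P ≤ M := fun j hj =>
    (setIntegral_mono_set (hv1 (k + j) (by omega))
      (Eventually.of_forall fun ω => Real.rpow_nonneg (dotProduct_self_nonneg' _) _)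
      (LE.le.eventuallyLE (hSE j hj))).trans (hv2 (k + j) (by omega))
  obtain ⟨i1, i2⟩ := hx.setIntegral_rpow_le k hl hexp hpk hη hη1 hSS hS hS' hxi hvi
  refine ⟨i1, hx.integrableOn_accumulatedNoise_rpow k h hl hvi, i2.trans ?_, ?_⟩
  · refine add_le_add ?_ le_rfl
    rw [← mul_assoc]
    refine mul_le_mul_of_nonneg_right ?_
      (integral_nonneg fun ω => Real.rpow_nonneg (dotProduct_self_nonneg' _) _)
    nlinarith [mul_pos hη hη]
  · have e1 : ∫ ω in S', (accumulatedNoise B g v k h ω ⬝ᵥ accumulatedNoise B g v k h ω) ^ l ∂P ≤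
        C₂ * (k : ℝ) ^ (-(2 * β) * l) := by
      refine (hx.setIntegral_accumulatedNoise_rpow_le k h hl hvi).trans ?_
      rw [hC₂, mul_assoc ((2 ^ h) ^ l * (h : ℝ) ^ (l - 1)) _ ((k : ℝ) ^ (-(2 * β) * l))]
      refine mul_le_mul_of_nonneg_left ?_ (by positivity)
      calc _ ≤ ∑ j ∈ Finset.range h, ((k : ℝ) ^ (-(2 * β)) / 4) ^ l * M := by
            refine Finset.sum_le_sum fun j hj => ?_
            have e0 : (a (k + j) ^ 2 / 4) ^ l ≤ ((k : ℝ) ^ (-(2 * β)) / 4) ^ l :=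
              Real.rpow_le_rpow (by positivity) (sq_gain_le hβ ha0 ha hk j) (by linarith)
            refine mul_le_mul e0 (hvj j (Finset.mem_range.1 hj))
              (integral_nonneg fun ω => Real.rpow_nonneg (dotProduct_self_nonneg' _) _)
              (by positivity)
        _ = h * ((1 / 4) ^ l * M) * (k : ℝ) ^ (-(2 * β) * l) := by
            have e : ((k : ℝ) ^ (-(2 * β)) / 4) ^ l = (1 / 4) ^ l * (k : ℝ) ^ (-(2 * β) * l) := by
              rw [Real.rpow_mul hk0.le, ← Real.mul_rpow (by norm_num) (by positivity)]
              congr 1; ring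
            rw [Finset.sum_const, Finset.card_range, nsmul_eq_mul, e]
            ring
    -- Exponents: `-c(1 - l) - 2βl = -c - (2β - c)l`.
    have e2 : (b / 2 * (k : ℝ) ^ (-c)) ^ (1 - l) * (k : ℝ) ^ (-(2 * β) * l) =
        (b / 2) ^ (1 - l) * (k : ℝ) ^ (-c - (2 * β - c) * l) := by
      rw [Real.mul_rpow (by positivity) hkc.le, ← Real.rpow_mul hk0.le, mul_assoc,
        ← Real.rpow_add hk0]
      congr 2; ring
    calc _ ≤ C₁ * (b / 2 * (k : ℝ) ^ (-c)) ^ (1 - l) * (C₂ * (k : ℝ) ^ (-(2 * β) * l)) :=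
          mul_le_mul_of_nonneg_left e1 (by positivity)
      _ = C₁ * C₂ * ((b / 2 * (k : ℝ) ^ (-c)) ^ (1 - l) * (k : ℝ) ^ (-(2 * β) * l)) := by ring
      _ = _ := by rw [e2]; ring

/-- Almost sure convergence rate along an arithmetic progression, on the event where the noise
moments stay controlled and the recursion starts in a bounded set. -/
theorem ae_tendsto_progression [IsFiniteMeasure P]
    (hx : IsContractiveRecursion P h F H a B g v x) {β c b M l δ : ℝ} (hβ : 0 ≤ β)
    (hc0 : 0 < c) (hc1 : c < 1) (hb : 0 < b) (hM : 0 ≤ M) (hl : 1 ≤ l)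
    (hδ0 : 0 ≤ δ) (hδ : δ < 2 * β - c) (hδ1 : 1 < (2 * β - c - δ) * l + c)
    (ha0 : ∀ k, 0 ≤ a k) (ha : ∀ k, 1 ≤ k → a k ≤ (k : ℝ) ^ (-β))
    (hp : ∀ᶠ k : ℕ in atTop, IsContractingAt P h F B k (b * (k : ℝ) ^ (-c)))
    {E : ℕ → Set Ω} (hE1 : ∀ j, MeasurableSet[F (j + 1)] (E j))
    (hE2 : ∀ k j, j < k + h → MeasurableSet[H k] (E j))
    (hv1 : ∀ k, 1 ≤ k → IntegrableOn (fun ω => (v k ω ⬝ᵥ v k ω) ^ l) (E k) P)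
    (hv2 : ∀ k, 1 ≤ k → ∫ ω in E k, (v k ω ⬝ᵥ v k ω) ^ l ∂P ≤ M) :
    ∀ᶠ r : ℕ in atTop, ∀ L : ℝ, ∀ᵐ ω ∂P, (∀ j, 1 ≤ j → ω ∈ E j) → x r ω ⬝ᵥ x r ω ≤ L →
      Tendsto (fun t : ℕ => ((r + h * t : ℕ) : ℝ) ^ δ *
        (x (r + h * t) ω ⬝ᵥ x (r + h * t) ω)) atTop (𝓝 0) := by
  have hl0 : 0 < l := by linarith
  have hδl : 0 ≤ δ * l := by positivity
  obtain ⟨C, hC, hrec⟩ := hx.exists_localized_recursion hβ hc0 hb hM hl ha0 ha hp hv1 hv2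
  have hev := hrec.and (eventually_ratio_rpow_mul_le hc0 hc1 hδl (half_pos hb) h)
  rw [eventually_atTop] at hev
  obtain ⟨r₀, hr₀⟩ := hev
  filter_upwards [eventually_ge_atTop (max r₀ 1)] with r hr L
  have hr0 : r₀ ≤ r := (le_max_left _ _).trans hr
  have hr1 : 1 ≤ r := (le_max_right _ _).trans hr
  choose D hD0 hD using fun t : ℕ => (hr₀ (r + h * t) (by omega)).1
  have hratio := fun t : ℕ => (hr₀ (r + h * t) (by omega)).2
  have hKs : ∀ t, r + h * (t + 1) = r + h * t + h := fun t => by ring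
  -- Bounding the state at time `r` makes its moment of order `2l` finite, although the unlocalized
  -- moment may be infinite. The events `E j` are imposed only up to the current time, so `S t` is
  -- adapted and decreasing.
  set S : ℕ → Set Ω := fun t =>
    {ω | x r ω ⬝ᵥ x r ω ≤ L} ∩ {ω | ∀ j, r ≤ j → j < r + h * t → ω ∈ E j} with hS
  have hSanti : ∀ t, S (t + 1) ⊆ S t := fun t ω hω =>
    ⟨hω.1, fun j h1 h2 => hω.2 j h1 (by rw [hKs]; omega)⟩
  have hS0m : ∀ t, MeasurableSet[F (r + h * t)] {ω | x r ω ⬝ᵥ x r ω ≤ L} := fun t => by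
    refine hx.past_mono (Nat.le_add_right r (h * t)) _ ?_
    exact measurable_dotProduct (hx.measurable_x r) (hx.measurable_x r) measurableSet_Iic
  have hSm : ∀ t, MeasurableSet[F (r + h * t)] (S t) := fun t => by
    refine MeasurableSet.inter (hS0m t) ?_
    simp only [Set.ofPred_forall]
    refine MeasurableSet.iInter fun j => MeasurableSet.iInter fun _ => MeasurableSet.iInter
      fun h2 => ?_
    exact hx.past_mono (by omega : j + 1 ≤ r + h * t) _ (hE1 j)
  -- The noise of the next window is integrated over `S (t + 1)`, so that set must already be known
  -- at the start of the window, in `H`.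
  have hSm' : ∀ t, MeasurableSet[H (r + h * t)] (S (t + 1)) := fun t => by
    refine MeasurableSet.inter (hx.past_le _ _ (hS0m t)) ?_
    simp only [Set.ofPred_forall]
    refine MeasurableSet.iInter fun j => MeasurableSet.iInter fun _ => MeasurableSet.iInter
      fun h2 => ?_
    exact hE2 _ _ (by rw [hKs] at h2; exact h2)
  have hSE : ∀ t, ∀ j < h, S (t + 1) ⊆ E (r + h * t + j) := fun t j hj ω hω =>
    hω.2 _ (by omega) (by rw [hKs]; omega)
  have hFle : ∀ k, F k ≤ mΩ := fun k => (hx.past_le k).trans (hx.le k)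
  have hSt : ∀ t, MeasurableSet (S t) := fun t => hFle _ _ (hSm t)
  -- moments along the progression
  have hxi : ∀ t, IntegrableOn (fun ω => (x (r + h * t) ω ⬝ᵥ x (r + h * t) ω) ^ l) (S t) P := by
    intro t
    induction t with
    | zero =>
      have hm := fun q => hx.measurable_x_top r q
      refine Integrable.of_bound (C := |L| ^ l)
        ((measurable_dotProduct hm hm).pow_const l).aestronglyMeasurable ?_
      refine (ae_restrict_iff' (hSt 0)).2 (Eventually.of_forall fun ω hω => ?_)
      have h0 := dotProduct_self_nonneg' (x r ω)
      rw [Real.norm_eq_abs]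
      simp only [mul_zero, add_zero]
      rw [abs_of_nonneg (Real.rpow_nonneg h0 _)]
      exact Real.rpow_le_rpow h0 ((show _ ≤ L from hω.1).trans (le_abs_self L)) hl0.le
    | succ t ih =>
      rw [hKs]
      exact (hD t (S t) (S (t + 1)) (hSanti t) (hSm t) (hSm' t) (hSE t) ih).1
  set ξ : ℕ → Ω → ι → ℝ := fun t => accumulatedNoise B g v (r + h * t) h with hξ
  have hmain := fun t => hD t (S t) (S (t + 1)) (hSanti t) (hSm t) (hSm' t) (hSE t) (hxi t)
  have hξm : ∀ t, Measurable[F (r + h * (t + 1))] fun ω => ξ t ω ⬝ᵥ ξ t ω := by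
    intro t
    -- Written as state minus transported state, the noise is measurable for `F`, the filtration of
    -- the supermartingale.
    have e : ξ t = fun ω => x (r + h * t + h) ω -
        transition B (r + h * t) h ω *ᵥ x (r + h * t) ω := by
      funext ω
      rw [hx.eq_transition_add]
      simp [hξ]
    have hm : ∀ q, Measurable[F (r + h * t + h)] fun ω => ξ t ω q := by
      intro q
      rw [e]
      refine Measurable.sub (hx.measurable_x _ q) ?_
      exact measurable_mulVec_apply (hx.measurable_transition_past _ _) (fun q' =>
        (hx.measurable_x _ q').mono (hx.past_mono (Nat.le_add_right _ _)) le_rfl) q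
    rw [hKs]
    exact measurable_dotProduct hm hm
  set w : ℕ → ℝ := fun t => ((r + h * t : ℕ) : ℝ) ^ (δ * l) with hw
  have hw0 : ∀ t, 0 ≤ w t := fun t => Real.rpow_nonneg (Nat.cast_nonneg _) _
  have hKpos : ∀ t, (0 : ℝ) < ((r + h * t : ℕ) : ℝ) := fun t => by
    exact_mod_cast (by omega : 0 < r + h * t)
  have hws : ∀ t, w (t + 1) * (1 - b / 2 * ((r + h * t : ℕ) : ℝ) ^ (-c)) ≤ w t := fun t => by
    have h1 := (hratio t).2.1
    simp only [hw, hKs]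
    refine h1.trans (mul_le_of_le_one_right (hw0 t) ?_)
    have := Real.rpow_nonneg (hKpos t).le (-c)
    have : 0 ≤ 3 / 4 * (b / 2) * ((r + h * t : ℕ) : ℝ) ^ (-c) := by positivity
    linarith
  have hdecay : Tendsto (fun t => w t * ∫ ω in S t,
      (x (r + h * t) ω ⬝ᵥ x (r + h * t) ω) ^ l ∂P) atTop (𝓝 0) := by
    have h1 := eventually_rpow_mul_le_of_recursion hc0 hc1
      (g := (2 * β - c) * l) (by have : 0 ≤ 2 * β - c := by linarith
                                 positivity) (half_pos hb) hC hr1 hx.one_le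
      (u := fun t => ∫ ω in S t, (x (r + h * t) ω ⬝ᵥ x (r + h * t) ω) ^ l ∂P)
      (Eventually.of_forall fun t => by
        obtain ⟨-, -, h3, h4⟩ := hmain t
        rw [hKs]
        linarith) one_pos
    have hKt : Tendsto (fun t : ℕ => ((r + h * t : ℕ) : ℝ)) atTop atTop :=
      tendsto_natCast_atTop_atTop.comp (tendsto_atTop_mono (fun t => by
        have := Nat.le_mul_of_pos_left t hx.one_le
        simp only [id]; omega) tendsto_id)
    have h2 : Tendsto (fun t : ℕ => (2 * C / (b / 2) + 1) *
        ((r + h * t : ℕ) : ℝ) ^ (-((2 * β - c - δ) * l))) atTop (𝓝 ((2 * C / (b / 2) + 1) * 0)) :=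
      ((tendsto_rpow_neg_atTop (mul_pos (by linarith) hl0)).comp hKt).const_mul _
    rw [mul_zero] at h2
    refine squeeze_zero' (Eventually.of_forall fun t => mul_nonneg (hw0 t)
      (integral_nonneg fun ω => Real.rpow_nonneg (dotProduct_self_nonneg' _) _)) ?_ h2
    filter_upwards [h1] with t ht
    have e : w t = ((r + h * t : ℕ) : ℝ) ^ (-((2 * β - c - δ) * l)) *
        ((r + h * t : ℕ) : ℝ) ^ ((2 * β - c) * l) := by
      simp only [hw]
      rw [← Real.rpow_add (hKpos t)]
      congr 1; ring
    rw [e, mul_assoc, mul_comm (2 * C / (b / 2) + 1)]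
    exact mul_le_mul_of_nonneg_left ht (Real.rpow_nonneg (hKpos t).le _)
  -- The weight `k^(δl)` is slow enough for its growth to be absorbed by the contraction, and `δ <
  -- 2β - c` makes the weighted expectation tend to zero.
  set Y : ℕ → Ω → ℝ := fun t ω => w t *
    (S t).indicator (fun ω => (x (r + h * t) ω ⬝ᵥ x (r + h * t) ω) ^ l) ω with hY
  set R : ℕ → Ω → ℝ := fun t ω => w (t + 1) * (D t *
    (S (t + 1)).indicator (fun ω => (ξ t ω ⬝ᵥ ξ t ω) ^ l) ω) with hR
  let ℱ : Filtration ℕ mΩ :=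
    { seq := fun t => F (r + h * t)
      mono' := fun s t hst => hx.past_mono (by
        have := Nat.mul_le_mul_left h hst
        omega)
      le' := fun t => hFle _ }
  have hYint : ∀ t, ∫ ω, Y t ω ∂P = w t * ∫ ω in S t,
      (x (r + h * t) ω ⬝ᵥ x (r + h * t) ω) ^ l ∂P := fun t => by
    rw [hY]
    simp only
    rw [integral_const_mul, integral_indicator (hSt t)]
  have hRi : ∀ t, Integrable (R t) P := fun t =>
    (((integrable_indicator_iff (hSt (t + 1))).2 (hmain t).2.1).const_mul _).const_mul _
  have hconv := ae_tendsto_zero_of_almostSupermartingale (P := P) ℱ (Y := Y) (R := R)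
    (fun t ω => mul_nonneg (hw0 t) (Set.indicator_nonneg
      (fun ω _ => Real.rpow_nonneg (dotProduct_self_nonneg' _) _) ω))
    (fun t ω => mul_nonneg (hw0 _) (mul_nonneg (hD0 t) (Set.indicator_nonneg
      (fun ω _ => Real.rpow_nonneg (dotProduct_self_nonneg' _) _) ω)))
    (fun t => (((measurable_dotProduct (hx.measurable_x _) (hx.measurable_x _)).pow_const
      l).indicator (hSm t)).const_mul _)
    (fun t => ((((hξm t).pow_const l).indicator (hSm (t + 1))).const_mul _).const_mul _)
    (fun t => ((integrable_indicator_iff (hSt t)).2 (hxi t)).const_mul _)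
    hRi ?_ ?_ (by simpa only [hYint] using hdecay)
  · filter_upwards [hconv] with ω hω hωE hωL
    have hmem : ∀ t, ω ∈ S t := fun t => ⟨hωL, fun j h1 _ => hωE j (by omega)⟩
    have h1 : Tendsto (fun t => (Y t ω) ^ (1 / l)) atTop (𝓝 (0 ^ (1 / l))) :=
      hω.rpow_const (Or.inr (by positivity))
    rw [Real.zero_rpow (by positivity)] at h1
    refine h1.congr fun t => ?_
    have h0 := dotProduct_self_nonneg' (x (r + h * t) ω)
    simp only [hY, Set.indicator_of_mem (hmem t), hw]
    rw [Real.rpow_mul (hKpos t).le, ← Real.mul_rpow (Real.rpow_nonneg (hKpos t).le _) h0,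
      ← Real.rpow_mul (mul_nonneg (Real.rpow_nonneg (hKpos t).le _) h0), mul_one_div_cancel hl0.ne',
      Real.rpow_one]
  · intro t s hs
    have hs' : MeasurableSet[F (r + h * t)] s := hs
    have hsH : MeasurableSet[H (r + h * t)] s := hx.past_le _ _ hs'
    -- Intersecting both sets with a past event `s` gives the integrated form of the conditional
    -- inequality.
    obtain ⟨-, -, h3, -⟩ := hD t (s ∩ S t) (s ∩ S (t + 1))
      (Set.inter_subset_inter_right s (hSanti t)) (hs'.inter (hSm t)) (hsH.inter (hSm' t))
      (fun j hj => Set.inter_subset_right.trans (hSE t j hj))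
      ((hxi t).mono_set Set.inter_subset_right)
    simp only [hY, hR]
    rw [integral_const_mul, integral_const_mul, integral_const_mul, integral_const_mul,
      setIntegral_indicator (hSt (t + 1)), setIntegral_indicator (hSt t),
      setIntegral_indicator (hSt (t + 1)), hKs]
    have h5 : 0 ≤ ∫ ω in s ∩ S t, (x (r + h * t) ω ⬝ᵥ x (r + h * t) ω) ^ l ∂P :=
      integral_nonneg fun ω => Real.rpow_nonneg (dotProduct_self_nonneg' _) _
    calc _ ≤ w (t + 1) * _ := mul_le_mul_of_nonneg_left h3 (hw0 _)
      _ = w (t + 1) * (1 - b / 2 * ((r + h * t : ℕ) : ℝ) ^ (-c)) *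
            ∫ ω in s ∩ S t, (x (r + h * t) ω ⬝ᵥ x (r + h * t) ω) ^ l ∂P +
          w (t + 1) * (D t * ∫ ω in s ∩ S (t + 1), (ξ t ω ⬝ᵥ ξ t ω) ^ l ∂P) := by ring
      _ ≤ _ := add_le_add (mul_le_mul_of_nonneg_right (hws t) h5) le_rfl
  -- The weighted perturbation has exponent `δl - c - (2β - c)l`, which is below `-1` by `hδ1`.
  · have hsum : Summable fun t : ℕ => 3 / 2 * C *
        ((r + h * t : ℕ) : ℝ) ^ (-((2 * β - c - δ) * l + c)) :=
      (summable_rpow_neg_arithmetic hδ1 hr1 hx.one_le).mul_left _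
    refine Summable.of_nonneg_of_le (fun t => integral_nonneg fun ω => mul_nonneg (hw0 _)
      (mul_nonneg (hD0 t) (Set.indicator_nonneg
        (fun ω _ => Real.rpow_nonneg (dotProduct_self_nonneg' _) _) ω))) (fun t => ?_) hsum
    simp only [hR]
    rw [integral_const_mul, integral_const_mul, integral_indicator (hSt (t + 1))]
    have h1 := (hmain t).2.2.2
    have h2 : w (t + 1) ≤ 3 / 2 * w t := by
      have := (hratio t).2.2
      simp only [hw, hKs]
      exact this
    have h3 : 0 ≤ C * ((r + h * t : ℕ) : ℝ) ^ (-c - (2 * β - c) * l) :=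
      mul_nonneg hC (Real.rpow_nonneg (hKpos t).le _)
    calc _ ≤ 3 / 2 * w t * (C * ((r + h * t : ℕ) : ℝ) ^ (-c - (2 * β - c) * l)) := by
          refine (mul_le_mul_of_nonneg_left h1 (hw0 _)).trans
            (mul_le_mul_of_nonneg_right h2 h3)
      _ = 3 / 2 * C * (w t * ((r + h * t : ℕ) : ℝ) ^ (-c - (2 * β - c) * l)) := by ring
      _ = _ := by
          simp only [hw]
          rw [← Real.rpow_add (hKpos t)]
          congr 2; ring

/-- Almost sure convergence rate of a contractive recursion, on the event where the noise moments
stay controlled. -/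
theorem ae_tendsto_rpow_mul [IsFiniteMeasure P]
    (hx : IsContractiveRecursion P h F H a B g v x) {β c b M l δ : ℝ} (hβ : 0 ≤ β)
    (hc0 : 0 < c) (hc1 : c < 1) (hb : 0 < b) (hM : 0 ≤ M) (hl : 1 ≤ l)
    (hδ0 : 0 ≤ δ) (hδ : δ < 2 * β - c) (hδ1 : 1 < (2 * β - c - δ) * l + c)
    (ha0 : ∀ k, 0 ≤ a k) (ha : ∀ k, 1 ≤ k → a k ≤ (k : ℝ) ^ (-β))
    (hp : ∀ᶠ k : ℕ in atTop, IsContractingAt P h F B k (b * (k : ℝ) ^ (-c)))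
    {E : ℕ → Set Ω} (hE1 : ∀ j, MeasurableSet[F (j + 1)] (E j))
    (hE2 : ∀ k j, j < k + h → MeasurableSet[H k] (E j))
    (hv1 : ∀ k, 1 ≤ k → IntegrableOn (fun ω => (v k ω ⬝ᵥ v k ω) ^ l) (E k) P)
    (hv2 : ∀ k, 1 ≤ k → ∫ ω in E k, (v k ω ⬝ᵥ v k ω) ^ l ∂P ≤ M) :
    ∀ᵐ ω ∂P, (∀ j, 1 ≤ j → ω ∈ E j) →
      Tendsto (fun k : ℕ => (k : ℝ) ^ δ * (x k ω ⬝ᵥ x k ω)) atTop (𝓝 0) := by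
  obtain ⟨r₀, hr₀⟩ := eventually_atTop.1 (hx.ae_tendsto_progression hβ hc0 hc1 hb hM hl hδ0 hδ hδ1
    ha0 ha hp hE1 hE2 hv1 hv2)
  have h1 : ∀ r : ℕ, r₀ ≤ r → ∀ᵐ ω ∂P, (∀ j, 1 ≤ j → ω ∈ E j) →
      Tendsto (fun t : ℕ => ((r + h * t : ℕ) : ℝ) ^ δ *
        (x (r + h * t) ω ⬝ᵥ x (r + h * t) ω)) atTop (𝓝 0) := by
    intro r hr
    filter_upwards [ae_all_iff.2 fun L : ℕ => hr₀ r hr L] with ω hω hωE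
    obtain ⟨L, hL⟩ := exists_nat_ge (x r ω ⬝ᵥ x r ω)
    exact hω L hωE hL
  filter_upwards [ae_all_iff.2 fun r => ae_all_iff.2 fun hr => h1 r hr] with ω hω hωE
  intro s hs
  rw [mem_map]
  change ∀ᶠ k : ℕ in atTop, (k : ℝ) ^ δ * (x k ω ⬝ᵥ x k ω) ∈ s
  exact eventually_of_residues (r₀ := r₀) hx.one_le fun r hr _ => hω r hr hωE hs

end IsContractiveRecursion

end Rates

-- Normalized regressor matrices.

section NormalizedOuter

variable {m : ℕ}

theorem norm_sq_eq_dotProduct {ι : Type*} [Fintype ι] (y : EuclideanSpace ℝ ι) :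
    ‖y‖ ^ 2 = (fun a => y a) ⬝ᵥ (fun a => y a) := by
  rw [EuclideanSpace.real_norm_sq_eq, dotProduct_self_sum]

theorem normalizedOuter_isHermitian (y : EuclideanSpace ℝ (Fin m)) :
    (normalizedOuter y).IsHermitian := by
  ext a b
  simp [normalizedOuter, mul_comm]

theorem normalizedOuter_mulVec (y : EuclideanSpace ℝ (Fin m)) (z : Fin m → ℝ) (a : Fin m) :
    (normalizedOuter y *ᵥ z) a = ((fun b => y b) ⬝ᵥ z) * (1 / (1 + ‖y‖ ^ 2)) * y a := by
  simp only [Matrix.mulVec, dotProduct, normalizedOuter, Matrix.of_apply, Finset.sum_mul]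
  exact Finset.sum_congr rfl fun b _ => by ring

theorem dotProduct_normalizedOuter_mulVec (y : EuclideanSpace ℝ (Fin m)) (z : Fin m → ℝ) :
    z ⬝ᵥ normalizedOuter y *ᵥ z = ((fun b => y b) ⬝ᵥ z) ^ 2 * (1 / (1 + ‖y‖ ^ 2)) := by
  have : normalizedOuter y *ᵥ z =
      (((fun b => y b) ⬝ᵥ z) * (1 / (1 + ‖y‖ ^ 2))) • fun b => y b := by
    funext a
    rw [normalizedOuter_mulVec]; simp
  rw [this, dotProduct_smul, smul_eq_mul, dotProduct_comm z]
  ring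

theorem normalizedOuter_posSemidef (y : EuclideanSpace ℝ (Fin m)) :
    (normalizedOuter y).PosSemidef := by
  refine .of_dotProduct_mulVec_nonneg (normalizedOuter_isHermitian y) fun z => ?_
  rw [star_trivial, dotProduct_normalizedOuter_mulVec]
  positivity

theorem dotProduct_normalizedOuter_mulVec_le (y : EuclideanSpace ℝ (Fin m)) (z : Fin m → ℝ) :
    z ⬝ᵥ normalizedOuter y *ᵥ z ≤ z ⬝ᵥ z := by
  rw [dotProduct_normalizedOuter_mulVec, mul_one_div, div_le_iff₀ (by positivity),
    norm_sq_eq_dotProduct]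
  have h1 := dotProduct_sq_le (fun b => y b) z
  have h2 := dotProduct_self_nonneg' z
  linarith

theorem isHermitian_smul {ι : Type*} {X : Matrix ι ι ℝ} (hX : X.IsHermitian) (r : ℝ) :
    (r • X).IsHermitian := by
  rw [Matrix.IsHermitian, Matrix.conjTranspose_smul, hX.eq, star_trivial]

theorem one_sub_smul_normalizedOuter_bounds (y : EuclideanSpace ℝ (Fin m)) {r : ℝ} (h0 : 0 ≤ r)
    (h1 : r ≤ 1) : (1 - r • normalizedOuter y).PosSemidef ∧
      (1 - (1 - r • normalizedOuter y)).PosSemidef := by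
  have e0 : ∀ z : Fin m → ℝ, 0 ≤ z ⬝ᵥ normalizedOuter y *ᵥ z := fun z => by
    simpa using (normalizedOuter_posSemidef y).dotProduct_mulVec_nonneg z
  refine ⟨.of_dotProduct_mulVec_nonneg (Matrix.isHermitian_one.sub
    (isHermitian_smul (normalizedOuter_isHermitian y) r)) fun z => ?_, ?_⟩
  · rw [star_trivial, Matrix.sub_mulVec, Matrix.one_mulVec, dotProduct_sub, Matrix.smul_mulVec,
      dotProduct_smul, smul_eq_mul]
    have := dotProduct_normalizedOuter_mulVec_le y z
    nlinarith [e0 z]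
  · rw [sub_sub_cancel]
    refine .of_dotProduct_mulVec_nonneg (isHermitian_smul (normalizedOuter_isHermitian y) r)
      fun z => ?_
    rw [star_trivial, Matrix.smul_mulVec, dotProduct_smul, smul_eq_mul]
    exact mul_nonneg h0 (e0 z)

/-- The information gained by one adaptation step dominates the normalized regressor matrix. -/
theorem smul_normalizedOuter_le (y : EuclideanSpace ℝ (Fin m)) {r : ℝ} (h0 : 0 ≤ r) (h1 : r ≤ 1)
    (z : Fin m → ℝ) : r * (z ⬝ᵥ normalizedOuter y *ᵥ z) ≤
      z ⬝ᵥ (1 - (1 - r • normalizedOuter y) * (1 - r • normalizedOuter y)) *ᵥ z := by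
  obtain ⟨p0, p1⟩ := one_sub_smul_normalizedOuter_bounds y h0 h1
  rw [dotProduct_one_sub_sq_mulVec p0.1]
  have e := mulVec_dotProduct_self_le p0 p1 z
  have e1 : z ⬝ᵥ (1 - r • normalizedOuter y) *ᵥ z =
      z ⬝ᵥ z - r * (z ⬝ᵥ normalizedOuter y *ᵥ z) := by
    rw [Matrix.sub_mulVec, Matrix.one_mulVec, dotProduct_sub, Matrix.smul_mulVec,
      dotProduct_smul, smul_eq_mul]
  linarith

theorem isBddMeasurable_normalizedOuter {Ω : Type*} {σ : MeasurableSpace Ω}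
    {y : Ω → EuclideanSpace ℝ (Fin m)} (hy : Measurable[σ] y) :
    IsBddMeasurable σ fun ω => normalizedOuter (y ω) := by
  have hc : ∀ a, Measurable[σ] fun ω => y ω a := fun a => by fun_prop
  refine isBddMeasurable_of_posSemidef (fun a b => ?_) fun ω => ?_
  · simp only [normalizedOuter, Matrix.of_apply]
    exact ((hc a).mul (hc b)).div ((hy.norm.pow_const 2).const_add 1)
  · have := one_sub_smul_normalizedOuter_bounds (y ω) zero_le_one le_rfl
    rw [one_smul] at this
    exact ⟨normalizedOuter_posSemidef _, this.1⟩

end NormalizedOuter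

-- The diffusion algorithm as a linear recursion.

section Algorithm

variable {Ω : Type*} {n m : ℕ}

/-- The step size `(k + 1)^{-β}`. -/
noncomputable def stepSize (β : ℝ) (k : ℕ) : ℝ := 1 / ((k : ℝ) + 1) ^ β

theorem stepSize_nonneg (β : ℝ) (k : ℕ) : 0 ≤ stepSize β k := by
  unfold stepSize; positivity

theorem stepSize_le_one {β : ℝ} (hβ : 0 ≤ β) (k : ℕ) : stepSize β k ≤ 1 := by
  unfold stepSize
  rw [div_le_one (by positivity)]
  exact Real.one_le_rpow (by linarith [Nat.cast_nonneg (α := ℝ) k]) hβ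

theorem stepSize_eq (β : ℝ) (k : ℕ) : stepSize β k = ((k + 1 : ℕ) : ℝ) ^ (-β) := by
  rw [stepSize, Real.rpow_neg (by positivity), one_div]
  push_cast
  rfl

theorem stepSize_le {β : ℝ} (hβ : 0 ≤ β) {k : ℕ} (hk : 1 ≤ k) :
    stepSize β k ≤ (k : ℝ) ^ (-β) := by
  rw [stepSize_eq]
  exact Real.rpow_le_rpow_of_nonpos (by exact_mod_cast hk) (by push_cast; linarith) (by linarith)

theorem stepSize_antitone {β : ℝ} (hβ : 0 ≤ β) : Antitone (stepSize β) := by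
  intro j k hjk
  rw [stepSize_eq, stepSize_eq]
  exact Real.rpow_le_rpow_of_nonpos (by positivity) (by exact_mod_cast Nat.succ_le_succ hjk)
    (by linarith)

/-- The local adaptation matrices `I - (k + 1)^{-β} φ φᵀ / (1 + ‖φ‖²)`. -/
noncomputable def adaptMatrix (β : ℝ) (φ : ℕ → Fin n → Ω → EuclideanSpace ℝ (Fin m)) (k : ℕ) (i : Fin n)
    (ω : Ω) : Matrix (Fin m) (Fin m) ℝ :=
  1 - stepSize β k • normalizedOuter (φ k i ω)

/-- The one-step transition matrix of the stacked error. -/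
noncomputable def errorMatrix (A : Matrix (Fin n) (Fin n) ℝ) (β : ℝ)
    (φ : ℕ → Fin n → Ω → EuclideanSpace ℝ (Fin m)) (k : ℕ) (ω : Ω) :
    Matrix (Fin n × Fin m) (Fin n × Fin m) ℝ :=
  (A ⊗ₖ (1 : Matrix (Fin m) (Fin m) ℝ)) * blockDiag fun i => adaptMatrix β φ k i ω

/-- The block diagonal matrix of the gains. -/
noncomputable def gainBlock (β : ℝ) (φ : ℕ → Fin n → Ω → EuclideanSpace ℝ (Fin m)) (k : ℕ) (ω : Ω) :
    Matrix (Fin n × Fin m) (Fin n) ℝ :=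
  Matrix.of fun p j => if p.1 = j then rmGain β φ k p.1 ω p.2 else 0

/-- The matrix through which the noise vector enters the stacked error. -/
noncomputable def noiseMatrix (A : Matrix (Fin n) (Fin n) ℝ) (β : ℝ)
    (φ : ℕ → Fin n → Ω → EuclideanSpace ℝ (Fin m)) (k : ℕ) (ω : Ω) :
    Matrix (Fin n × Fin m) (Fin n) ℝ :=
  (A ⊗ₖ (1 : Matrix (Fin m) (Fin m) ℝ)) * gainBlock β φ k ω

/-- The stacked error as a plain vector. -/
noncomputable def errorVec (A : Matrix (Fin n) (Fin n) ℝ) (β : ℝ)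
    (θ : EuclideanSpace ℝ (Fin m)) (θ₀ : Fin n → EuclideanSpace ℝ (Fin m))
    (φ : ℕ → Fin n → Ω → EuclideanSpace ℝ (Fin m)) (ε : ℕ → Fin n → Ω → ℝ)
    (k : ℕ) (ω : Ω) (p : Fin n × Fin m) : ℝ :=
  atcEstimate A φ (observation θ φ ε) (rmGain β φ) θ₀ k p.1 ω p.2 - θ p.2

theorem norm_sq_stackedError (A : Matrix (Fin n) (Fin n) ℝ) (β : ℝ)
    (θ : EuclideanSpace ℝ (Fin m)) (θ₀ : Fin n → EuclideanSpace ℝ (Fin m))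
    (φ : ℕ → Fin n → Ω → EuclideanSpace ℝ (Fin m)) (ε : ℕ → Fin n → Ω → ℝ) (k : ℕ) (ω : Ω) :
    ‖stackedError A β θ θ₀ φ ε k ω‖ ^ 2 =
      errorVec A β θ θ₀ φ ε k ω ⬝ᵥ errorVec A β θ θ₀ φ ε k ω := by
  rw [norm_sq_eq_dotProduct]
  rfl

theorem inner_eq_dotProduct {ι : Type*} [Fintype ι] (y z : EuclideanSpace ℝ ι) :
    inner ℝ y z = (fun a => z a) ⬝ᵥ (fun a => y a) := by
  simp [PiLp.inner_apply, dotProduct]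

theorem gainBlock_mulVec_apply (β : ℝ) (φ : ℕ → Fin n → Ω → EuclideanSpace ℝ (Fin m)) (k : ℕ)
    (ω : Ω) (w : Fin n → ℝ) (i : Fin n) (a : Fin m) :
    (gainBlock β φ k ω *ᵥ w) (i, a) = rmGain β φ k i ω a * w i := by
  simp [gainBlock, Matrix.mulVec, dotProduct]

theorem errorVec_succ {A : Matrix (Fin n) (Fin n) ℝ} (hA : A ∈ doublyStochastic ℝ (Fin n)) (β : ℝ)
    (θ : EuclideanSpace ℝ (Fin m)) (θ₀ : Fin n → EuclideanSpace ℝ (Fin m))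
    (φ : ℕ → Fin n → Ω → EuclideanSpace ℝ (Fin m)) (ε : ℕ → Fin n → Ω → ℝ) (k : ℕ) (ω : Ω) :
    errorVec A β θ θ₀ φ ε (k + 1) ω = errorMatrix A β φ k ω *ᵥ errorVec A β θ θ₀ φ ε k ω +
      noiseMatrix A β φ k ω *ᵥ fun i => ε k i ω := by
  obtain ⟨-, hrow, -⟩ := mem_doublyStochastic_iff_sum.1 hA
  rw [errorMatrix, noiseMatrix, ← Matrix.mulVec_mulVec, ← Matrix.mulVec_mulVec, ← Matrix.mulVec_add]
  funext ⟨i, a⟩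
  rw [kronecker_one_mulVec_apply]
  -- Averaging fixes the true parameter, so the error can be subtracted inside the sum over
  -- neighbours.
  have e1 : θ a = ∑ j, A i j * θ a := by rw [← Finset.sum_mul, hrow, one_mul]
  simp only [errorVec, atcEstimate, WithLp.ofLp_sum, Finset.sum_apply, PiLp.smul_apply, PiLp.add_apply, smul_eq_mul]
  rw [e1, ← Finset.sum_sub_distrib]
  refine Finset.sum_congr rfl fun j _ => ?_
  rw [← mul_sub]
  congr 1
  rw [Pi.add_apply, blockDiag_mulVec_apply, gainBlock_mulVec_apply, adaptMatrix, Matrix.sub_mulVec,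
    Matrix.one_mulVec, Pi.sub_apply, Matrix.smul_mulVec, Pi.smul_apply, normalizedOuter_mulVec,
    observation, inner_eq_dotProduct, inner_eq_dotProduct, rmGain, stepSize]
  have e2 : ((fun b => φ k j ω b) ⬝ᵥ fun b =>
      atcEstimate A φ (observation θ φ ε) (rmGain β φ) θ₀ k j ω b - θ b) =
      ((fun b => φ k j ω b) ⬝ᵥ fun b =>
        atcEstimate A φ (observation θ φ ε) (rmGain β φ) θ₀ k j ω b) -
      ((fun b => φ k j ω b) ⬝ᵥ fun b => θ b) := by
    rw [← dotProduct_sub]; rfl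
  simp only [errorVec]
  rw [e2]
  simp only [PiLp.smul_apply, smul_eq_mul]
  ring

theorem adaptMatrix_bounds {β : ℝ} (hβ : 0 ≤ β) (φ : ℕ → Fin n → Ω → EuclideanSpace ℝ (Fin m))
    (k : ℕ) (i : Fin n) (ω : Ω) :
    (adaptMatrix β φ k i ω).PosSemidef ∧ (1 - adaptMatrix β φ k i ω).PosSemidef :=
  one_sub_smul_normalizedOuter_bounds _ (stepSize_nonneg β k) (stepSize_le_one hβ k)

theorem errorMatrix_contraction {A : Matrix (Fin n) (Fin n) ℝ}
    (hA : A ∈ doublyStochastic ℝ (Fin n)) {β : ℝ} (hβ : 0 ≤ β)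
    (φ : ℕ → Fin n → Ω → EuclideanSpace ℝ (Fin m)) (k : ℕ) (ω : Ω) (z : Fin n × Fin m → ℝ) :
    (errorMatrix A β φ k ω *ᵥ z) ⬝ᵥ (errorMatrix A β φ k ω *ᵥ z) ≤ z ⬝ᵥ z := by
  rw [errorMatrix, ← Matrix.mulVec_mulVec]
  exact (kronecker_mulVec_dotProduct_self_le hA _).trans
    (blockDiag_mulVec_dotProduct_self_le (fun i => adaptMatrix_bounds hβ φ k i ω) z)

/-- The normalization bounds the gain however large the regressor is: `t/(1 + t)² ≤ 1/4` for `t ≥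
0`. -/
theorem norm_sq_rmGain_le (β : ℝ) (φ : ℕ → Fin n → Ω → EuclideanSpace ℝ (Fin m)) (k : ℕ)
    (i : Fin n) (ω : Ω) : ‖rmGain β φ k i ω‖ ^ 2 ≤ stepSize β k ^ 2 / 4 := by
  rw [rmGain, norm_smul, mul_pow, Real.norm_eq_abs, sq_abs, ← stepSize]
  set N := ‖φ k i ω‖ ^ 2 with hN
  have hN0 : 0 ≤ N := sq_nonneg _
  have h1 : (1 / (1 + N)) ^ 2 * N ≤ 1 / 4 := by
    rw [div_pow, one_pow, one_div, inv_mul_le_iff₀ (by positivity)]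
    nlinarith [sq_nonneg (1 - N)]
  calc (stepSize β k * (1 / (1 + N))) ^ 2 * N = stepSize β k ^ 2 * ((1 / (1 + N)) ^ 2 * N) := by
        ring
    _ ≤ stepSize β k ^ 2 * (1 / 4) := mul_le_mul_of_nonneg_left h1 (sq_nonneg _)
    _ = _ := by ring

theorem noiseMatrix_mulVec_le {A : Matrix (Fin n) (Fin n) ℝ}
    (hA : A ∈ doublyStochastic ℝ (Fin n)) (β : ℝ)
    (φ : ℕ → Fin n → Ω → EuclideanSpace ℝ (Fin m)) (k : ℕ) (ω : Ω) (w : Fin n → ℝ) :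
    (noiseMatrix A β φ k ω *ᵥ w) ⬝ᵥ (noiseMatrix A β φ k ω *ᵥ w) ≤
      stepSize β k ^ 2 / 4 * (w ⬝ᵥ w) := by
  rw [noiseMatrix, ← Matrix.mulVec_mulVec]
  refine (kronecker_mulVec_dotProduct_self_le hA _).trans ?_
  rw [dotProduct_self_prod, dotProduct_self_sum w, Finset.mul_sum]
  refine Finset.sum_le_sum fun i _ => ?_
  have e : (fun a => (gainBlock β φ k ω *ᵥ w) (i, a)) = w i • fun a => rmGain β φ k i ω a := by
    funext a
    rw [gainBlock_mulVec_apply]; simp [mul_comm]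
  rw [e, smul_dotProduct, dotProduct_smul, smul_eq_mul, smul_eq_mul, ← norm_sq_eq_dotProduct,
    ← mul_assoc, ← sq, mul_comm]
  exact mul_le_mul_of_nonneg_right (norm_sq_rmGain_le β φ k i ω) (sq_nonneg _)

theorem transition_errorMatrix (A : Matrix (Fin n) (Fin n) ℝ) (β : ℝ)
    (φ : ℕ → Fin n → Ω → EuclideanSpace ℝ (Fin m)) (k i : ℕ) (ω : Ω) :
    transition (errorMatrix A β φ) k i ω = psi A (fun j i => adaptMatrix β φ (k + j) i ω) i := by
  induction i with
  | zero => rfl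
  | succ i ih => rw [transition, psi, ih, errorMatrix]

theorem isBddMeasurable_adaptMatrix {σ : MeasurableSpace Ω} (β : ℝ)
    {φ : ℕ → Fin n → Ω → EuclideanSpace ℝ (Fin m)} {k : ℕ} {i : Fin n}
    (hφ : Measurable[σ] (φ k i)) : IsBddMeasurable σ (adaptMatrix β φ k i) :=
  (IsBddMeasurable.const 1).sub ((isBddMeasurable_normalizedOuter hφ).smul _)

theorem isBddMeasurable_errorMatrix {σ : MeasurableSpace Ω} (A : Matrix (Fin n) (Fin n) ℝ) (β : ℝ)
    {φ : ℕ → Fin n → Ω → EuclideanSpace ℝ (Fin m)} {k : ℕ}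
    (hφ : ∀ i, Measurable[σ] (φ k i)) : IsBddMeasurable σ (errorMatrix A β φ k) :=
  (IsBddMeasurable.const _).mul (.blockDiag fun i => isBddMeasurable_adaptMatrix β (hφ i))

theorem measurable_rmGain {σ : MeasurableSpace Ω} (β : ℝ)
    {φ : ℕ → Fin n → Ω → EuclideanSpace ℝ (Fin m)} {k : ℕ} {i : Fin n}
    (hφ : Measurable[σ] (φ k i)) (a : Fin m) : Measurable[σ] fun ω => rmGain β φ k i ω a := by
  have hc : Measurable[σ] fun ω => φ k i ω a := by fun_prop
  simp only [rmGain, PiLp.smul_apply, smul_eq_mul]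
  exact (((hφ.norm.pow_const 2).const_add 1).const_div 1 |>.const_mul _).mul hc

theorem measurable_noiseMatrix {σ : MeasurableSpace Ω} (A : Matrix (Fin n) (Fin n) ℝ) (β : ℝ)
    {φ : ℕ → Fin n → Ω → EuclideanSpace ℝ (Fin m)} {k : ℕ}
    (hφ : ∀ i, Measurable[σ] (φ k i)) (p : Fin n × Fin m) (q : Fin n) :
    Measurable[σ] fun ω => noiseMatrix A β φ k ω p q := by
  simp only [noiseMatrix, Matrix.mul_apply]
  refine Finset.measurable_sum _ fun r _ => Measurable.const_mul ?_ _
  by_cases hr : r.1 = q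
  · simpa only [gainBlock, Matrix.of_apply, hr, if_true] using measurable_rmGain β (hφ q) r.2
  · simp only [gainBlock, Matrix.of_apply, hr, if_false]
    exact measurable_const

end Algorithm

-- σ-algebras that decorrelate the noise.

section SigmaAlgebras

variable {Ω : Type*} {n m : ℕ} {φ : ℕ → Fin n → Ω → EuclideanSpace ℝ (Fin m)}
  {ε : ℕ → Fin n → Ω → ℝ}

theorem measurable_regressorSigma {j k : ℕ} (hjk : j ≤ k) (i : Fin n) :
    Measurable[regressorSigma φ k] (φ j i) :=
  (comap_measurable (φ j i)).mono
    ((le_iSup (fun i => MeasurableSpace.comap (φ j i) inferInstance) i).trans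
      (le_iSup₂ (f := fun j (_ : j ≤ k) => ⨆ i, MeasurableSpace.comap (φ j i) inferInstance)
        j hjk)) le_rfl

theorem measurable_pastNoiseSigma {j k : ℕ} (hjk : j < k) (i : Fin n) :
    Measurable[pastNoiseSigma ε k] (ε j i) :=
  (comap_measurable (ε j i)).mono
    ((le_iSup (fun i => MeasurableSpace.comap (ε j i) inferInstance) i).trans
      (le_iSup₂ (f := fun j (_ : j < k) => ⨆ i, MeasurableSpace.comap (ε j i) inferInstance)
        j hjk)) le_rfl

theorem measurable_pastSigma {j k : ℕ} (hjk : j < k) (i : Fin n) :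
    Measurable[pastSigma φ ε k] (φ j i) :=
  (comap_measurable (φ j i)).mono
    (((le_iSup (fun i => MeasurableSpace.comap (φ j i) inferInstance) i).trans
      (le_iSup₂ (f := fun j (_ : j < k) => ⨆ i, MeasurableSpace.comap (φ j i) inferInstance)
        j hjk)).trans le_sup_left) le_rfl

theorem regressorSigma_le {σ : MeasurableSpace Ω} {k : ℕ}
    (h : ∀ j ≤ k, ∀ i, Measurable[σ] (φ j i)) : regressorSigma φ k ≤ σ :=
  iSup₂_le fun j hj => iSup_le fun i => (h j hj i).comap_le

theorem pastNoiseSigma_le {σ : MeasurableSpace Ω} {k : ℕ}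
    (h : ∀ j < k, ∀ i, Measurable[σ] (ε j i)) : pastNoiseSigma ε k ≤ σ :=
  iSup₂_le fun j hj => iSup_le fun i => (h j hj i).comap_le

theorem pastSigma_le {σ : MeasurableSpace Ω} {k : ℕ}
    (h : ∀ j < k, ∀ i, Measurable[σ] (φ j i)) (h' : ∀ j < k, ∀ i, Measurable[σ] (ε j i)) :
    pastSigma φ ε k ≤ σ :=
  sup_le (iSup₂_le fun j hj => iSup_le fun i => (h j hj i).comap_le) (pastNoiseSigma_le h')

theorem pastNoiseSigma_mono : Monotone (pastNoiseSigma ε) := fun _ _ hjk =>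
  pastNoiseSigma_le fun _ hi i => measurable_pastNoiseSigma (hi.trans_le hjk) i

theorem regressorSigma_mono : Monotone (regressorSigma φ) := fun _ _ hjk =>
  regressorSigma_le fun _ hi i => measurable_regressorSigma (hi.trans hjk) i

theorem pastSigma_mono : Monotone (pastSigma φ ε) := fun _ _ hjk =>
  pastSigma_le (fun _ hi i => measurable_pastSigma (hi.trans_le hjk) i)
    fun _ hi i => (measurable_pastNoiseSigma (hi.trans_le hjk) i).mono le_sup_right le_rfl

theorem regressorSigma_le_pastSigma (k : ℕ) : regressorSigma φ k ≤ pastSigma φ ε (k + 1) :=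
  regressorSigma_le fun _ hj i => measurable_pastSigma (Nat.lt_succ_of_le hj) i

/-- The σ-algebras used to decorrelate the noise: over the next `h` steps the regressors are known,
while the noise is still centered. -/
structure IsNoiseFiltration [mΩ : MeasurableSpace Ω] (P : Measure Ω) (h : ℕ)
    (φ : ℕ → Fin n → Ω → EuclideanSpace ℝ (Fin m)) (ε : ℕ → Fin n → Ω → ℝ)
    (H : ℕ → MeasurableSpace Ω) : Prop where
  mono : Monotone H
  le : ∀ k, H k ≤ mΩ
  regressorSigma_le : ∀ k j, j < k + h → regressorSigma φ j ≤ H k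
  pastNoiseSigma_le : ∀ k, pastNoiseSigma ε k ≤ H k
  centered : ∀ k i, P[ε k i | H k] =ᵐ[P] 0

theorem isNoiseFiltration_of_centeredGivenPast [MeasurableSpace Ω] {P : Measure Ω}
    (hφ : ∀ k i, Measurable (φ k i)) (hε : ∀ k i, Measurable (ε k i))
    (hc : NoiseCenteredGivenPast P φ ε) :
    IsNoiseFiltration P 1 φ ε fun k => regressorSigma φ k ⊔ pastNoiseSigma ε k where
  mono _ _ hjk := sup_le_sup (regressorSigma_mono hjk) (pastNoiseSigma_mono hjk)
  le _ := sup_le (regressorSigma_le fun j _ i => hφ j i) (pastNoiseSigma_le fun j _ i => hε j i)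
  regressorSigma_le _ _ hj := (regressorSigma_mono (Nat.lt_succ_iff.1 hj)).trans le_sup_left
  pastNoiseSigma_le _ := le_sup_right
  centered k i := hc k i

/-- If `X` is independent of `(Y, Z)` and `Y` is independent of `Z`, then `(X, Y)` is independent
of `Z`. -/
theorem indepFun_prodMk_left {α β γ : Type*} [MeasurableSpace Ω] [MeasurableSpace α]
    [MeasurableSpace β] [MeasurableSpace γ] {P : Measure Ω} [IsProbabilityMeasure P]
    {X : Ω → α} {Y : Ω → β} {Z : Ω → γ} (hX : Measurable X) (hY : Measurable Y) (hZ : Measurable Z)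
    (h1 : IndepFun X (fun ω => (Y ω, Z ω)) P) (h2 : IndepFun Y Z P) :
    IndepFun (fun ω => (X ω, Y ω)) Z P := by
  have h3 : IndepFun X Y P := h1.comp measurable_id measurable_fst
  rw [indepFun_iff_map_prod_eq_prod_map_map (by fun_prop) (by fun_prop)] at h1 h2 h3 ⊢
  have := Measure.isProbabilityMeasure_map (μ := P) hX.aemeasurable
  have := Measure.isProbabilityMeasure_map (μ := P) hY.aemeasurable
  have := Measure.isProbabilityMeasure_map (μ := P) hZ.aemeasurable
  have e : (fun ω => ((X ω, Y ω), Z ω)) =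
      MeasurableEquiv.prodAssoc.symm ∘ fun ω => (X ω, (Y ω, Z ω)) := rfl
  rw [e, ← Measure.map_map (by fun_prop) (by fun_prop), h1, h2, h3, ← Measure.prodAssoc_prod,
    Measure.map_map (by fun_prop) (by fun_prop)]
  simp

/-- Under independence all regressors, future ones included, can be adjoined to the past noise: the
current noise is independent of the pair, so its conditional mean is its mean, which is zero. -/
theorem isNoiseFiltration_of_indepFun [MeasurableSpace Ω] {P : Measure Ω} [IsProbabilityMeasure P]
    {M : ℝ} (hφ : ∀ k i, Measurable (φ k i)) (hε : ∀ k i, Measurable (ε k i))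
    (hnoise : NoiseAssumption P φ ε M)
    (hind : IndepFun (fun (ω : Ω) (p : ℕ × Fin n) => φ p.1 p.2 ω)
      (fun (ω : Ω) (p : ℕ × Fin n) => ε p.1 p.2 ω) P) (h : ℕ) :
    IsNoiseFiltration P h φ ε fun k =>
      MeasurableSpace.comap (fun ω (p : ℕ × Fin n) => φ p.1 p.2 ω) inferInstance ⊔
        pastNoiseSigma ε k := by
  have hX : Measurable fun ω (p : ℕ × Fin n) => φ p.1 p.2 ω := by fun_prop
  have hφm : ∀ j i, Measurable[MeasurableSpace.comap (fun ω (p : ℕ × Fin n) => φ p.1 p.2 ω)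
      inferInstance] (φ j i) := fun j i =>
    (measurable_pi_apply (X := fun _ : ℕ × Fin n => EuclideanSpace ℝ (Fin m)) (j, i)).comp
      (comap_measurable fun ω (p : ℕ × Fin n) => φ p.1 p.2 ω)
  refine ⟨fun _ _ hjk => sup_le_sup le_rfl (pastNoiseSigma_mono hjk),
    fun k => sup_le hX.comap_le (pastNoiseSigma_le fun j _ i => hε j i),
    fun k j _ => (regressorSigma_le fun j' _ i => hφm j' i).trans le_sup_left,
    fun k => le_sup_right, fun k i => ?_⟩
  have hY : Measurable fun ω (j : Finset.range k) (i : Fin n) => ε j i ω := by fun_prop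
  have hZ : Measurable fun ω (j : ({k} : Finset ℕ)) (i : Fin n) => ε j i ω := by fun_prop
  have hYZ := hnoise.independent.indepFun_finset (Finset.range k) {k} (by simp)
    (fun k => by fun_prop)
  have hXYZ : IndepFun (fun ω (p : ℕ × Fin n) => φ p.1 p.2 ω)
      (fun ω => ((fun (j : Finset.range k) (i : Fin n) => ε j i ω),
        fun (j : ({k} : Finset ℕ)) (i : Fin n) => ε j i ω)) P :=
    hind.comp (φ := id) (ψ := fun (y : ℕ × Fin n → ℝ) =>
      ((fun (j : Finset.range k) (i : Fin n) => y (j, i)),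
        fun (j : ({k} : Finset ℕ)) (i : Fin n) => y (j, i))) measurable_id (by fun_prop)
  have hfin := indepFun_prodMk_left hX hY hZ hXYZ hYZ
  have hle : MeasurableSpace.comap (fun ω (p : ℕ × Fin n) => φ p.1 p.2 ω) inferInstance ⊔
      pastNoiseSigma ε k ≤ MeasurableSpace.comap (fun ω => ((fun (p : ℕ × Fin n) => φ p.1 p.2 ω),
        fun (j : Finset.range k) (i : Fin n) => ε j i ω)) inferInstance := by
    refine sup_le ?_ (pastNoiseSigma_le fun j hj i => ?_)
    · exact Measurable.comap_le (measurable_fst.comp (comap_measurable _))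
    · have hg : Measurable fun y : (ℕ × Fin n → EuclideanSpace ℝ (Fin m)) ×
          (Finset.range k → Fin n → ℝ) => y.2 ⟨j, Finset.mem_range.2 hj⟩ i := by fun_prop
      exact hg.comp (comap_measurable fun ω => ((fun (p : ℕ × Fin n) => φ p.1 p.2 ω),
        fun (j : Finset.range k) (i : Fin n) => ε j i ω))
  have hεm : Measurable[MeasurableSpace.comap
      (fun ω (j : ({k} : Finset ℕ)) (i : Fin n) => ε j i ω) inferInstance] (ε k i) := by
    have hg : Measurable fun y : ({k} : Finset ℕ) → Fin n → ℝ =>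
      y ⟨k, Finset.mem_singleton_self k⟩ i := by fun_prop
    exact hg.comp (comap_measurable fun ω (j : ({k} : Finset ℕ)) (i : Fin n) => ε j i ω)
  have hindep := indep_of_indep_of_le_left ((IndepFun_iff_Indep _ _ _).1 hfin) hle
  have h0 : ∫ ω, ε k i ω ∂P = 0 := by
    rw [← integral_condExp (regressorSigma_le (k := k) fun j _ i => hφ j i),
      integral_congr_ae (hnoise.centered k i)]
    simp
  have := condExp_indep_eq hZ.comap_le
    (sup_le hX.comap_le (pastNoiseSigma_le (k := k) fun j _ i => hε j i)) hεm.stronglyMeasurable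
    hindep.symm
  rw [h0] at this
  exact this

end SigmaAlgebras

-- The error process as a contractive recursion.

section Instantiation

variable {Ω : Type u} {n m : ℕ} [mΩ : MeasurableSpace Ω] {P : Measure Ω} [IsProbabilityMeasure P]
  {A : Matrix (Fin n) (Fin n) ℝ} {φ : ℕ → Fin n → Ω → EuclideanSpace ℝ (Fin m)}
  {ε : ℕ → Fin n → Ω → ℝ} {h : ℕ} {H : ℕ → MeasurableSpace Ω}

theorem isContractiveRecursion_errorVec (hA : A ∈ doublyStochastic ℝ (Fin n)) {β : ℝ} (hβ : 0 ≤ β)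
    (θ : EuclideanSpace ℝ (Fin m)) (θ₀ : Fin n → EuclideanSpace ℝ (Fin m)) (hh : 1 ≤ h)
    (hH : IsNoiseFiltration P h φ ε H) (hε2 : ∀ k i, MemLp (ε k i) 2 P) :
    IsContractiveRecursion P h (pastSigma φ ε) H (stepSize β) (errorMatrix A β φ)
      (noiseMatrix A β φ) (fun k ω i => ε k i ω) (errorVec A β θ θ₀ φ ε) where
  one_le := hh
  past_le k := pastSigma_le (fun j hj i =>
      (measurable_regressorSigma le_rfl i).mono (hH.regressorSigma_le k j (by omega)) le_rfl)
    fun j hj i => (measurable_pastNoiseSigma hj i).mono (hH.pastNoiseSigma_le k) le_rfl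
  past_mono := pastSigma_mono
  mono := hH.mono
  le := hH.le
  succ_eq k ω := errorVec_succ hA β θ θ₀ φ ε k ω
  contraction k ω z := errorMatrix_contraction hA hβ φ k ω z
  gain_le k ω w := noiseMatrix_mulVec_le hA β φ k ω w
  measurable_B k j hj := (isBddMeasurable_errorMatrix A β fun i =>
    (measurable_regressorSigma le_rfl i).mono (hH.regressorSigma_le k j hj) le_rfl).measurable
  measurable_g k j hj := measurable_noiseMatrix A β fun i =>
    (measurable_regressorSigma le_rfl i).mono (hH.regressorSigma_le k j hj) le_rfl
  measurable_B_past k := (isBddMeasurable_errorMatrix A β fun i =>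
    measurable_pastSigma (Nat.lt_succ_self k) i).measurable
  measurable_x k := by
    induction k with
    | zero =>
      intro p
      simp only [errorVec, atcEstimate]
      exact measurable_const
    | succ k ih =>
      intro p
      simp only [errorVec_succ hA, Pi.add_apply]
      have hm : pastSigma φ ε k ≤ pastSigma φ ε (k + 1) := pastSigma_mono (Nat.le_succ k)
      refine Measurable.add (measurable_mulVec_apply (isBddMeasurable_errorMatrix A β fun i =>
        measurable_pastSigma (Nat.lt_succ_self k) i).measurable
        (fun q => (ih q).mono hm le_rfl) p) ?_
      exact measurable_mulVec_apply (measurable_noiseMatrix A β fun i =>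
        measurable_pastSigma (Nat.lt_succ_self k) i) (fun q =>
        (measurable_pastNoiseSigma (Nat.lt_succ_self k) q).mono le_sup_right le_rfl) p
  measurable_v k q := (measurable_pastNoiseSigma (Nat.lt_succ_self k) q).mono
    (hH.pastNoiseSigma_le (k + 1)) le_rfl
  memLp_zero p := by
    simp only [errorVec, atcEstimate]
    exact memLp_const _
  memLp_v := hε2
  centered := hH.centered

/-- Mean-square contraction of the error over an excited window. -/
theorem isContractingAt_errorMatrix (hn : 1 ≤ n) (hm : 1 ≤ m)
    {β : ℝ} (hβ : 0 ≤ β) (hh : 1 ≤ h) (hφ : ∀ k i, Measurable (φ k i))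
    (hε : ∀ k i, Measurable (ε k i)) {s : ℝ} (hs : 0 ≤ s)
    (hcon : IsContractionConstant.{u} A h s) {k : ℕ} {lam : ℝ}
    (hexc : ∀ᵐ ω ∂P, lam ≤ excitationLevel P φ ε h k ω) :
    IsContractiveRecursion.IsContractingAt P h (pastSigma φ ε) (errorMatrix A β φ) k
      (s * (stepSize β (k + h - 1) * (n * h) * lam)) := by
  intro z hz hz2
  have hF : pastSigma φ ε k ≤ mΩ := pastSigma_le (fun j _ i => hφ j i) fun j _ i => hε j i
  have : Nonempty (Fin m) := ⟨⟨0, hm⟩⟩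
  have hn0 : (0 : ℝ) < n := by exact_mod_cast hn
  have hh0 : (0 : ℝ) < h := by exact_mod_cast hh
  -- The steps decrease, so the last one of the window bounds all of them from below.
  set a := stepSize β (k + h - 1) with ha
  have ha0 : 0 ≤ a := stepSize_nonneg _ _
  set D : ℕ → Fin n → Ω → Matrix (Fin m) (Fin m) ℝ := fun j i => adaptMatrix β φ (k + j) i with hD
  have hDb : ∀ j i, IsBddMeasurable mΩ (D j i) := fun j i =>
    isBddMeasurable_adaptMatrix β (hφ _ i)
  have hDP : ∀ j i ω, (D j i ω).PosSemidef ∧ (1 - D j i ω).PosSemidef := fun j i ω =>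
    adaptMatrix_bounds hβ φ (k + j) i ω
  set Q : Ω → Matrix (Fin m) (Fin m) ℝ :=
    fun ω' => ∑ k ∈ Finset.range h, ∑ i, (1 - D k i ω' * D k i ω') with hQ
  set X : Ω → Matrix (Fin n × Fin m) (Fin n × Fin m) ℝ := fun ω' =>
    1 - (psi A (fun k i => D k i ω') h)ᵀ * psi A (fun k i => D k i ω') h with hX
  set G : Ω → Matrix (Fin m) (Fin m) ℝ := fun ω' => (1 / ((n : ℝ) * (h : ℝ))) •
      ∑ i, ∑ j ∈ Finset.Ico k (k + h), normalizedOuter (φ j i ω') with hG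
  have hQb : IsBddMeasurable mΩ Q := .sum fun k _ => .sum fun i _ =>
    (IsBddMeasurable.const 1).sub ((hDb k i).mul (hDb k i))
  have hGb : IsBddMeasurable mΩ G := (IsBddMeasurable.sum fun i _ => .sum fun j _ =>
    isBddMeasurable_normalizedOuter (hφ j i)).smul _
  have hψ : IsBddMeasurable mΩ fun ω => psi A (fun k i => D k i ω) h :=
    .psi A h fun k _ i => hDb k i
  have hXb : IsBddMeasurable mΩ X := (IsBddMeasurable.const 1).sub (hψ.transpose.mul hψ)
  have hQh : ∀ ω, (Q ω).IsHermitian := fun ω =>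
    isHermitian_sum fun k _ => isHermitian_sum fun i _ => isHermitian_one_sub_sq (hDP k i ω).1.1
  have hXh : ∀ ω, (X ω).IsHermitian := fun ω => isHermitian_one_sub_gram _
  have hGh : ∀ ω, (G ω).IsHermitian := fun ω => isHermitian_smul
    (isHermitian_sum fun i _ => isHermitian_sum fun j _ => normalizedOuter_isHermitian _) _
  have hnn : ∀ y : EuclideanSpace ℝ (Fin m), ∀ w : Fin m → ℝ,
      0 ≤ w ⬝ᵥ normalizedOuter y *ᵥ w := fun y w => by
    simpa using (normalizedOuter_posSemidef y).dotProduct_mulVec_nonneg w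
  have hGQ : ∀ ω w, w ⬝ᵥ ((a * (n * h)) • G ω) *ᵥ w ≤ w ⬝ᵥ Q ω *ᵥ w := by
    intro ω w
    rw [hG, hQ, smul_smul]
    have e : a * (n * h) * (1 / ((n : ℝ) * h)) = a := by field_simp
    rw [e, Matrix.smul_mulVec, dotProduct_smul, smul_eq_mul, Finset.sum_comm]
    simp only [dotProduct_sum_mulVec]
    rw [Finset.sum_Ico_eq_sum_range, Nat.add_sub_cancel_left, Finset.mul_sum]
    refine Finset.sum_le_sum fun j hj => ?_
    rw [Finset.mul_sum]
    refine Finset.sum_le_sum fun i _ => ?_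
    have h1 := smul_normalizedOuter_le (φ (k + j) i ω) (stepSize_nonneg β (k + j))
      (stepSize_le_one hβ (k + j)) w
    refine le_trans (mul_le_mul_of_nonneg_right ?_ (hnn _ w)) h1
    refine stepSize_antitone hβ ?_
    have := Finset.mem_range.1 hj
    omega
  have key := condExpMatrix_dotProduct_mulVec_mono (P := P) (F := pastSigma φ ε k)
    (hGb.smul (a * (n * h))).integrable hQb.integrable hGQ
  -- The contraction constant is applied to the actual adaptation matrices, conditioned on the past
  -- in which excitation is assumed.
  have hcon' := hcon m Ω (pastSigma φ ε k) P D hm hF (fun j i => (hDb j i).measurable) hDP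
  have hlow : ∀ᵐ ω ∂P, ∀ w, s * (a * (n * h) * lam) * (w ⬝ᵥ w) ≤
      w ⬝ᵥ condExpMatrix P (pastSigma φ ε k) X ω *ᵥ w := by
    filter_upwards [key, hcon', hexc,
      condExpMatrix_smul (P := P) (F := pastSigma φ ε k) (X := G) (a * (n * h))]
      with ω h1 h2 h3 h4 w
    have h5 : a * (n * h) * lam ≤ lambdaMin (condExpMatrix P (pastSigma φ ε k) Q ω) := by
      refine le_lambdaMin (condExpMatrix_isHermitian hQh ω) fun w' => ?_
      refine le_trans ?_ (h1 w')
      rw [h4, Matrix.smul_mulVec, dotProduct_smul, smul_eq_mul, mul_assoc _ lam]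
      refine mul_le_mul_of_nonneg_left ?_ (by positivity)
      exact (mul_le_mul_of_nonneg_right h3 (dotProduct_self_nonneg' w')).trans
        (lambdaMin_mul_le (condExpMatrix_isHermitian hGh ω) w')
    refine le_trans ?_ (lambdaMin_mul_le (condExpMatrix_isHermitian hXh ω) w)
    exact mul_le_mul_of_nonneg_right ((mul_le_mul_of_nonneg_left h5 hs).trans h2)
      (dotProduct_self_nonneg' w)
  obtain ⟨i1, i2⟩ := integral_dotProduct_condExpMatrix_mulVec hF hXb hz hz2
  have hz2i := integrable_dotProduct hz2 hz2
  have h6 : s * (a * (n * h) * lam) * ∫ ω, z ω ⬝ᵥ z ω ∂P ≤ ∫ ω, z ω ⬝ᵥ X ω *ᵥ z ω ∂P := by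
    rw [← i2, ← integral_const_mul]
    refine integral_mono_ae (hz2i.const_mul _) i1 ?_
    filter_upwards [hlow] with ω hω
    exact hω (z ω)
  have hTz := memLp_mulVec_apply hψ hz2
  have h7 : ∫ ω, z ω ⬝ᵥ X ω *ᵥ z ω ∂P = ∫ ω, z ω ⬝ᵥ z ω ∂P -
      ∫ ω, (transition (errorMatrix A β φ) k h ω *ᵥ z ω) ⬝ᵥ
        (transition (errorMatrix A β φ) k h ω *ᵥ z ω) ∂P := by
    simp only [transition_errorMatrix]
    rw [← integral_sub hz2i (integrable_dotProduct hTz hTz)]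
    refine integral_congr_ae (Eventually.of_forall fun ω => ?_)
    exact dotProduct_one_sub_gram_mulVec _ _
  linarith

end Instantiation

-- Excitation and noise bounds for the algorithm.

section Excitation

/-- A real infimum of a family unbounded below is 0 by convention; being above `c ≥ 0` rules this
out. -/
theorem le_of_lt_iInf {ι : Type*} {f : ι → ℝ} {c : ℝ} (hc : 0 ≤ c) (h : c < ⨅ i, f i) (i : ι) :
    c ≤ f i := by
  by_cases hb : BddBelow (Set.range f)
  · exact h.le.trans (ciInf_le hb i)
  · rw [Real.iInf_of_not_bddBelow hb] at h
    exact absurd h hc.not_gt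

variable {Ω : Type u} {n m : ℕ} [mΩ : MeasurableSpace Ω] {P : Measure Ω}
  {A : Matrix (Fin n) (Fin n) ℝ} {φ : ℕ → Fin n → Ω → EuclideanSpace ℝ (Fin m)}
  {ε : ℕ → Fin n → Ω → ℝ} {h : ℕ}

theorem le_excitationLevel {c α : ℝ} (hc : 0 ≤ c)
    (hexc : ∀ᵐ ω ∂P,
      c < ⨅ k : {k : ℕ // 1 ≤ k}, ((k : ℕ) : ℝ) ^ α * excitationLevel P φ ε h k ω)
    {k : ℕ} (hk : 1 ≤ k) : ∀ᵐ ω ∂P, c * (k : ℝ) ^ (-α) ≤ excitationLevel P φ ε h k ω := by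
  filter_upwards [hexc] with ω hω
  have h1 := le_of_lt_iInf hc hω ⟨k, hk⟩
  have hk0 : (0 : ℝ) < (k : ℝ) ^ α := Real.rpow_pos_of_pos (by exact_mod_cast hk) _
  rw [Real.rpow_neg (Nat.cast_nonneg k), ← div_eq_mul_inv, div_le_iff₀ hk0, mul_comm]
  exact h1

theorem exists_isNoiseFiltration_and_le_excitationLevel [IsProbabilityMeasure P] {M c α : ℝ} (hc : 0 < c)
    (hφ : ∀ k i, Measurable (φ k i)) (hε : ∀ k i, Measurable (ε k i))
    (hnoise : NoiseAssumption P φ ε M)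
    (hexc : (h = 1 ∧ OneStepExcitation P φ ε c α ∧ NoiseCenteredGivenPast P φ ε) ∨
      WindowExcitation P φ ε c α h) :
    ∃ H, IsNoiseFiltration P h φ ε H ∧
      ∀ k : ℕ, 1 ≤ k → ∀ᵐ ω ∂P, c * (k : ℝ) ^ (-α) ≤ excitationLevel P φ ε h k ω := by
  rcases hexc with ⟨rfl, h1, h2⟩ | hw
  · refine ⟨_, isNoiseFiltration_of_centeredGivenPast hφ hε h2, fun k hk => ?_⟩
    refine le_excitationLevel hc.le ?_ hk
    simpa [OneStepExcitation, excitationLevel] using h1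
  · exact ⟨_, isNoiseFiltration_of_indepFun hφ hε hnoise hw.independent h,
      fun k hk => le_excitationLevel hc.le hw.excitation hk⟩

/-- Within a window `k + h ≤ 2k`, and `2^(-β) ≥ 1/2`; this is the factor 2 in the contraction rate.
-/
theorem half_rpow_le_stepSize {β : ℝ} (hβ0 : 0 ≤ β) (hβ1 : β ≤ 1) {h k : ℕ} (hh : 1 ≤ h)
    (hk : h ≤ k) : (k : ℝ) ^ (-β) / 2 ≤ stepSize β (k + h - 1) := by
  have hk0 : (0 : ℝ) < k := by exact_mod_cast hh.trans hk
  rw [stepSize_eq, Nat.sub_add_cancel (by omega)]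
  have h0 : ((k + h : ℕ) : ℝ) ≤ 2 * k := by exact_mod_cast (by omega : k + h ≤ 2 * k)
  have h1 : ((2 : ℝ) * k) ^ (-β) ≤ ((k + h : ℕ) : ℝ) ^ (-β) :=
    Real.rpow_le_rpow_of_nonpos (by exact_mod_cast (by omega : 0 < k + h)) h0 (by linarith)
  have h2 : (2 : ℝ) ^ (-1 : ℝ) ≤ 2 ^ (-β) :=
    Real.rpow_le_rpow_of_exponent_le (by norm_num) (by linarith)
  rw [Real.mul_rpow (by norm_num) hk0.le] at h1
  rw [Real.rpow_neg_one] at h2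
  have h3 := mul_le_mul_of_nonneg_right h2 (Real.rpow_nonneg hk0.le (-β))
  linarith

theorem eventually_isContractingAt_errorMatrix [IsProbabilityMeasure P] (hn : 1 ≤ n)
    (hm : 1 ≤ m) {α β c : ℝ} (hc : 0 < c) (hβ0 : 0 ≤ β) (hβ1 : β ≤ 1) (hh : 1 ≤ h) (hφ : ∀ k i, Measurable (φ k i))
    (hε : ∀ k i, Measurable (ε k i)) {s : ℝ} (hs : 0 ≤ s)
    (hcon : IsContractionConstant.{u} A h s)
    (hexc : ∀ k : ℕ, 1 ≤ k → ∀ᵐ ω ∂P, c * (k : ℝ) ^ (-α) ≤ excitationLevel P φ ε h k ω) :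
    ∀ᶠ k : ℕ in atTop, IsContractiveRecursion.IsContractingAt P h (pastSigma φ ε)
      (errorMatrix A β φ) k (s * n * h * c / 2 * (k : ℝ) ^ (-(α + β))) := by
  filter_upwards [eventually_ge_atTop h] with k hk z hz hz2
  have hk0 : (0 : ℝ) < k := by exact_mod_cast hh.trans hk
  refine (isContractingAt_errorMatrix hn hm hβ0 hh hφ hε hs hcon (hexc k (hh.trans hk))
    z hz hz2).trans ?_
  have h0 : 0 ≤ ∫ ω, z ω ⬝ᵥ z ω ∂P := integral_nonneg fun ω => dotProduct_self_nonneg' _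
  refine mul_le_mul_of_nonneg_right (sub_le_sub_left ?_ _) h0
  have h1 : 0 ≤ (s * n * h * c) * (k : ℝ) ^ (-α) := by positivity
  have h2 := mul_le_mul_of_nonneg_left (half_rpow_le_stepSize hβ0 hβ1 hh hk) h1
  rw [neg_add, Real.rpow_add hk0]
  linarith

theorem integral_noise_sq_le [IsProbabilityMeasure P] {M : ℝ} (hφ : ∀ k i, Measurable (φ k i))
    (hnoise : NoiseAssumption P φ ε M) {k : ℕ} (hk : 1 ≤ k) :
    ∫ ω, (fun i => ε k i ω) ⬝ᵥ (fun i => ε k i ω) ∂P ≤ n * M := by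
  simp only [dotProduct_self_sum]
  rw [integral_finsetSum _ fun i _ => (hnoise.memLp k i).integrable_sq]
  refine (Finset.sum_le_card_nsmul _ _ M fun i _ => ?_).trans (by simp)
  rw [← integral_condExp (regressorSigma_le (k := k) fun j _ i => hφ j i)]
  refine (integral_mono_ae integrable_condExp (integrable_const M)
    (hnoise.variance_le k hk i)).trans (by simp)

end Excitation

-- Limits from eventual bounds.

section Limits

theorem limsup_coe_le_of_eventually_le_add {u : ℕ → ℝ} {L : ℝ}
    (hu : ∀ η : ℝ, 0 < η → ∀ᶠ k in atTop, u k ≤ L + η) :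
    limsup (fun k => (u k : EReal)) atTop ≤ (L : EReal) := by
  refine le_of_forall_gt_imp_ge_of_dense fun b hb => ?_
  obtain ⟨r, hr1, hr2⟩ := EReal.lt_iff_exists_real_btwn.1 hb
  refine le_trans (limsup_le_of_le (by isBoundedDefault) ?_) hr2.le
  have hr : L < r := EReal.coe_lt_coe_iff.1 hr1
  filter_upwards [hu (r - L) (by linarith)] with k hk
  exact EReal.coe_le_coe_iff.2 (by linarith)

theorem tendsto_zero_of_rpow_mul_le {u : ℕ → ℝ} (hu0 : ∀ k, 0 ≤ u k) {γ C : ℝ} (hγ : 0 < γ)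
    (hu : ∀ᶠ k : ℕ in atTop, (k : ℝ) ^ γ * u k ≤ C) : Tendsto u atTop (𝓝 0) := by
  have h1 : Tendsto (fun k : ℕ => C * (k : ℝ) ^ (-γ)) atTop (𝓝 (C * 0)) :=
    ((tendsto_rpow_neg_atTop hγ).comp tendsto_natCast_atTop_atTop).const_mul C
  rw [mul_zero] at h1
  refine tendsto_of_tendsto_of_tendsto_of_le_of_le' tendsto_const_nhds h1
    (Eventually.of_forall hu0) ?_
  filter_upwards [hu, eventually_gt_atTop 0] with k hk hk0
  have hk0' : (0 : ℝ) < (k : ℝ) ^ γ := Real.rpow_pos_of_pos (by exact_mod_cast hk0) _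
  rw [Real.rpow_neg (Nat.cast_nonneg k), ← div_eq_mul_inv, le_div_iff₀ hk0', mul_comm]
  exact hk

theorem isLittleO_rpow_neg_of_tendsto {u : ℕ → ℝ} {δ : ℝ}
    (hu : Tendsto (fun k : ℕ => (k : ℝ) ^ δ * u k) atTop (𝓝 0)) :
    u =o[atTop] fun k : ℕ => (k : ℝ) ^ (-δ) := by
  refine (Asymptotics.isLittleO_iff_tendsto' ?_).2 ?_
  · filter_upwards [eventually_gt_atTop 0] with k hk h0
    exact absurd h0 (Real.rpow_pos_of_pos (by exact_mod_cast hk) _).ne'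
  · refine hu.congr fun k => ?_
    rw [Real.rpow_neg (Nat.cast_nonneg k), div_inv_eq_mul, mul_comm]

end Limits

-- Truncation by conditional moments.

section Moments

variable {Ω : Type*} [mΩ : MeasurableSpace Ω] {P : Measure Ω}

theorem measurableSet_condExp_le (F : MeasurableSpace Ω) (f : Ω → ℝ) (N : ℝ) :
    MeasurableSet[F] {ω | (P[f | F]) ω ≤ N} :=
  (stronglyMeasurable_condExp (f := f) (m := F) (μ := P)).measurable measurableSet_Iic

/-- Truncating where a conditional expectation is at most `N` bounds the truncated integral. -/
theorem setIntegral_condExp_le_le [IsProbabilityMeasure P] {F : MeasurableSpace Ω} (hF : F ≤ mΩ)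
    {f : Ω → ℝ} (hf : Integrable f P) {N : ℝ} (hN : 0 ≤ N) :
    ∫ ω in {ω | (P[f | F]) ω ≤ N}, f ω ∂P ≤ N := by
  have hE : MeasurableSet[F] {ω | (P[f | F]) ω ≤ N} :=
    measurableSet_condExp_le (mΩ := mΩ) F f N
  rw [← setIntegral_condExp hF hf hE]
  calc ∫ ω in {ω | (P[f | F]) ω ≤ N}, (P[f | F]) ω ∂P
      ≤ ∫ _ω in {ω | (P[f | F]) ω ≤ N}, N ∂P :=
        setIntegral_mono_on integrable_condExp.integrableOn (integrable_const N).integrableOn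
          (hF _ hE) fun ω hω => hω
    _ ≤ N := by
        rw [setIntegral_const, smul_eq_mul]
        exact mul_le_of_le_one_left hN measureReal_le_one

end Moments

end DiffusionRM

-- The main theorem.

theorem theorem5
    {n m : ℕ} (hn : 1 ≤ n) (hm : 1 ≤ m)
    (A : Matrix (Fin n) (Fin n) ℝ) (hA : DiffusionRM.NetworkAssumption A)
    {Ω : Type u} [MeasurableSpace Ω] (P : Measure Ω) [IsProbabilityMeasure P]
    (θ : EuclideanSpace ℝ (Fin m)) (θ₀ : Fin n → EuclideanSpace ℝ (Fin m))
    (φ : ℕ → Fin n → Ω → EuclideanSpace ℝ (Fin m)) (ε : ℕ → Fin n → Ω → ℝ)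
    (hφ : ∀ k i, Measurable (φ k i)) (hε : ∀ k i, Measurable (ε k i))
    (M : ℝ) (hM : 0 < M) (hnoise : DiffusionRM.NoiseAssumption P φ ε M)
    (c α β : ℝ) (hc : 0 < c) (hα : α ∈ Set.Ico (0 : ℝ) (1 / 2))
    (hβ : β ∈ Set.Ioo (1 / 2 : ℝ) (1 - α))
    (h : ℕ) (hh : 1 ≤ h)
    (hexc : (h = 1 ∧ DiffusionRM.OneStepExcitation P φ ε c α ∧
        DiffusionRM.NoiseCenteredGivenPast P φ ε) ∨
      DiffusionRM.WindowExcitation P φ ε c α h) :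
    -- mean-square and almost sure convergence
    ((∀ k, Integrable (fun ω => ‖DiffusionRM.stackedError A β θ θ₀ φ ε k ω‖ ^ 2) P) ∧
      Tendsto (fun k => ∫ ω, ‖DiffusionRM.stackedError A β θ θ₀ φ ε k ω‖ ^ 2 ∂P) atTop (𝓝 0) ∧
      ∀ᵐ ω ∂P, Tendsto (fun k => ‖DiffusionRM.stackedError A β θ θ₀ φ ε k ω‖) atTop (𝓝 0)) ∧
    -- mean-square convergence rate
    ((∃ s : ℝ, 0 < s ∧ s < 1 ∧ DiffusionRM.IsContractionConstant.{u} A h s) ∧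
      ∀ s : ℝ, 0 < s → s < 1 → DiffusionRM.IsContractionConstant.{u} A h s →
        limsup (fun k : ℕ => (((k : ℝ) ^ (β - α) *
            ∫ ω, ‖DiffusionRM.stackedError A β θ θ₀ φ ε k ω‖ ^ 2 ∂P : ℝ) : EReal)) atTop ≤
          ((M / (s * c) : ℝ) : EReal)) ∧
    -- almost sure convergence rate
    (∀ l : ℝ, 1 / (β - α) < l → DiffusionRM.BoundedNoiseMoments P φ ε l →
      ∀ δ ∈ Set.Ioo (0 : ℝ) (β - α - 1 / (l + 1)), ∀ᵐ ω ∂P,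
        (fun k : ℕ => ‖DiffusionRM.stackedError A β θ θ₀ φ ε k ω‖ ^ 2) =o[atTop]
          (fun k : ℕ => (k : ℝ) ^ (-δ))) := by
  open DiffusionRM in
  obtain ⟨hα0, hα1⟩ := hα
  obtain ⟨hβ0, hβ1⟩ := hβ
  obtain ⟨H, hH, hlev⟩ :=
    exists_isNoiseFiltration_and_le_excitationLevel hc hφ hε hnoise hexc
  have hx := isContractiveRecursion_errorVec hA.doublyStochastic (by linarith : (0 : ℝ) ≤ β) θ θ₀
    hh hH hnoise.memLp
  have hcontr : ∀ s : ℝ, 0 < s → IsContractionConstant.{u} A h s → _ := fun s hs hcon =>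
    eventually_isContractingAt_errorMatrix (P := P) (φ := φ) (ε := ε) (α := α) (β := β)
      hn hm hc (by linarith) (by linarith) hh hφ hε hs.le hcon hlev
  have hn0 : (0 : ℝ) < n := by exact_mod_cast hn
  have hh0 : (0 : ℝ) < h := by exact_mod_cast hh
  have hb : ∀ s : ℝ, 0 < s → 0 < s * n * h * c / 2 := fun s hs => by positivity
  have hv := fun (k : ℕ) (hk : 1 ≤ k) => integral_noise_sq_le hφ hnoise hk
  have hstep0 : ∀ k, 0 ≤ stepSize β k := stepSize_nonneg β
  have hstep : ∀ k : ℕ, 1 ≤ k → stepSize β k ≤ (k : ℝ) ^ (-β) := fun k hk =>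
    stepSize_le (by linarith) hk
  have hrate : ∀ s : ℝ, 0 < s → IsContractionConstant.{u} A h s → ∀ η : ℝ, 0 < η →
      ∀ᶠ k : ℕ in atTop, (k : ℝ) ^ (β - α) *
        ∫ ω, ‖stackedError A β θ θ₀ φ ε k ω‖ ^ 2 ∂P ≤ M / (s * c) + η := by
    intro s hs hcon η hη
    have := hx.eventually_rpow_mul_integral_le (by linarith) (by linarith : 0 < α + β)
      (by linarith) (by linarith) (hb s hs) (by positivity) hstep0 hstep (hcontr s hs hcon) hv hη
    have e1 : 2 * β - (α + β) = β - α := by ring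
    -- The number of nodes and the window length cancel, since noise energy and excitation both
    -- scale with `n * h`.
    have e2 : 2 * (h * (n * M / 4)) / (s * n * h * c / 2) = M / (s * c) := by
      field_simp
      ring
    rw [e1, e2] at this
    simpa only [norm_sq_stackedError] using this
  obtain ⟨s₀, hs₀, hs₀1, hcon₀⟩ := exists_isContractionConstant.{u} hn hA h
  refine ⟨⟨fun k => ?_, ?_, ?_⟩, ⟨⟨s₀, hs₀, hs₀1, hcon₀⟩, fun s hs _ hcon =>
    limsup_coe_le_of_eventually_le_add (hrate s hs hcon)⟩, ?_⟩
  · simp only [norm_sq_stackedError]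
    exact integrable_dotProduct (hx.memLp_x k) (hx.memLp_x k)
  · exact tendsto_zero_of_rpow_mul_le (fun k => integral_nonneg fun ω => sq_nonneg _)
      (by linarith : 0 < β - α) (hrate s₀ hs₀ hcon₀ 1 one_pos)
  -- With `l = 1`, `δ = 0` and no truncation, the summability condition reads `2β > 1`.
  · have := hx.ae_tendsto_rpow_mul (l := 1) (δ := 0) (M := n * M) (E := fun _ => Set.univ)
      (by linarith) (by linarith : 0 < α + β) (by linarith) (hb s₀ hs₀) (by positivity) le_rfl
      le_rfl (by linarith) (by linarith) hstep0 hstep (hcontr s₀ hs₀ hcon₀)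
      (fun _ => MeasurableSet.univ) (fun _ _ _ => MeasurableSet.univ)
      (fun k _ => by
        simpa only [Real.rpow_one, integrableOn_univ] using
          integrable_dotProduct (hnoise.memLp k) (hnoise.memLp k))
      (fun k hk => by simpa only [Real.rpow_one, Measure.restrict_univ] using hv k hk)
    filter_upwards [this] with ω hω
    have h1 := (hω fun _ _ => Set.mem_univ _).sqrt
    simpa only [Real.rpow_zero, one_mul, ← norm_sq_stackedError, Real.sqrt_sq (norm_nonneg _),
      Real.sqrt_zero] using h1
  · rintro l hl hmom δ ⟨hδ0, hδ1⟩
    have hγ : 0 < β - α := by linarith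
    have hl1 : 1 < l := lt_of_lt_of_le (by rw [lt_div_iff₀ hγ]; linarith) hl.le
    have hl0 : 0 < l + 1 := by linarith
    -- The choice of `δ` makes the first term exceed `l/(l + 1)`, and `α + β > 1/2 > 1/(l + 1)`
    -- supplies the rest.
    have hδl : 1 < (2 * β - (α + β) - δ) * l + (α + β) := by
      have h1 : 1 / (l + 1) * (l + 1) = 1 := by field_simp
      have h2 : 1 < (β - α) * l := by rwa [div_lt_iff₀ hγ, mul_comm] at hl
      have h3 : 1 / (l + 1) * l < (2 * β - (α + β) - δ) * l :=
        mul_lt_mul_of_pos_right (by linarith) (by linarith)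
      have h4 : 1 / (l + 1) < α + β := by
        rw [div_lt_iff₀ hl0]
        nlinarith
      linarith
    -- The conditional moments are bounded only by a random constant, so the rate is proved on each
    -- event where they stay below `N`; almost every outcome lies in one of these events.
    have key := fun N : ℕ => hx.ae_tendsto_rpow_mul (l := l) (δ := δ) (M := N)
      (E := fun j => {ω | (P[fun ω' => (∑ i, ε j i ω' ^ 2) ^ l | regressorSigma φ j]) ω ≤ N})
      (by linarith) (by linarith : 0 < α + β) (by linarith) (hb s₀ hs₀) (by positivity) hl1.le
      hδ0.le (by have : 0 < 1 / (l + 1) := by positivity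
                 linarith) hδl hstep0 hstep (hcontr s₀ hs₀ hcon₀)
      (fun j => regressorSigma_le_pastSigma j _ (measurableSet_condExp_le _ _ _))
      (fun k j hj => hH.regressorSigma_le k j hj _ (measurableSet_condExp_le _ _ _))
      (fun k hk => by
        simp only [dotProduct_self_sum]
        exact (hmom.integrable k hk).integrableOn)
      (fun k hk => by
        simp only [dotProduct_self_sum]
        exact setIntegral_condExp_le_le (regressorSigma_le fun j _ i => hφ j i)
          (hmom.integrable k hk) (Nat.cast_nonneg N))
    filter_upwards [ae_all_iff.2 key, hmom.bounded] with ω hω ⟨K, hK⟩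
    obtain ⟨N, hN⟩ := exists_nat_ge K
    refine isLittleO_rpow_neg_of_tendsto ?_
    simp only [norm_sq_stackedError]
    exact hω N fun j hj => (hK ⟨⟨j, hj⟩, rfl⟩).trans hN
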